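/- For every constant $c$ there are a constant $K$ and a deterministic (computable) multipass streaming algorithm that solves $(\text{degree}+1)$-list-coloring in the following sense. Let $C$ be a set of colors with $|C|\le c\,n^2$, let $G$ be an $n$-vertex graph with maximum degree $\Delta$, and let each vertex $x$ have a list $L_x\subseteq C$ with $|L_x|\ge\deg(x)+1$. The input is a stream whose tokens are the edges of $G$ and the pairs $(x,L_x)$, each occurring exactly once, interleaved in any order; the algorithm knows $n$ and $C$ in advance, and reads the same stream in every pass. Then the algorithm outputs a proper coloring $\chi$ of $G$ with $\chi(x)\in L_x$ for every vertex $x$. Its memory, measured before and after each token that it reads and at the end of each pass, never exceeds $K\,(1+n\log^2 n)$ bits, that is, $O(n\log^2 n)$ bits, and it makes at most $K\,(1+\log\Delta\,\log\log\Delta)$ passes, that is, $O(\log\Delta\log\log\Delta)$ passes. (Logarithms are to base $2$; the product $\log\Delta\,\log\log\Delta$ is read as $0$ when $\Delta\le 1$.) -/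

import Mathlib

/-- A token of the input stream of a list-coloring instance with vertex set `Fin n` and color set
`Fin m`: an (unordered) edge `{u, v}`, or a pair `(x, S)` giving the list `S` of vertex `x`. -/
inductive StreamToken (n m : ℕ) : Type
  | edge (e : Sym2 (Fin n)) : StreamToken n m
  | list (x : Fin n) (S : Finset (Fin m)) : StreamToken n m

/-- The concrete form in which an algorithm reads a token: an edge as the pair of its endpoints,
a pair `(x, S)` as `x` followed by the elements of `S`. -/
def StreamToken.code {n m : ℕ} : StreamToken n m → (ℕ × ℕ) ⊕ (ℕ × List ℕ)
  | .edge e => Sum.inl ((e.inf : Fin n).val, (e.sup : Fin n).val)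
  | .list x S => Sum.inr (x.val, (S.sort (· ≤ ·)).map Fin.val)

/-- The tokens describing the graph `G` with the lists `L`: the edges `e` of `G` and the
pairs `(x, L x)`. -/
def StreamToken.Describes {n m : ℕ} (G : SimpleGraph (Fin n)) (L : Fin n → Finset (Fin m)) :
    StreamToken n m → Prop
  | .edge e => e ∈ G.edgeSet
  | .list x S => S = L x

/-- `σ` is an input stream for `(G, L)`: it consists of all edges of `G` and all pairs `(x, L x)`,
each occurring exactly once, interleaved in an arbitrary order. -/
def IsInputStream {n m : ℕ} (G : SimpleGraph (Fin n)) (L : Fin n → Finset (Fin m))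
    (σ : List (StreamToken n m)) : Prop :=
  σ.Nodup ∧ ∀ t, t ∈ σ ↔ t.Describes G L

/-- A deterministic multipass streaming algorithm for list coloring. It is one algorithm for all
inputs, and is told the number `n` of vertices and the number `m` of colors (the pair `(n, m)`),
but nothing else about the input. Its memory is a string of bits. `init` is the
memory content at the start, `read` updates the memory when a token is read, `endPass` updates
it at the end of a pass, and `output`, evaluated after each pass, is `none` if another pass is to
be made, and `some` of the list of the colors of the vertices `0, 1, …, n - 1` if the algorithm
stops. All of these have to be computable functions. -/
structure StreamingAlgorithm where
  init : ℕ × ℕ → List Bool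
  read : (ℕ × ℕ) × List Bool × ((ℕ × ℕ) ⊕ (ℕ × List ℕ)) → List Bool
  endPass : (ℕ × ℕ) × List Bool → List Bool
  output : (ℕ × ℕ) × List Bool → Option (List ℕ)
  computable_init : Computable init
  computable_read : Computable read
  computable_endPass : Computable endPass
  computable_output : Computable output

namespace StreamingAlgorithm

/-- The memory content after reading the tokens `τ`, one after the other, from memory `q`. -/
def readAll (A : StreamingAlgorithm) {n m : ℕ} (τ : List (StreamToken n m)) (q : List Bool) : List Bool :=
  τ.foldl (fun q t => A.read ((n, m), q, t.code)) q

/-- The memory content after `i` complete passes over the stream `σ`. -/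
def afterPasses (A : StreamingAlgorithm) {n m : ℕ} (σ : List (StreamToken n m)) :
    ℕ → List Bool
  | 0 => A.init (n, m)
  | i + 1 => A.endPass ((n, m), A.readAll σ (A.afterPasses σ i))

/-- On the stream `σ`, the algorithm stops after exactly `p ≥ 1` passes with output `out`. -/
def StopsWith (A : StreamingAlgorithm) {n m : ℕ} (σ : List (StreamToken n m))
    (p : ℕ) (out : List ℕ) : Prop :=
  1 ≤ p ∧ A.output ((n, m), A.afterPasses σ p) = some out ∧
    ∀ i, 1 ≤ i → i < p → A.output ((n, m), A.afterPasses σ i) = none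

/-- In its first `p` passes over `σ`, the memory never holds more than `s` bits: neither
after reading any initial segment `τ` of the stream in any of these passes (`τ = []` being the
start of the pass), nor after the last of them. -/
def UsesSpaceAtMost (A : StreamingAlgorithm) {n m : ℕ} (σ : List (StreamToken n m))
    (p : ℕ) (s : ℝ) : Prop :=
  (∀ i < p, ∀ τ, τ <+: σ → ((A.readAll τ (A.afterPasses σ i)).length : ℝ) ≤ s) ∧
    ((A.afterPasses σ p).length : ℝ) ≤ s

end StreamingAlgorithm

/-!
# Deterministic streaming algorithm for (degree + 1)-list coloring

Let `D` be the maximum degree plus one; only the first `D` colors of each list matter. The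
algorithm derandomizes the following trial coloring of a set `U` of uncolored vertices, the
*active* ones. Every pass but the last computes a vector of `O(n)` counters, each of which is a sum
over the tokens of the stream and fits into `O(log n)` bits.

* *Cells.* A pairwise independent hash function divides the colors into `4 * D ^ 3` cells. Its seed
  is chosen so that the lists in which two colors share a cell belong to at most `n / D` vertices
  (`average_collisions_le`, `run_first`); these are set aside. For all others, choosing a color from
  the list amounts to choosing a cell.
* *Stages.* The cell of an active vertex is chosen little by little, as a residue modulo `q ^ t`
  for `t = 1, 2, …`, where `q = n / |U| + 1` is the splitting factor. The slack of a vertex for a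
  residue is the number of colors of its list in cells with this residue, minus the number of its
  neighbors already colored from such cells. One pass counts the slacks of all `q` refinements of
  all active vertices; these are only `|U| * q ≤ 2 * n` numbers. Choosing refinements with
  probabilities proportional to the slacks, by means of a pairwise independent hash function, the
  expectation of the potential `∑ (1 / s u + 1 / s v)` over the edges `uv` of `U` with equal
  residues hardly grows (`average_edgeCost_le`).
* *Seeds.* A seed has thirteen digits in base `b = O(n)`. A good one is found by the method of
  conditional expectations, one digit per pass, with one counter for each value of the digit
  (`GoodPrefix.succ`). Hence a stage takes `14` passes (`Counting.run_refine`).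
* *Epochs.* The potential is at most about `|U|` at first, since the slack of a vertex for the
  residue modulo `1` exceeds the number of its active neighbors. When the residues determine the
  cells, all slacks are `1`, so at most `3 / 4 * |U|` edges are left whose ends have the same
  residue. The vertices that are not the larger end of such an edge are colored: at least
  a quarter of them (`Committing.commit`).
* *End.* Once `|U| * D ≤ n`, the edges and lists of all uncolored vertices have size `O(n)` and are
  stored in one pass; the greedy algorithm does the rest (`Finishing.run`).

After `e` epochs `q` is at least `(4 / 3) ^ e`, so the next one has `O(log D / (e + 1))` stages
(`Starting.stages_le`). There are `O(log D)` epochs, and the harmonic sum gives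
`O(log D * log (log D))` passes in all (`run_finishing`, `exists_epochs`).
-/

namespace ListColoring

/-! ### Primitive recursive functions and `fun_prop` -/

attribute [fun_prop] Primrec
attribute [fun_prop] PrimrecPred

section Primrec

variable {α β γ : Type*} [Primcodable α] [Primcodable β] [Primcodable γ]

@[fun_prop]
theorem primrec_id : Primrec fun a : α => a := Primrec.id

@[fun_prop]
theorem primrec_const (b : β) : Primrec fun _ : α => b := Primrec.const b

@[fun_prop]
theorem primrec_comp {f : β → γ} {g : α → β} (hf : Primrec f) (hg : Primrec g) :
    Primrec fun a => f (g a) := hf.comp hg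

@[fun_prop]
theorem primrec_fst {f : α → β × γ} (hf : Primrec f) : Primrec fun a => (f a).1 :=
  Primrec.fst.comp hf

@[fun_prop]
theorem primrec_snd {f : α → β × γ} (hf : Primrec f) : Primrec fun a => (f a).2 :=
  Primrec.snd.comp hf

@[fun_prop]
theorem primrec_prodMk {f : α → β} {g : α → γ} (hf : Primrec f) (hg : Primrec g) :
    Primrec fun a => (f a, g a) := hf.pair hg

@[fun_prop]
theorem primrec_some {f : α → β} (hf : Primrec f) : Primrec fun a => some (f a) :=
  Primrec.option_some.comp hf

section Nat

variable {f g : α → ℕ}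

@[fun_prop]
theorem primrec_add (hf : Primrec f) (hg : Primrec g) : Primrec fun a => f a + g a :=
  Primrec.nat_add.comp hf hg

@[fun_prop]
theorem primrec_sub (hf : Primrec f) (hg : Primrec g) : Primrec fun a => f a - g a :=
  Primrec.nat_sub.comp hf hg

@[fun_prop]
theorem primrec_mul (hf : Primrec f) (hg : Primrec g) : Primrec fun a => f a * g a :=
  Primrec.nat_mul.comp hf hg

@[fun_prop]
theorem primrec_div (hf : Primrec f) (hg : Primrec g) : Primrec fun a => f a / g a :=
  Primrec.nat_div.comp hf hg

@[fun_prop]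
theorem primrec_mod (hf : Primrec f) (hg : Primrec g) : Primrec fun a => f a % g a :=
  Primrec.nat_mod.comp hf hg

@[fun_prop]
theorem primrec_pow (hf : Primrec f) (hg : Primrec g) : Primrec fun a => f a ^ g a :=
  (Primrec₂.unpaired'.1 Nat.Primrec.pow).comp hf hg

@[fun_prop]
theorem primrec_min (hf : Primrec f) (hg : Primrec g) : Primrec fun a => min (f a) (g a) :=
  Primrec.nat_min.comp hf hg

@[fun_prop]
theorem primrec_max (hf : Primrec f) (hg : Primrec g) : Primrec fun a => max (f a) (g a) :=
  Primrec.nat_max.comp hf hg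

@[fun_prop]
theorem primrec_natPair (hf : Primrec f) (hg : Primrec g) :
    Primrec fun a => Nat.pair (f a) (g a) := Primrec₂.natPair.comp hf hg

@[fun_prop]
theorem primrec_sum_range {g : α → ℕ → ℕ} (hf : Primrec f)
    (hg : Primrec fun p : α × ℕ => g p.1 p.2) :
    Primrec fun a => ∑ i ∈ Finset.range (f a), g a i := by
  refine (Primrec.nat_rec' (g := fun _ => 0) (h := fun a p => p.2 + g a p.1) hf
    (Primrec.const 0) ?_).of_eq fun a => ?_
  · exact Primrec.nat_add.comp (Primrec.snd.comp Primrec.snd)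
      (hg.comp (Primrec.fst.pair (Primrec.fst.comp Primrec.snd)))
  · induction f a with
    | zero => simp
    | succ k ih => rw [Finset.sum_range_succ, ← ih]

@[fun_prop]
theorem primrec_findGreatest {p : α → ℕ → Prop} [∀ a, DecidablePred (p a)] (hf : Primrec f)
    (hp : PrimrecPred fun x : α × ℕ => p x.1 x.2) :
    Primrec fun a => Nat.findGreatest (p a) (f a) :=
  Primrec.nat_findGreatest (p := p) hf hp.primrecRel

end Nat

section Pred

variable {p q : α → Prop}

@[fun_prop]
theorem primrecPred_eq {f g : α → β} (hf : Primrec f) (hg : Primrec g) :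
    PrimrecPred fun a => f a = g a := Primrec.eq.comp hf hg

@[fun_prop]
theorem primrecPred_lt {f g : α → ℕ} (hf : Primrec f) (hg : Primrec g) :
    PrimrecPred fun a => f a < g a := Primrec.nat_lt.comp hf hg

@[fun_prop]
theorem primrecPred_le {f g : α → ℕ} (hf : Primrec f) (hg : Primrec g) :
    PrimrecPred fun a => f a ≤ g a := Primrec.nat_le.comp hf hg

@[fun_prop]
theorem primrecPred_not (hp : PrimrecPred p) : PrimrecPred fun a => ¬ p a := hp.not

@[fun_prop]
theorem primrecPred_and (hp : PrimrecPred p) (hq : PrimrecPred q) :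
    PrimrecPred fun a => p a ∧ q a := hp.and hq

@[fun_prop]
theorem primrecPred_or (hp : PrimrecPred p) (hq : PrimrecPred q) :
    PrimrecPred fun a => p a ∨ q a := hp.or hq

@[fun_prop]
theorem primrecPred_imp (hp : PrimrecPred p) (hq : PrimrecPred q) :
    PrimrecPred fun a => p a → q a := (hp.not.or hq).of_eq fun _ => imp_iff_not_or.symm

@[fun_prop]
theorem primrec_ite [DecidablePred p] {f g : α → β} (hp : PrimrecPred p) (hf : Primrec f)
    (hg : Primrec g) : Primrec fun a => if p a then f a else g a := Primrec.ite hp hf hg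

@[fun_prop]
theorem primrecPred_forall_lt {r : α → ℕ → Prop} {f : α → ℕ} (hf : Primrec f)
    (hr : PrimrecPred fun x : α × ℕ => r x.1 x.2) : PrimrecPred fun a => ∀ i < f a, r a i := by
  classical
  have h : PrimrecPred fun a => (∑ i ∈ Finset.range (f a), if r a i then 0 else 1) = 0 := by
    refine primrecPred_eq (primrec_sum_range hf ?_) (by fun_prop)
    exact Primrec.ite hr (Primrec.const 0) (Primrec.const 1)
  refine h.of_eq fun a => ?_
  simp [Finset.sum_eq_zero_iff]

@[fun_prop]
theorem primrecPred_mem {f : α → β} {l : α → List β} (hf : Primrec f) (hl : Primrec l) :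
    PrimrecPred fun a => f a ∈ l a :=
  ((PrimrecRel.exists_mem_list (Primrec.eq (α := β))).comp hl hf).of_eq fun a => by simp

@[fun_prop]
theorem primrecPred_prime {f : α → ℕ} (hf : Primrec f) : PrimrecPred fun a => (f a).Prime := by
  have h : PrimrecPred fun k : ℕ => 2 ≤ k ∧ ∀ i < k, k % i = 0 → i = 1 := by fun_prop
  refine (h.comp hf).of_eq fun a => ?_
  simp only [Nat.prime_def_lt, Nat.dvd_iff_mod_eq_zero]

end Pred

section List

variable {l l' : α → List β}

@[fun_prop]
theorem primrec_cons {f : α → β} (hf : Primrec f) (hl : Primrec l) :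
    Primrec fun a => f a :: l a := Primrec.list_cons.comp hf hl

@[fun_prop]
theorem primrec_append (hl : Primrec l) (hl' : Primrec l') : Primrec fun a => l a ++ l' a :=
  Primrec.list_append.comp hl hl'

@[fun_prop]
theorem primrec_length (hl : Primrec l) : Primrec fun a => (l a).length :=
  Primrec.list_length.comp hl

@[fun_prop]
theorem primrec_getD {i : α → ℕ} (hl : Primrec l) (hi : Primrec i) (d : β) :
    Primrec fun a => (l a).getD (i a) d := (Primrec.list_getD d).comp hl hi

@[fun_prop]
theorem primrec_take {i : α → ℕ} (hi : Primrec i) (hl : Primrec l) :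
    Primrec fun a => (l a).take (i a) := Primrec.list_take.comp hi hl

@[fun_prop]
theorem primrec_idxOf [DecidableEq β] {f : α → β} (hf : Primrec f) (hl : Primrec l) :
    Primrec fun a => (l a).idxOf (f a) :=
  (Primrec.list_idxOf.comp hf hl).of_eq fun a => by congr

@[fun_prop]
theorem primrec_range {f : α → ℕ} (hf : Primrec f) : Primrec fun a => List.range (f a) :=
  Primrec.list_range.comp hf

@[fun_prop]
theorem primrec_map {g : α → β → γ} (hl : Primrec l) (hg : Primrec fun p : α × β => g p.1 p.2) :
    Primrec fun a => (l a).map (g a) := Primrec.list_map hl hg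

@[fun_prop]
theorem primrec_flatMap {g : α → β → List γ} (hl : Primrec l)
    (hg : Primrec fun p : α × β => g p.1 p.2) :
    Primrec fun a => (l a).flatMap (g a) := Primrec.list_flatMap hl hg

@[fun_prop]
theorem primrec_filter {p : α → β → Prop} [∀ a, DecidablePred (p a)] (hl : Primrec l)
    (hp : PrimrecPred fun x : α × β => p x.1 x.2) :
    Primrec fun a => (l a).filter fun b => decide (p a b) := by
  refine (primrec_flatMap (g := fun a b => if p a b then [b] else []) hl (by fun_prop)).of_eq
    fun a => ?_
  induction l a with
  | nil => rfl
  | cons b t ih => by_cases h : p a b <;> simp [h, ih]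

@[fun_prop]
theorem primrec_foldl {f : α → γ} {g : α → γ → β → γ} (hl : Primrec l) (hf : Primrec f)
    (hg : Primrec fun p : α × (γ × β) => g p.1 p.2.1 p.2.2) :
    Primrec fun a => (l a).foldl (g a) (f a) :=
  Primrec.list_foldl (h := fun a p => g a p.1 p.2) hl hf hg.to₂

@[fun_prop]
theorem primrec_foldr {f : α → γ} {g : α → β → γ → γ} (hl : Primrec l) (hf : Primrec f)
    (hg : Primrec fun p : α × (β × γ) => g p.1 p.2.1 p.2.2) :
    Primrec fun a => (l a).foldr (g a) (f a) :=
  Primrec.list_foldr (h := fun a p => g a p.1 p.2) hl hf hg.to₂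

@[fun_prop]
theorem primrec_set {i : α → ℕ} {f : α → β} (hl : Primrec l) (hi : Primrec i) (hf : Primrec f) :
    Primrec fun a => (l a).set (i a) (f a) := Primrec.list_set.comp hl (hi.pair hf)

@[fun_prop]
theorem primrec_replicate {i : α → ℕ} {f : α → β} (hi : Primrec i) (hf : Primrec f) :
    Primrec fun a => List.replicate (i a) (f a) :=
  (primrec_map (g := fun a _ => f a) (primrec_range hi) (by fun_prop)).of_eq fun a => by
    simp

@[fun_prop]
theorem primrec_sum {l : α → List ℕ} (hl : Primrec l) : Primrec fun a => (l a).sum :=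
  Primrec.list_foldr hl (Primrec.const 0) (h := fun _ p => p.1 + p.2) (by
    unfold Primrec₂; fun_prop)

@[fun_prop]
theorem primrec_headI [Inhabited β] (hl : Primrec l) : Primrec fun a => (l a).headI :=
  Primrec.list_headI.comp hl

@[fun_prop]
theorem primrec_tail (hl : Primrec l) : Primrec fun a => (l a).tail :=
  Primrec.list_tail.comp hl

end List

end Primrec

/-! ### Bit strings -/

/-- A number `k` with `a < 2 ^ k`, the least one if `a` is positive: the number of binary digits
with which `a` is stored. -/
def bitLength (a : ℕ) : ℕ := Nat.findGreatest (fun k => 2 ^ k ≤ a) a + 1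

theorem lt_two_pow_bitLength (a : ℕ) : a < 2 ^ bitLength a := by
  by_contra h
  rw [not_lt] at h
  have h1 : bitLength a ≤ a := (Nat.lt_two_pow_self.trans_le h).le
  have := Nat.le_findGreatest (P := fun k => 2 ^ k ≤ a) h1 h
  unfold bitLength at this
  omega

theorem bitLength_le {a k : ℕ} (hk : 1 ≤ k) (h : a < 2 ^ k) : bitLength a ≤ k := by
  unfold bitLength
  by_cases h0 : Nat.findGreatest (fun k => 2 ^ k ≤ a) a = 0
  · omega
  · have h1 := Nat.findGreatest_of_ne_zero (P := fun k => 2 ^ k ≤ a) rfl h0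
    have := (Nat.pow_lt_pow_iff_right (a := 2) (by norm_num)).1 (h1.trans_lt h)
    omega

/-- The binary digits of `a`, lowest first, each preceded by the marker `true`; then the end
marker `[false, true]`. -/
def encodeNat (a : ℕ) : List Bool :=
  (List.range (bitLength a)).flatMap
    (fun i => [true, if a / 2 ^ i % 2 = 1 then true else false]) ++ [false, true]

/-- The codes of the numbers of a list, followed by the end marker `[false, false]`. -/
def encodeList (l : List ℕ) : List Bool := l.flatMap encodeNat ++ [false, false]

/-- Self-delimiting code of a list of lists of natural numbers. -/
def encodeLists (L : List (List ℕ)) : List Bool := L.flatMap encodeList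

/-- Decoding of one two-bit symbol `b, b'`, the symbols being processed from right to left. The
first number of the first list of `st` is the one being built. -/
def decodeSymbol (b b' : Bool) (st : List (List ℕ)) : List (List ℕ) :=
  if b = true then
    ((2 * st.headI.headI + if b' = true then 1 else 0) :: st.headI.tail) :: st.tail
  else if b' = true then (0 :: st.headI) :: st.tail else [] :: st

/-- Decoding of one bit, from right to left. The first component of the state is `0` between two
symbols, and `1` or `2` when the second bit of a symbol has been read and is `false` or `true`. -/
def decodeStep (b : Bool) (s : ℕ × List (List ℕ)) : ℕ × List (List ℕ) :=
  if s.1 = 0 then (if b = true then 2 else 1, s.2)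
  else (0, decodeSymbol b (if s.1 = 2 then true else false) s.2)

/-- The inverse of `encodeLists`. -/
def decodeLists (q : List Bool) : List (List ℕ) := (q.foldr decodeStep (0, [])).2

theorem foldr_decodeStep_symbol (b b' : Bool) (st : List (List ℕ)) :
    [b, b'].foldr decodeStep (0, st) = (0, decodeSymbol b b' st) := by
  cases b <;> cases b' <;> simp [decodeStep]

theorem foldr_decodeStep_digits (a k h : ℕ) (t : List ℕ) (st : List (List ℕ)) :
    ((List.range k).flatMap
      (fun i => [true, if a / 2 ^ i % 2 = 1 then true else false])).foldr decodeStep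
        (0, (h :: t) :: st) = (0, ((a % 2 ^ k + 2 ^ k * h) :: t) :: st) := by
  induction k generalizing h with
  | zero => simp [Nat.mod_one]
  | succ k ih =>
    rw [List.range_succ, List.flatMap_append, List.foldr_append, List.flatMap_singleton,
      foldr_decodeStep_symbol]
    have hd : decodeSymbol true (if a / 2 ^ k % 2 = 1 then true else false) ((h :: t) :: st) =
        ((2 * h + a / 2 ^ k % 2) :: t) :: st := by
      rcases Nat.mod_two_eq_zero_or_one (a / 2 ^ k) with h0 | h0 <;> simp [decodeSymbol, h0]
    rw [hd, ih]
    congr 3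
    rw [pow_succ, Nat.mod_mul]
    ring

theorem foldr_decodeStep_encodeNat (a : ℕ) (t : List ℕ) (st : List (List ℕ)) :
    (encodeNat a).foldr decodeStep (0, t :: st) = (0, (a :: t) :: st) := by
  rw [encodeNat, List.foldr_append, foldr_decodeStep_symbol]
  have : decodeSymbol false true (t :: st) = (0 :: t) :: st := by simp [decodeSymbol]
  rw [this, foldr_decodeStep_digits, Nat.mod_eq_of_lt (lt_two_pow_bitLength a)]
  simp

theorem foldr_decodeStep_encodeList (l : List ℕ) (st : List (List ℕ)) :
    (encodeList l).foldr decodeStep (0, st) = (0, l :: st) := by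
  rw [encodeList, List.foldr_append, foldr_decodeStep_symbol]
  have : decodeSymbol false false st = [] :: st := by simp [decodeSymbol]
  rw [this]
  induction l with
  | nil => rfl
  | cons a l ih => rw [List.flatMap_cons, List.foldr_append, ih, foldr_decodeStep_encodeNat]

theorem decodeLists_encodeLists (L : List (List ℕ)) : decodeLists (encodeLists L) = L := by
  have : (encodeLists L).foldr decodeStep (0, []) = (0, L) := by
    induction L with
    | nil => rfl
    | cons l L ih =>
      rw [encodeLists] at ih ⊢
      rw [List.flatMap_cons, List.foldr_append, ih, foldr_decodeStep_encodeList]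
  rw [decodeLists, this]

theorem length_encodeNat (a : ℕ) : (encodeNat a).length = 2 * bitLength a + 2 := by
  simp [encodeNat, List.length_flatMap]
  ring

theorem length_encodeList_le {l : List ℕ} {k : ℕ} (hk : 1 ≤ k) (h : ∀ a ∈ l, a < 2 ^ k) :
    (encodeList l).length ≤ l.length * (2 * k + 2) + 2 := by
  have : (l.flatMap encodeNat).length ≤ l.length * (2 * k + 2) := by
    rw [List.length_flatMap]
    refine (List.sum_le_card_nsmul _ (2 * k + 2) fun x hx => ?_).trans (by simp)
    obtain ⟨a, ha, rfl⟩ := List.mem_map.1 hx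
    have := bitLength_le hk (h a ha)
    rw [length_encodeNat]
    omega
  simpa [encodeList] using this

@[fun_prop]
theorem primrec_encodeLists {α : Type*} [Primcodable α] {f : α → List (List ℕ)}
    (hf : Primrec f) : Primrec fun a => encodeLists (f a) := by
  unfold encodeLists encodeList encodeNat bitLength
  fun_prop

@[fun_prop]
theorem primrec_decodeLists {α : Type*} [Primcodable α] {f : α → List Bool}
    (hf : Primrec f) : Primrec fun a => decodeLists (f a) := by
  unfold decodeLists decodeStep decodeSymbol
  fun_prop

/-! ### The algorithm -/

/-- The contents of the memory. -/
structure Memory where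
  /-- What is computed in the present pass: `0` the degrees, `1` a digit of the seed of the
  coloring of the colors with cells, `2` the vertices whose list has two colors in one cell, `3`
  slacks, `4` a digit of the seed with which the residues are refined, `5` new colors, `6` the
  edges and lists of the uncolored vertices. The algorithm has stopped if it is `7`. -/
  phase : ℕ
  /-- The maximum degree plus one. -/
  deg : ℕ
  /-- The seed of the hash function that defines the cells of the colors. -/
  cellSeed : ℕ
  /-- The modulus of the residues. -/
  modulus : ℕ
  /-- The digits that are already known of the seed that is searched for. -/
  seed : ℕ
  /-- The number of these digits. -/
  digits : ℕ
  /-- The states of the vertices: `0` for set aside, `1` for active, `k + 2` for colored by `k`. -/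
  col : List ℕ
  /-- The residues of the vertices: the color of the active vertex `x` is to be chosen in a cell
  that is congruent to `res x` modulo `modulus`. -/
  res : List ℕ
  /-- The slacks of the refined residues of the active vertices. -/
  slack : List ℕ
  /-- The counters of the present pass (in phase `6`, the stored items). -/
  acc : List ℕ

/-- The memory as a list of lists. -/
def Memory.toLists (s : Memory) : List (List ℕ) :=
  [[s.phase, s.deg, s.cellSeed, s.modulus, s.seed, s.digits], s.col, s.res, s.slack, s.acc]

/-- The inverse of `Memory.toLists`. -/
def Memory.ofLists (L : List (List ℕ)) : Memory where
  phase := (L.getD 0 []).getD 0 0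
  deg := (L.getD 0 []).getD 1 0
  cellSeed := (L.getD 0 []).getD 2 0
  modulus := (L.getD 0 []).getD 3 0
  seed := (L.getD 0 []).getD 4 0
  digits := (L.getD 0 []).getD 5 0
  col := L.getD 1 []
  res := L.getD 2 []
  slack := L.getD 3 []
  acc := L.getD 4 []

theorem Memory.ofLists_toLists (s : Memory) : Memory.ofLists s.toLists = s := rfl

/-- The base of the digits of seeds, and the yardstick for all bounds: there are fewer than `b`
vertices and, if there are at most `c * n ^ 2` colors, at most `b ^ 3` colors. -/
def base (c n : ℕ) : ℕ := n + c + 100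

/-- A prime number between `b ^ 5` and `2 * b ^ 5`. -/
def hashPrime (b : ℕ) : ℕ := Nat.findGreatest Nat.Prime (2 * b ^ 5)

/-- The member with seed `s` of a pairwise independent family of functions to
`{0, …, hashPrime b - 1}`: with `p = hashPrime b`, it is `s₀ x + s₁` modulo `p` if `s₀` and `s₁`
are the last two digits of `s` in base `p`. -/
def hash (b s x : ℕ) : ℕ := (s * x + s / hashPrime b) % hashPrime b

/-- The number of cells into which the colors are divided, if `D` is the maximum degree plus
one. -/
def numCells (D : ℕ) : ℕ := 4 * D ^ 3

/-- The cell of the color `k`. -/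
def cell (b D gs k : ℕ) : ℕ := hash b gs k % numCells D

/-- The number of ordered pairs of distinct colors of the list `l` in the same cell. -/
def collisions (b D gs : ℕ) (l : List ℕ) : ℕ :=
  (l.map fun k => (l.map fun k' =>
    if k ≠ k' ∧ cell b D gs k = cell b D gs k' then 1 else 0).sum).sum

/-- The active vertices. -/
def activeList (col : List ℕ) : List ℕ :=
  (List.range col.length).filter fun x => decide (col.getD x 0 = 1)

/-- The number of residues modulo `q * modulus` into which each residue modulo `modulus` is
split. The slacks of all of them together need only `O(n)` counters. -/
def splitting (n : ℕ) (col : List ℕ) : ℕ := n / (activeList col).length + 1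

/-- The slack of the active vertex `x` for the `j`-th refinement of its residue. -/
def slackAt (q : ℕ) (act sl : List ℕ) (x j : ℕ) : ℕ := sl.getD (act.idxOf x * q + j) 0

/-- The list of the refinements `j < q` of the residue of `x`, each repeated as often as its slack
says. -/
def slots (q : ℕ) (act sl : List ℕ) (x : ℕ) : List ℕ :=
  (List.range q).flatMap fun j => List.replicate (slackAt q act sl x j) j

/-- The refinement of the residue of `x` that the seed `s` selects. -/
def choice (b q : ℕ) (act sl : List ℕ) (s x : ℕ) : ℕ :=
  (slots q act sl x).getD (hash b s x % (slots q act sl x).length) 0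

/-- The integer stand-in for `b ^ 3 / s`, the contribution to the potential of an endpoint with
slack `s` of an edge. -/
def weight (b s : ℕ) : ℕ := b ^ 3 / s + 1

/-- The potential of the edge `uv` after the refinement with seed `s`. -/
def edgeCost (b q : ℕ) (act sl : List ℕ) (u v s : ℕ) : ℕ :=
  if choice b q act sl s u = choice b q act sl s v then
    weight b (slackAt q act sl u (choice b q act sl s u)) +
      weight b (slackAt q act sl v (choice b q act sl s v))
  else 0

/-- The sum of `f` over the seeds of thirteen digits in base `b` that begin with the `d + 1` digits
of `pre * b + i`. -/
def blockSum (b pre d i : ℕ) (f : ℕ → ℕ) : ℕ :=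
  ∑ s ∈ Finset.range (b ^ (12 - d)), f ((pre * b + i) * b ^ (12 - d) + s)

/-- Whether `y` has a color whose cell is congruent to `a` modulo `R`. -/
def hits (b : ℕ) (st : Memory) (R a y : ℕ) : ℕ :=
  if 2 ≤ st.col.getD y 0 ∧ cell b st.deg st.cellSeed (st.col.getD y 0 - 2) % R = a then 1 else 0

/-- The active vertex `u` and the active vertex `v` have the same residue. -/
def Conflict (st : Memory) (u v : ℕ) : Prop :=
  st.col.getD u 0 = 1 ∧ st.col.getD v 0 = 1 ∧ st.res.getD u 0 = st.res.getD v 0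

instance (st : Memory) (u v : ℕ) : Decidable (Conflict st u v) := by
  unfold Conflict; infer_instance

/-- What reading the edge `uv` adds to the counter `i`. In phase `3` the counters `2 k` and
`2 k + 1` with `k = i * q + j` concern the `j`-th refinement of the residue of the `i`-th active
vertex: the slack is their difference. -/
def edgeIncrement (n b : ℕ) (st : Memory) (u v i : ℕ) : ℕ :=
  if st.phase = 0 then (if i = u then 1 else 0) + (if i = v then 1 else 0)
  else if st.phase = 3 then
    if i % 2 = 1 then
      (if (activeList st.col).getD (i / 2 / splitting n st.col) 0 = u then
        hits b st (st.modulus * splitting n st.col)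
          (st.res.getD u 0 + st.modulus * (i / 2 % splitting n st.col)) v else 0) +
      (if (activeList st.col).getD (i / 2 / splitting n st.col) 0 = v then
        hits b st (st.modulus * splitting n st.col)
          (st.res.getD v 0 + st.modulus * (i / 2 % splitting n st.col)) u else 0)
    else 0
  else if st.phase = 4 then
    if Conflict st u v then
      blockSum b st.seed st.digits i
        (edgeCost b (splitting n st.col) (activeList st.col) st.slack u v)
    else 0
  else if st.phase = 5 then
    if Conflict st u v ∧ i = v then 1 else 0
  else 0

/-- The number of colors in `l` whose cell is congruent to `a` modulo `R`. -/
def cellCount (b D gs R a : ℕ) (l : List ℕ) : ℕ :=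
  (l.map fun k => if cell b D gs k % R = a then 1 else 0).sum

/-- What reading the list `l` of the vertex `x`, truncated to `deg` colors, adds to the
counter `i`. -/
def listIncrement (n b : ℕ) (st : Memory) (x : ℕ) (l : List ℕ) (i : ℕ) : ℕ :=
  if st.phase = 1 then blockSum b st.seed st.digits i fun s => collisions b st.deg s l
  else if st.phase = 2 then if i = x then collisions b st.deg st.cellSeed l else 0
  else if st.phase = 3 then
    if i % 2 = 0 ∧ (activeList st.col).getD (i / 2 / splitting n st.col) 0 = x then
      cellCount b st.deg st.cellSeed (st.modulus * splitting n st.col)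
        (st.res.getD x 0 + st.modulus * (i / 2 % splitting n st.col)) l
    else 0
  else if st.phase = 5 then
    if i = n + x ∧ st.col.getD x 0 = 1 then
      (l.map fun k => if cell b st.deg st.cellSeed k = st.res.getD x 0 then k + 2 else 0).sum
    else 0
  else 0

/-- The item stored for the edge `uv` in phase `6`. -/
def edgeItem (u v : ℕ) : ℕ := 2 * Nat.pair u v

/-- The item stored for the color `k` in the list of `x` in phase `6`. -/
def colorItem (x k : ℕ) : ℕ := 2 * Nat.pair x k + 1

/-- Add the values of `f` to the counters. -/
def addCounters (acc : List ℕ) (f : ℕ → ℕ) : List ℕ :=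
  (List.range acc.length).map fun i => acc.getD i 0 + f i

/-- The counters or items after reading the edge `uv`. -/
def readEdge (n b : ℕ) (st : Memory) (u v : ℕ) : List ℕ :=
  if st.phase = 6 then
    st.acc ++ if st.col.getD u 0 < 2 ∨ st.col.getD v 0 < 2 then [edgeItem u v] else []
  else addCounters st.acc (edgeIncrement n b st u v)

/-- The counters or items after reading the list `l` of `x`. -/
def readList (n b : ℕ) (st : Memory) (x : ℕ) (l : List ℕ) : List ℕ :=
  if st.phase = 6 then
    st.acc ++ if st.col.getD x 0 < 2 then (l.take st.deg).map (colorItem x) else []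
  else addCounters st.acc (listIncrement n b st x (l.take st.deg))

/-- The memory after reading a token. -/
def readToken (n b : ℕ) (st : Memory) (t : (ℕ × ℕ) ⊕ (ℕ × List ℕ)) : Memory :=
  { st with
    acc := Sum.casesOn t (fun e => readEdge n b st e.1 e.2) (fun e => readList n b st e.1 e.2) }

/-- The position of the least element of a list. -/
def argmin (l : List ℕ) : ℕ := l.idxOf (l.foldr min l.headI)

/-- The color that the greedy algorithm gives to `x`. -/
def greedyColor (n m : ℕ) (items col : List ℕ) (x : ℕ) : ℕ :=
  Nat.findGreatest (fun k => colorItem x k ∈ items ∧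
    ∀ y < n, (edgeItem x y ∈ items ∨ edgeItem y x ∈ items) → ¬ col.getD y 0 = k + 2) m

/-- The greedy algorithm, from the coloring `col` and the items stored in phase `6`. -/
def greedy (n m : ℕ) (items col : List ℕ) : List ℕ :=
  (List.range n).foldl (fun col x =>
    if col.getD x 0 < 2 then col.set x (greedyColor n m items col x + 2) else col) col

/-- Begin to count the slacks of the refinements of the residues. -/
def startStage (n : ℕ) (st : Memory) : Memory :=
  { st with
    phase := 3
    acc := List.replicate (2 * ((activeList st.col).length * splitting n st.col)) 0 }

/-- Begin to color the active vertices, or the last phase if few vertices are active. -/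
def startEpoch (n : ℕ) (st : Memory) : Memory :=
  if (activeList st.col).length * st.deg ≤ n then { st with phase := 6, acc := [] }
  else startStage n { st with modulus := 1, res := List.replicate n 0 }

/-- Begin to search for a seed. -/
def startSearch (b ph : ℕ) (st : Memory) : Memory :=
  { st with phase := ph, seed := 0, digits := 0, acc := List.replicate b 0 }

/-- The next digit of a seed. -/
def nextDigit (b : ℕ) (st : Memory) : Memory :=
  { st with
    seed := st.seed * b + argmin st.acc
    digits := st.digits + 1
    acc := List.replicate b 0 }

/-- Refine the residues with the seed that was found. -/
def refine (n b : ℕ) (st : Memory) : Memory :=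
  { st with
    res := (List.range n).map fun x => st.res.getD x 0 + st.modulus *
      choice b (splitting n st.col) (activeList st.col) st.slack st.seed x
    modulus := st.modulus * splitting n st.col }

/-- Color the active vertices that have no smaller neighbor with the same residue. -/
def commit (n : ℕ) (st : Memory) : Memory :=
  { st with
    col := (List.range n).map fun x =>
      if st.col.getD x 0 = 1 ∧ st.acc.getD x 0 = 0 then st.acc.getD (n + x) 0
      else st.col.getD x 0 }

/-- The memory after the end of a pass. -/
def endPass (n m b : ℕ) (st : Memory) : Memory :=
  if st.phase = 0 then startSearch b 1 { st with deg := st.acc.foldr max 0 + 1 }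
  else if st.phase = 1 then
    if st.digits = 12 then
      { nextDigit b st with
        phase := 2
        cellSeed := (nextDigit b st).seed
        acc := List.replicate n 0 }
    else nextDigit b st
  else if st.phase = 2 then
    startEpoch n { st with col := st.acc.map fun k => if k = 0 then 1 else 0 }
  else if st.phase = 3 then
    startSearch b 4 { st with
      slack := (List.range ((activeList st.col).length * splitting n st.col)).map fun k =>
        st.acc.getD (2 * k) 0 - st.acc.getD (2 * k + 1) 0 }
  else if st.phase = 4 then
    if st.digits = 12 then
      if numCells st.deg ≤ (refine n b (nextDigit b st)).modulus then
        { refine n b (nextDigit b st) with phase := 5, acc := List.replicate (2 * n) 0 }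
      else startStage n (refine n b (nextDigit b st))
    else nextDigit b st
  else if st.phase = 5 then startEpoch n (commit n st)
  else if st.phase = 6 then { st with phase := 7, col := greedy n m st.acc st.col }
  else st

/-- The output after a pass: the colors, in the last phase. -/
def output (st : Memory) : Option (List ℕ) :=
  if st.phase = 7 then some (st.col.map fun k => k - 2) else none

/-- The memory at the start. -/
def initial (n : ℕ) : Memory := ⟨0, 0, 0, 0, 0, 0, [], [], [], List.replicate n 0⟩

/-! ### Computability of the algorithm -/

section Primrec

/-- The components of the memory as a tuple. -/
def Memory.equivProd : Memory ≃
    ℕ × ℕ × ℕ × ℕ × ℕ × ℕ × List ℕ × List ℕ × List ℕ × List ℕ where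
  toFun s := (s.phase, s.deg, s.cellSeed, s.modulus, s.seed, s.digits, s.col, s.res, s.slack,
    s.acc)
  invFun p := ⟨p.1, p.2.1, p.2.2.1, p.2.2.2.1, p.2.2.2.2.1, p.2.2.2.2.2.1, p.2.2.2.2.2.2.1,
    p.2.2.2.2.2.2.2.1, p.2.2.2.2.2.2.2.2.1, p.2.2.2.2.2.2.2.2.2⟩
  left_inv _ := rfl
  right_inv _ := rfl

instance : Primcodable Memory := Primcodable.ofEquiv _ Memory.equivProd

variable {α β γ δ : Type*} [Primcodable α] [Primcodable β] [Primcodable γ] [Primcodable δ]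

theorem primrec_equivProd {f : α → Memory} (hf : Primrec f) :
    Primrec fun a => Memory.equivProd (f a) := Primrec.of_equiv.comp hf

variable {st : α → Memory}

@[fun_prop]
theorem primrec_phase (h : Primrec st) : Primrec fun a => (st a).phase :=
  primrec_fst (primrec_equivProd h)

@[fun_prop]
theorem primrec_deg (h : Primrec st) : Primrec fun a => (st a).deg :=
  primrec_fst (primrec_snd (primrec_equivProd h))

@[fun_prop]
theorem primrec_cellSeed (h : Primrec st) : Primrec fun a => (st a).cellSeed :=
  primrec_fst (primrec_snd (primrec_snd (primrec_equivProd h)))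

@[fun_prop]
theorem primrec_modulus (h : Primrec st) : Primrec fun a => (st a).modulus :=
  primrec_fst (primrec_snd (primrec_snd (primrec_snd (primrec_equivProd h))))

@[fun_prop]
theorem primrec_seed (h : Primrec st) : Primrec fun a => (st a).seed :=
  primrec_fst (primrec_snd (primrec_snd (primrec_snd (primrec_snd (primrec_equivProd h)))))

@[fun_prop]
theorem primrec_digits (h : Primrec st) : Primrec fun a => (st a).digits :=
  primrec_fst (primrec_snd (primrec_snd (primrec_snd (primrec_snd (primrec_snd
    (primrec_equivProd h))))))

@[fun_prop]
theorem primrec_col (h : Primrec st) : Primrec fun a => (st a).col :=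
  primrec_fst (primrec_snd (primrec_snd (primrec_snd (primrec_snd (primrec_snd (primrec_snd
    (primrec_equivProd h)))))))

@[fun_prop]
theorem primrec_res (h : Primrec st) : Primrec fun a => (st a).res :=
  primrec_fst (primrec_snd (primrec_snd (primrec_snd (primrec_snd (primrec_snd (primrec_snd
    (primrec_snd (primrec_equivProd h))))))))

@[fun_prop]
theorem primrec_slack (h : Primrec st) : Primrec fun a => (st a).slack :=
  primrec_fst (primrec_snd (primrec_snd (primrec_snd (primrec_snd (primrec_snd (primrec_snd
    (primrec_snd (primrec_snd (primrec_equivProd h)))))))))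

@[fun_prop]
theorem primrec_acc (h : Primrec st) : Primrec fun a => (st a).acc :=
  primrec_snd (primrec_snd (primrec_snd (primrec_snd (primrec_snd (primrec_snd
    (primrec_snd (primrec_snd (primrec_snd (primrec_equivProd h)))))))))

@[fun_prop]
theorem primrec_memoryMk {f₁ f₂ f₃ f₄ f₅ f₆ : α → ℕ} {g₁ g₂ g₃ g₄ : α → List ℕ}
    (h₁ : Primrec f₁) (h₂ : Primrec f₂) (h₃ : Primrec f₃) (h₄ : Primrec f₄) (h₅ : Primrec f₅)
    (h₆ : Primrec f₆) (i₁ : Primrec g₁) (i₂ : Primrec g₂) (i₃ : Primrec g₃) (i₄ : Primrec g₄) :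
    Primrec fun a => Memory.mk (f₁ a) (f₂ a) (f₃ a) (f₄ a) (f₅ a) (f₆ a) (g₁ a) (g₂ a) (g₃ a)
      (g₄ a) :=
  (Primrec.of_equiv_symm (e := Memory.equivProd)).comp
    (h₁.pair (h₂.pair (h₃.pair (h₄.pair (h₅.pair (h₆.pair (i₁.pair (i₂.pair (i₃.pair i₄)))))))))

variable {n m b D gs q R a' x y j u v i pre d : α → ℕ} {l act sl : α → List ℕ}

@[fun_prop]
theorem primrec_hashPrime (hb : Primrec b) : Primrec fun a => hashPrime (b a) := by
  unfold hashPrime; fun_prop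

@[fun_prop]
theorem primrec_hash (hb : Primrec b) (hi : Primrec i) (hx : Primrec x) :
    Primrec fun a => hash (b a) (i a) (x a) := by
  unfold hash; fun_prop

@[fun_prop]
theorem primrec_cell (hb : Primrec b) (hD : Primrec D) (hi : Primrec i) (hx : Primrec x) :
    Primrec fun a => cell (b a) (D a) (i a) (x a) := by
  unfold cell numCells; fun_prop

@[fun_prop]
theorem primrec_collisions (hb : Primrec b) (hD : Primrec D) (hi : Primrec i) (hl : Primrec l) :
    Primrec fun a => collisions (b a) (D a) (i a) (l a) := by
  unfold collisions; fun_prop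

@[fun_prop]
theorem primrec_activeList (hl : Primrec l) : Primrec fun a => activeList (l a) := by
  unfold activeList; fun_prop

@[fun_prop]
theorem primrec_splitting (hn : Primrec n) (hl : Primrec l) :
    Primrec fun a => splitting (n a) (l a) := by
  unfold splitting; fun_prop

@[fun_prop]
theorem primrec_slackAt (hq : Primrec q) (hact : Primrec act) (hsl : Primrec sl)
    (hx : Primrec x) (hj : Primrec j) :
    Primrec fun a => slackAt (q a) (act a) (sl a) (x a) (j a) := by
  unfold slackAt; fun_prop

@[fun_prop]
theorem primrec_choice (hb : Primrec b) (hq : Primrec q) (hact : Primrec act)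
    (hsl : Primrec sl) (hi : Primrec i) (hx : Primrec x) :
    Primrec fun a => choice (b a) (q a) (act a) (sl a) (i a) (x a) := by
  unfold choice slots; fun_prop

@[fun_prop]
theorem primrec_edgeCost (hb : Primrec b) (hq : Primrec q) (hact : Primrec act)
    (hsl : Primrec sl) (hu : Primrec u) (hv : Primrec v) (hi : Primrec i) :
    Primrec fun a => edgeCost (b a) (q a) (act a) (sl a) (u a) (v a) (i a) := by
  unfold edgeCost weight; fun_prop

@[fun_prop]
theorem primrec_blockSum {f : α → ℕ → ℕ} (hb : Primrec b) (hpre : Primrec pre) (hd : Primrec d)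
    (hi : Primrec i) (hf : Primrec fun p : α × ℕ => f p.1 p.2) :
    Primrec fun a => blockSum (b a) (pre a) (d a) (i a) (f a) := by
  unfold blockSum
  refine primrec_sum_range (by fun_prop) ?_
  exact hf.comp (g := fun p : α × ℕ =>
    (p.1, (pre p.1 * b p.1 + i p.1) * b p.1 ^ (12 - d p.1) + p.2)) (by fun_prop)

@[fun_prop]
theorem primrec_hits (hb : Primrec b) (hst : Primrec st) (hR : Primrec R) (ha : Primrec a')
    (hy : Primrec y) : Primrec fun a => hits (b a) (st a) (R a) (a' a) (y a) := by
  unfold hits; fun_prop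

@[fun_prop]
theorem primrecPred_conflict (hst : Primrec st) (hu : Primrec u) (hv : Primrec v) :
    PrimrecPred fun a => Conflict (st a) (u a) (v a) := by
  unfold Conflict; fun_prop

@[fun_prop]
theorem primrec_edgeIncrement (hn : Primrec n) (hb : Primrec b) (hst : Primrec st)
    (hu : Primrec u) (hv : Primrec v) (hi : Primrec i) :
    Primrec fun a => edgeIncrement (n a) (b a) (st a) (u a) (v a) (i a) := by
  unfold edgeIncrement; fun_prop

@[fun_prop]
theorem primrec_listIncrement (hn : Primrec n) (hb : Primrec b) (hst : Primrec st)
    (hx : Primrec x) (hl : Primrec l) (hi : Primrec i) :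
    Primrec fun a => listIncrement (n a) (b a) (st a) (x a) (l a) (i a) := by
  unfold listIncrement cellCount; fun_prop

@[fun_prop]
theorem primrec_addCounters {f : α → ℕ → ℕ} (hl : Primrec l)
    (hf : Primrec fun p : α × ℕ => f p.1 p.2) : Primrec fun a => addCounters (l a) (f a) := by
  unfold addCounters; fun_prop

@[fun_prop]
theorem primrec_readEdge (hn : Primrec n) (hb : Primrec b) (hst : Primrec st) (hu : Primrec u)
    (hv : Primrec v) : Primrec fun a => readEdge (n a) (b a) (st a) (u a) (v a) := by
  unfold readEdge edgeItem; fun_prop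

@[fun_prop]
theorem primrec_readList (hn : Primrec n) (hb : Primrec b) (hst : Primrec st) (hx : Primrec x)
    (hl : Primrec l) : Primrec fun a => readList (n a) (b a) (st a) (x a) (l a) := by
  unfold readList colorItem; fun_prop

@[fun_prop]
theorem primrec_sumCasesOn {t : α → β ⊕ γ} {f : α → β → δ} {g : α → γ → δ} (ht : Primrec t)
    (hf : Primrec fun p : α × β => f p.1 p.2) (hg : Primrec fun p : α × γ => g p.1 p.2) :
    Primrec fun a => (Sum.casesOn (t a) (f a) (g a) : δ) := Primrec.sumCasesOn ht hf hg

theorem primrec_readToken {t : α → (ℕ × ℕ) ⊕ (ℕ × List ℕ)} (hn : Primrec n) (hb : Primrec b)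
    (hst : Primrec st) (ht : Primrec t) :
    Primrec fun a => readToken (n a) (b a) (st a) (t a) := by
  have : Primrec fun a => (Sum.casesOn (t a) (fun e => readEdge (n a) (b a) (st a) e.1 e.2)
      (fun e => readList (n a) (b a) (st a) e.1 e.2) : List ℕ) :=
    primrec_sumCasesOn ht (by fun_prop) (by fun_prop)
  unfold readToken
  exact primrec_memoryMk (by fun_prop) (by fun_prop) (by fun_prop) (by fun_prop) (by fun_prop)
    (by fun_prop) (by fun_prop) (by fun_prop) (by fun_prop) this

@[fun_prop]
theorem primrec_argmin (hl : Primrec l) : Primrec fun a => argmin (l a) := by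
  unfold argmin; fun_prop

@[fun_prop]
theorem primrec_greedy (hn : Primrec n) (hm : Primrec m) (hl : Primrec l) (hsl : Primrec sl) :
    Primrec fun a => greedy (n a) (m a) (l a) (sl a) := by
  unfold greedy greedyColor edgeItem colorItem; fun_prop

@[fun_prop]
theorem primrec_startStage (hn : Primrec n) (hst : Primrec st) :
    Primrec fun a => startStage (n a) (st a) := by
  unfold startStage; fun_prop

@[fun_prop]
theorem primrec_startEpoch (hn : Primrec n) (hst : Primrec st) :
    Primrec fun a => startEpoch (n a) (st a) := by
  unfold startEpoch; fun_prop

@[fun_prop]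
theorem primrec_startSearch (hb : Primrec b) (hi : Primrec i) (hst : Primrec st) :
    Primrec fun a => startSearch (b a) (i a) (st a) := by
  unfold startSearch; fun_prop

@[fun_prop]
theorem primrec_nextDigit (hb : Primrec b) (hst : Primrec st) :
    Primrec fun a => nextDigit (b a) (st a) := by
  unfold nextDigit; fun_prop

@[fun_prop]
theorem primrec_refine (hn : Primrec n) (hb : Primrec b) (hst : Primrec st) :
    Primrec fun a => refine (n a) (b a) (st a) := by
  unfold refine; fun_prop

@[fun_prop]
theorem primrec_commit (hn : Primrec n) (hst : Primrec st) :
    Primrec fun a => commit (n a) (st a) := by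
  unfold commit; fun_prop

theorem primrec_endPass (hn : Primrec n) (hm : Primrec m) (hb : Primrec b) (hst : Primrec st) :
    Primrec fun a => endPass (n a) (m a) (b a) (st a) := by
  unfold endPass numCells; fun_prop

theorem primrec_output (hst : Primrec st) : Primrec fun a => output (st a) := by
  unfold output; fun_prop

theorem primrec_toLists (hst : Primrec st) : Primrec fun a => (st a).toLists := by
  unfold Memory.toLists; fun_prop

@[fun_prop]
theorem primrec_ofLists {L : α → List (List ℕ)} (hL : Primrec L) :
    Primrec fun a => Memory.ofLists (L a) := by
  unfold Memory.ofLists; fun_prop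

end Primrec

/-- The memory as a bit string. -/
def Memory.encode (s : Memory) : List Bool := encodeLists s.toLists

/-- The inverse of `Memory.encode`. -/
def Memory.decode (q : List Bool) : Memory := .ofLists (decodeLists q)

@[fun_prop]
theorem primrec_decode {α : Type*} [Primcodable α] {q : α → List Bool} (hq : Primrec q) :
    Primrec fun a => Memory.decode (q a) := by
  unfold Memory.decode; fun_prop

@[fun_prop]
theorem primrec_base {α : Type*} [Primcodable α] (c : ℕ) {n : α → ℕ} (hn : Primrec n) :
    Primrec fun a => base c (n a) := by
  unfold base; fun_prop

theorem Memory.decode_encode (s : Memory) : Memory.decode s.encode = s := by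
  rw [decode, encode, decodeLists_encodeLists, ofLists_toLists]

/-- The streaming algorithm: the operations on `Memory`, on the level of bit strings. -/
def algorithm (c : ℕ) : StreamingAlgorithm where
  init p := (initial p.1).encode
  read p := (readToken p.1.1 (base c p.1.1) (.decode p.2.1) p.2.2).encode
  endPass p := (endPass p.1.1 p.1.2 (base c p.1.1) (.decode p.2)).encode
  output p := output (.decode p.2)
  computable_init := by
    refine Primrec.to_comp (primrec_encodeLists (primrec_toLists ?_))
    unfold initial
    fun_prop
  computable_read := by
    refine Primrec.to_comp (primrec_encodeLists (primrec_toLists (primrec_readToken ?_ ?_ ?_ ?_)))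
    all_goals fun_prop
  computable_endPass := by
    refine Primrec.to_comp (primrec_encodeLists (primrec_toLists (primrec_endPass ?_ ?_ ?_ ?_)))
    all_goals fun_prop
  computable_output := by
    refine Primrec.to_comp (primrec_output ?_)
    fun_prop

theorem algorithm_read (c n m : ℕ) (q : List Bool) (t : (ℕ × ℕ) ⊕ (ℕ × List ℕ)) :
    (algorithm c).read ((n, m), q, t) = (readToken n (base c n) (.decode q) t).encode := by
  rw [algorithm]

theorem algorithm_endPass (c n m : ℕ) (q : List Bool) :
    (algorithm c).endPass ((n, m), q) = (endPass n m (base c n) (.decode q)).encode := by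
  rw [algorithm]

theorem algorithm_output (c n m : ℕ) (q : List Bool) :
    (algorithm c).output ((n, m), q) = output (.decode q) := by
  rw [algorithm]

open Finset

/-! ### Pairwise independence -/

theorem sum_range_mul (f : ℕ → ℕ) (k q : ℕ) :
    ∑ s ∈ range (k * q), f s = ∑ i ∈ range k, ∑ j ∈ range q, f (i * q + j) := by
  induction k with
  | zero => simp
  | succ k ih => rw [Nat.succ_mul, sum_range_add, ih, sum_range_succ]

theorem sum_range_mod_le (f : ℕ → ℕ) (T : ℕ) {q : ℕ} (hq : 0 < q) :
    ∑ s ∈ range T, f (s % q) ≤ (T / q + 1) * ∑ i ∈ range q, f i := by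
  have h1 : T ≤ (T / q + 1) * q := by
    have := Nat.lt_div_mul_add hq (a := T)
    rw [Nat.succ_mul]
    exact this.le
  calc ∑ s ∈ range T, f (s % q) ≤ ∑ s ∈ range ((T / q + 1) * q), f (s % q) :=
        sum_le_sum_of_subset (range_subset_range.2 h1)
    _ = ∑ i ∈ range (T / q + 1), ∑ j ∈ range q, f j := by
        rw [sum_range_mul]
        refine sum_congr rfl fun i _ => sum_congr rfl fun j hj => ?_
        rw [mul_comm, Nat.mul_add_mod, Nat.mod_eq_of_lt (mem_range.1 hj)]
    _ = _ := by simp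

theorem exists_hashPrime {b : ℕ} (hb : 1 ≤ b) :
    (hashPrime b).Prime ∧ b ^ 5 < hashPrime b ∧ hashPrime b ≤ 2 * b ^ 5 := by
  obtain ⟨p, hp, h1, h2⟩ := Nat.exists_prime_lt_and_le_two_mul (b ^ 5) (by positivity)
  exact ⟨Nat.findGreatest_spec (P := Nat.Prime) h2 hp,
    h1.trans_le (Nat.le_findGreatest h2 hp), Nat.findGreatest_le _⟩

theorem hash_lt {b : ℕ} (hb : 1 ≤ b) (s x : ℕ) : hash b s x < hashPrime b :=
  Nat.mod_lt _ (exists_hashPrime hb).1.pos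

/-- Only the last two digits of the seed in base `hashPrime b` matter. -/
theorem hash_mod {b : ℕ} (hb : 1 ≤ b) (s x : ℕ) :
    hash b (s % (hashPrime b * hashPrime b)) x = hash b s x := by
  have hp := (exists_hashPrime hb).1.pos
  unfold hash
  set p := hashPrime b
  conv_rhs => rw [← Nat.mod_add_div s (p * p)]
  have : (s % (p * p) + p * p * (s / (p * p))) / p = s % (p * p) / p + p * (s / (p * p)) := by
    rw [mul_assoc, Nat.add_mul_div_left _ _ hp]
  rw [this]
  have : (s % (p * p) + p * p * (s / (p * p))) * x + (s % (p * p) / p + p * (s / (p * p))) =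
      (s % (p * p) * x + s % (p * p) / p) + p * (p * (s / (p * p)) * x + s / (p * p)) := by ring
  rw [this, Nat.add_mul_mod_self_left]

/-- The two values at distinct points determine the seed modulo `p ^ 2`, where `p = hashPrime b`. -/
theorem hash_injOn {b x y : ℕ} (hb : 1 ≤ b) (hx : x < hashPrime b) (hy : y < hashPrime b)
    (hxy : x ≠ y) {s t : ℕ} (hs : s < hashPrime b * hashPrime b)
    (ht : t < hashPrime b * hashPrime b) (h1 : hash b s x = hash b t x)
    (h2 : hash b s y = hash b t y) : s = t := by
  have hp := (exists_hashPrime hb).1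
  have := Fact.mk hp
  unfold hash at h1 h2
  set p := hashPrime b
  have e1 : (s : ZMod p) * x + (s / p : ℕ) = t * x + (t / p : ℕ) := by
    have := (ZMod.natCast_eq_natCast_iff' _ _ p).2 h1
    exact_mod_cast this
  have e2 : (s : ZMod p) * y + (s / p : ℕ) = t * y + (t / p : ℕ) := by
    have := (ZMod.natCast_eq_natCast_iff' _ _ p).2 h2
    exact_mod_cast this
  have hne : (x : ZMod p) - y ≠ 0 := by
    intro h
    have := (ZMod.natCast_eq_natCast_iff' _ _ p).1 (sub_eq_zero.1 h)
    rw [Nat.mod_eq_of_lt hx, Nat.mod_eq_of_lt hy] at this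
    exact hxy this
  have e3 : (s : ZMod p) = t := by
    have : ((s : ZMod p) - t) * (x - y) = 0 := by linear_combination e1 - e2
    exact sub_eq_zero.1 ((mul_eq_zero.1 this).resolve_right hne)
  have e4 : ((s / p : ℕ) : ZMod p) = (t / p : ℕ) := by
    rw [e3] at e1
    exact add_left_cancel e1
  have e3' := (ZMod.natCast_eq_natCast_iff' _ _ p).1 e3
  have e4' := (ZMod.natCast_eq_natCast_iff' _ _ p).1 e4
  rw [Nat.mod_eq_of_lt (Nat.div_lt_of_lt_mul hs), Nat.mod_eq_of_lt (Nat.div_lt_of_lt_mul ht)] at e4'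
  rw [← Nat.mod_add_div s p, ← Nat.mod_add_div t p, e3', e4']

/-- Pairwise independence of the hash functions, as an upper bound for sums. The factor is nearly
`T / p ^ 2` if `T` is much larger than `p ^ 2`. -/
theorem sum_hash_le {b x y : ℕ} (hb : 1 ≤ b) (hx : x < hashPrime b) (hy : y < hashPrime b)
    (hxy : x ≠ y) (F : ℕ → ℕ → ℕ) (T : ℕ) :
    ∑ s ∈ range T, F (hash b s x) (hash b s y) ≤ (T / (hashPrime b * hashPrime b) + 1) *
      ∑ i ∈ range (hashPrime b), ∑ j ∈ range (hashPrime b), F i j := by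
  have hp := (exists_hashPrime hb).1.pos
  have h1 := sum_range_mod_le (fun s => F (hash b s x) (hash b s y)) T (Nat.mul_pos hp hp)
  simp only [hash_mod hb] at h1
  refine h1.trans (Nat.mul_le_mul_left _ ?_)
  rw [← sum_product' (range (hashPrime b)) (range (hashPrime b)) F]
  have hinj : Set.InjOn (fun s => (hash b s x, hash b s y))
      (range (hashPrime b * hashPrime b) : Finset ℕ) := by
    intro s hs t ht h
    simp only [Prod.mk.injEq] at h
    exact hash_injOn hb hx hy hxy (mem_range.1 hs) (mem_range.1 ht) h.1 h.2
  rw [← sum_image (f := fun z : ℕ × ℕ => F z.1 z.2) hinj]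
  refine sum_le_sum_of_subset fun z hz => ?_
  obtain ⟨s, -, rfl⟩ := mem_image.1 hz
  simp [hash_lt hb]

/-! ### Searching for a seed digit by digit -/

theorem argmin_spec {k : ℕ} (hk : 0 < k) (f : ℕ → ℕ) :
    argmin ((List.range k).map f) < k ∧ ∀ i < k, f (argmin ((List.range k).map f)) ≤ f i := by
  have key : ∀ (l : List ℕ) (a : ℕ), (l.foldr min a = a ∨ l.foldr min a ∈ l) ∧
      ∀ x ∈ l, l.foldr min a ≤ x := by
    intro l a
    induction l with
    | nil => simp
    | cons c l ih =>
      obtain ⟨h1, h2⟩ := ih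
      simp only [List.foldr_cons, List.mem_cons]
      refine ⟨?_, ?_⟩
      · rcases min_choice c (l.foldr min a) with h | h <;> rw [h] <;> tauto
      · rintro x (rfl | hx)
        · exact min_le_left _ _
        · exact (min_le_right _ _).trans (h2 x hx)
  set l := (List.range k).map f with hl
  have hne : l ≠ [] := by
    rw [hl]; simp [hk.ne']
  have hmem : l.foldr min l.headI ∈ l := by
    rcases (key l l.headI).1 with h | h
    · rw [h]
      cases h' : l with
      | nil => exact absurd h' hne
      | cons a t => simp
    · exact h
  have hlt : argmin l < l.length := List.idxOf_lt_length_of_mem hmem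
  have hlen : l.length = k := by simp [hl]
  have hget : l[argmin l] = l.foldr min l.headI := List.getElem_idxOf hlt
  refine ⟨hlen ▸ hlt, fun i hi => ?_⟩
  have : f (argmin l) = l[argmin l] := by simp [hl]
  rw [this, hget]
  exact (key l l.headI).2 _ (List.mem_map.2 ⟨i, List.mem_range.2 hi, rfl⟩)

/-- The prefix `pre` of `d` digits is good for `cost`: the average of `cost` over the seeds of
thirteen digits that begin with `pre` is at most the average over all of them. -/
def GoodPrefix (b : ℕ) (cost : ℕ → ℕ) (d pre : ℕ) : Prop :=
  pre < b ^ d ∧ (∑ s ∈ range (b ^ (13 - d)), cost (pre * b ^ (13 - d) + s)) * b ^ d ≤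
    ∑ s ∈ range (b ^ 13), cost s

theorem goodPrefix_zero (b : ℕ) (cost : ℕ → ℕ) : GoodPrefix b cost 0 0 := by
  simp [GoodPrefix]

/-- The method of conditional expectations: the best next digit keeps a prefix good. -/
theorem GoodPrefix.succ {b d pre : ℕ} {cost : ℕ → ℕ} (hb : 0 < b) (hd : d ≤ 12)
    (h : GoodPrefix b cost d pre) :
    GoodPrefix b cost (d + 1)
      (pre * b + argmin ((List.range b).map fun i => blockSum b pre d i cost)) := by
  obtain ⟨h1, h2⟩ := argmin_spec hb fun i => blockSum b pre d i cost
  set a := argmin ((List.range b).map fun i => blockSum b pre d i cost)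
  refine ⟨?_, le_trans ?_ h.2⟩
  · have := h.1
    calc pre * b + a < (pre + 1) * b := by linarith
      _ ≤ b ^ d * b := Nat.mul_le_mul_right _ this
      _ = _ := (pow_succ b d).symm
  · have e : 13 - (d + 1) = 12 - d := by omega
    have e' : 13 - d = 12 - d + 1 := by omega
    rw [e, e', pow_succ b d, ← mul_assoc, mul_right_comm, pow_succ b (12 - d),
      mul_comm (b ^ (12 - d)) b, sum_range_mul]
    refine Nat.mul_le_mul_right _ ?_
    have : ∀ i, ∑ j ∈ range (b ^ (12 - d)), cost (pre * (b * b ^ (12 - d)) + (i * b ^ (12 - d) + j))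
        = blockSum b pre d i cost := by
      intro i
      unfold blockSum
      refine sum_congr rfl fun j _ => ?_
      congr 1
      ring
    simp only [this]
    have h3 := card_nsmul_le_sum (range b) (fun i => blockSum b pre d i cost)
      (blockSum b pre d a cost) fun i hi => h2 i (mem_range.1 hi)
    rw [card_range, smul_eq_mul, mul_comm] at h3
    exact h3

theorem GoodPrefix.cost_le {b pre : ℕ} {cost : ℕ → ℕ} (h : GoodPrefix b cost 13 pre) :
    cost pre * b ^ 13 ≤ ∑ s ∈ range (b ^ 13), cost s := by
  simpa using h.2

/-! ### Averages over the seeds -/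

theorem sum_range_length_getD (l : List ℕ) (f : ℕ → ℕ) :
    ∑ r ∈ range l.length, f (l.getD r 0) = (l.map f).sum := by
  induction l with
  | nil => simp
  | cons a l ih =>
    rw [List.length_cons, sum_range_succ', List.map_cons, List.sum_cons, ← ih, add_comm]
    simp

theorem sum_map_flatMap_replicate (k : ℕ) (g f : ℕ → ℕ) :
    (((List.range k).flatMap fun j => List.replicate (g j) j).map f).sum =
      ∑ j ∈ range k, g j * f j := by
  induction k with
  | zero => simp
  | succ k ih =>
    rw [List.range_succ, List.flatMap_append, List.map_append, List.sum_append, ih,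
      sum_range_succ]
    simp

theorem sum_slots (q : ℕ) (act sl : List ℕ) (x : ℕ) (f : ℕ → ℕ) :
    ((slots q act sl x).map f).sum = ∑ j ∈ range q, slackAt q act sl x j * f j :=
  sum_map_flatMap_replicate _ _ _

theorem length_slots (q : ℕ) (act sl : List ℕ) (x : ℕ) :
    (slots q act sl x).length = ∑ j ∈ range q, slackAt q act sl x j := by
  have := sum_slots q act sl x fun _ => 1
  simpa using this

theorem sum_getD_slots_le (q : ℕ) (act sl : List ℕ) (x : ℕ) (f : ℕ → ℕ) (p : ℕ)
    (h : 0 < (slots q act sl x).length) :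
    ∑ i ∈ range p, f ((slots q act sl x).getD (i % (slots q act sl x).length) 0) ≤
      (p / (slots q act sl x).length + 1) * ∑ j ∈ range q, slackAt q act sl x j * f j := by
  rw [← sum_slots, ← sum_range_length_getD]
  exact sum_range_mod_le (fun r => f ((slots q act sl x).getD r 0)) p h

theorem mul_weight_le (b s : ℕ) : s * weight b s ≤ b ^ 3 + s := by
  rw [weight, mul_add, mul_one]
  exact Nat.add_le_add_right (Nat.mul_div_le _ _) _

/-- The expected cost of an edge, up to the rounding errors of `hash`: the ends take the same
refinement `j` with probability `s u j * s v j / (S u * S v)`, and then cost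
`1 / s u j + 1 / s v j` (in units of `b ^ 3`), so that the sum over `j` is at most
`(S u + S v) / (S u * S v) = 1 / S u + 1 / S v`, where `S` denotes the numbers of slots. -/
theorem sum_edgeCost_le {b q u v : ℕ} {act sl : List ℕ} (hb : 1 ≤ b) (hu : u < hashPrime b)
    (hv : v < hashPrime b) (huv : u ≠ v) (hu0 : 0 < (slots q act sl u).length)
    (hv0 : 0 < (slots q act sl v).length) (hub : (slots q act sl u).length ≤ b)
    (hvb : (slots q act sl v).length ≤ b) (T : ℕ) :
    ∑ s ∈ range T, edgeCost b q act sl u v s ≤ (T / (hashPrime b * hashPrime b) + 1) *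
      ((hashPrime b / (slots q act sl u).length + 1) *
        ((hashPrime b / (slots q act sl v).length + 1) *
          ((b ^ 3 + b) * ((slots q act sl u).length + (slots q act sl v).length)))) := by
  set p := hashPrime b with hp
  set g : ℕ → ℕ → ℕ := fun j k => if j = k then
    weight b (slackAt q act sl u j) + weight b (slackAt q act sl v k) else 0 with hg
  have hcost : ∀ s, edgeCost b q act sl u v s = g
      ((slots q act sl u).getD (hash b s u % (slots q act sl u).length) 0)
      ((slots q act sl v).getD (hash b s v % (slots q act sl v).length) 0) := fun s => rfl
  simp only [hcost]
  refine (sum_hash_le hb hu hv huv (fun i j => g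
      ((slots q act sl u).getD (i % (slots q act sl u).length) 0)
      ((slots q act sl v).getD (j % (slots q act sl v).length) 0)) T).trans
    (Nat.mul_le_mul_left _ ?_)
  calc _ ≤ ∑ i ∈ range p, (p / (slots q act sl v).length + 1) *
        ∑ k ∈ range q, slackAt q act sl v k *
          g ((slots q act sl u).getD (i % (slots q act sl u).length) 0) k :=
        sum_le_sum fun i _ => sum_getD_slots_le q act sl v
          (g ((slots q act sl u).getD (i % (slots q act sl u).length) 0)) p hv0
    _ ≤ (p / (slots q act sl u).length + 1) * ∑ j ∈ range q, slackAt q act sl u j *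
          ((p / (slots q act sl v).length + 1) *
            ∑ k ∈ range q, slackAt q act sl v k * g j k) :=
        sum_getD_slots_le q act sl u (fun j => (p / (slots q act sl v).length + 1) *
            ∑ k ∈ range q, slackAt q act sl v k * g j k) p hu0
    _ = (p / (slots q act sl u).length + 1) * ((p / (slots q act sl v).length + 1) *
          ∑ j ∈ range q, slackAt q act sl u j * (slackAt q act sl v j *
            (weight b (slackAt q act sl u j) + weight b (slackAt q act sl v j)))) := by
        rw [mul_sum (a := p / (slots q act sl v).length + 1)]
        congr 1
        refine sum_congr rfl fun j hj => ?_
        have : ∑ k ∈ range q, slackAt q act sl v k * g j k = slackAt q act sl v j *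
            (weight b (slackAt q act sl u j) + weight b (slackAt q act sl v j)) := by
          rw [sum_eq_single j]
          · simp [hg]
          · intro k _ hk
            simp [hg, hk.symm]
          · exact fun h => absurd hj h
        rw [this]
        ring
    _ ≤ _ := by
        refine Nat.mul_le_mul_left _ (Nat.mul_le_mul_left _ ?_)
        rw [length_slots q act sl u, length_slots q act sl v, ← sum_add_distrib, mul_sum]
        refine sum_le_sum fun j hj => ?_
        have hs : ∀ x, (slots q act sl x).length ≤ b → slackAt q act sl x j ≤ b := by
          intro x hx
          rw [length_slots] at hx
          exact (single_le_sum (f := fun j => slackAt q act sl x j)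
            (fun _ _ => Nat.zero_le _) hj).trans hx
        have h1 := (mul_weight_le b (slackAt q act sl u j)).trans
          (Nat.add_le_add_left (hs u hub) _)
        have h2 := (mul_weight_le b (slackAt q act sl v j)).trans
          (Nat.add_le_add_left (hs v hvb) _)
        nlinarith [Nat.mul_le_mul_left (slackAt q act sl v j) h1,
          Nat.mul_le_mul_left (slackAt q act sl u j) h2]

/-- Rounding up costs a factor of at most `1 + e` if the quotient is at least `1 / e`. -/
theorem div_add_one_le {x y : ℕ} {e : ℝ} (hy : 0 < y) (he : 0 < e) (h : y / e ≤ (x : ℝ)) :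
    ((x / y + 1 : ℕ) : ℝ) ≤ (x / y : ℝ) * (1 + e) := by
  have hy' : (0 : ℝ) < y := by exact_mod_cast hy
  have h1 : ((x / y : ℕ) : ℝ) ≤ x / y := Nat.cast_div_le
  have h2 : 1 ≤ (x / y : ℝ) * e := by
    rw [div_mul_eq_mul_div, le_div_iff₀ hy', one_mul]
    exact (div_le_iff₀ he).1 h
  push_cast
  linarith

/-- Averaged over the seeds, the potential of an edge hardly grows when the residues of its ends
are refined with probabilities proportional to the slacks. -/
theorem average_edgeCost_le {b q u v su sv : ℕ} {act sl : List ℕ} (hb : 100 ≤ b)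
    (hu : u < b) (hv : v < b) (huv : u ≠ v) (hu0 : 0 < su)
    (hv0 : 0 < sv) (hus : su ≤ (slots q act sl u).length) (hvs : sv ≤ (slots q act sl v).length)
    (hub : (slots q act sl u).length ≤ b) (hvb : (slots q act sl v).length ≤ b) :
    ((∑ s ∈ range (b ^ 13), edgeCost b q act sl u v s : ℕ) : ℝ) ≤
      b ^ 13 * ((1 + 1 / b ^ 2 : ℝ) ^ 4 * (weight b su + weight b sv : ℕ)) := by
  obtain ⟨hp, hp1, hp2⟩ := exists_hashPrime (b := b) (by omega)
  have hbp : b ≤ hashPrime b := (Nat.le_self_pow (by norm_num) b).trans hp1.le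
  have key := sum_edgeCost_le (q := q) (act := act) (sl := sl) (by omega) (hu.trans_le hbp)
    (hv.trans_le hbp) huv (hu0.trans_le hus) (hv0.trans_le hvs) hub hvb (b ^ 13)
  set p := hashPrime b
  set Su := (slots q act sl u).length
  set Sv := (slots q act sl v).length
  have hSu0 : 0 < Su := hu0.trans_le hus
  have hSv0 : 0 < Sv := hv0.trans_le hvs
  have hbR : (100 : ℝ) ≤ b := by exact_mod_cast hb
  have hb0 : (0 : ℝ) < b := by linarith
  have hp0 : (0 : ℝ) < p := by exact_mod_cast hp.pos
  have hSuR : (0 : ℝ) < Su := by exact_mod_cast hSu0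
  have hSvR : (0 : ℝ) < Sv := by exact_mod_cast hSv0
  set e : ℝ := 1 / b ^ 2 with he
  have he0 : 0 < e := by positivity
  have hp1R : (b : ℝ) ^ 5 ≤ p := by exact_mod_cast hp1.le
  have hp2R : (p : ℝ) ≤ 2 * b ^ 5 := by exact_mod_cast hp2
  have f1 : ((b ^ 13 / (p * p) + 1 : ℕ) : ℝ) ≤ ((b : ℝ) ^ 13 / (p * p)) * (1 + e) := by
    have := div_add_one_le (x := b ^ 13) (y := p * p) (Nat.mul_pos hp.pos hp.pos) he0 (by
      rw [he, div_div_eq_mul_div, div_one]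
      push_cast
      have : (p * p : ℝ) ≤ (2 * b ^ 5) * (2 * b ^ 5) :=
        mul_le_mul hp2R hp2R hp0.le (by positivity)
      calc (p * p : ℝ) * b ^ 2 ≤ (2 * b ^ 5) * (2 * b ^ 5) * b ^ 2 := by gcongr
        _ = 4 * (b : ℝ) ^ 12 := by ring
        _ ≤ b * (b : ℝ) ^ 12 := by gcongr; linarith
        _ = (b : ℝ) ^ 13 := by ring)
    exact_mod_cast this
  have f2 : ∀ S : ℕ, 0 < S → S ≤ b → ((p / S + 1 : ℕ) : ℝ) ≤ ((p : ℝ) / S) * (1 + e) := by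
    intro S h0 hS
    refine div_add_one_le h0 he0 ?_
    rw [he, div_div_eq_mul_div, div_one]
    have : (S : ℝ) ≤ b := by exact_mod_cast hS
    calc (S : ℝ) * b ^ 2 ≤ b * b ^ 2 := by gcongr
      _ = (b : ℝ) ^ 3 := by ring
      _ ≤ (b : ℝ) ^ 5 := pow_le_pow_right₀ (by linarith) (by norm_num)
      _ ≤ (p : ℝ) := hp1R
  have f3 : ((b ^ 3 + b : ℕ) : ℝ) = b ^ 3 * (1 + e) := by
    rw [he]; push_cast; field_simp
  have f4 : ∀ s S : ℕ, 0 < s → s ≤ S → (b : ℝ) ^ 3 / S ≤ weight b s := by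
    intro s S h0 hS
    have h0' : (0 : ℝ) < s := by exact_mod_cast h0
    have : (b : ℝ) ^ 3 / S ≤ b ^ 3 / s := by
      have : (s : ℝ) ≤ S := by exact_mod_cast hS
      gcongr
    refine this.trans ?_
    rw [div_le_iff₀ h0', weight]
    have := (Nat.lt_div_mul_add h0 (a := b ^ 3)).le
    rw [← Nat.succ_mul] at this
    exact_mod_cast this
  calc ((∑ s ∈ range (b ^ 13), edgeCost b q act sl u v s : ℕ) : ℝ)
      ≤ ((b ^ 13 / (p * p) + 1 : ℕ) : ℝ) * (((p / Su + 1 : ℕ) : ℝ) * (((p / Sv + 1 : ℕ) : ℝ) *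
          (((b ^ 3 + b : ℕ) : ℝ) * (Su + Sv)))) := by exact_mod_cast key
    _ ≤ ((b : ℝ) ^ 13 / (p * p)) * (1 + e) * (((p : ℝ) / Su) * (1 + e) * (((p : ℝ) / Sv) * (1 + e) *
          ((b ^ 3 * (1 + e)) * (Su + Sv)))) := by
        rw [f3]
        gcongr
        · exact f2 Su hSu0 hub
        · exact f2 Sv hSv0 hvb
    _ = b ^ 13 * ((1 + e) ^ 4 * (b ^ 3 / Su + b ^ 3 / Sv)) := by
        field_simp
        ring
    _ ≤ _ := by
        push_cast
        gcongr
        · exact f4 su Su hu0 hus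
        · exact f4 sv Sv hv0 hvs

theorem sum_sum_list {α : Type*} (l : List α) (f : α → ℕ → ℕ) (T : ℕ) :
    ∑ s ∈ range T, (l.map fun a => f a s).sum = (l.map fun a => ∑ s ∈ range T, f a s).sum := by
  induction l with
  | nil => simp
  | cons a l ih => simp [sum_add_distrib, ih]

theorem sum_map_le {α : Type*} {l : List α} {f : α → ℕ} {k : ℕ} (h : ∀ a ∈ l, f a ≤ k) :
    (l.map f).sum ≤ l.length * k := by
  have := List.sum_le_card_nsmul (l.map f) k (by simpa using h)
  simpa using this

/-- Averaged over the seeds, the number of collisions in a list of at most `D` colors is at most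
`1 / D`. -/
theorem average_collisions_le {b D : ℕ} {l : List ℕ} (hb : 100 ≤ b) (hD0 : 0 < D) (hD : D ≤ b)
    (hl : l.length ≤ D) (hlb : ∀ k ∈ l, k < b ^ 5) :
    (∑ s ∈ range (b ^ 13), collisions b D s l) * D ≤ b ^ 13 := by
  obtain ⟨hp, hp1, hp2⟩ := exists_hashPrime (b := b) (by omega)
  set p := hashPrime b with hpdef
  set M := numCells D with hM
  have hM0 : 0 < M := by rw [hM, numCells]; positivity
  have hMp : M ≤ p := by
    calc M = 4 * D ^ 3 := rfl
      _ ≤ b ^ 2 * b ^ 3 := Nat.mul_le_mul (by nlinarith) (Nat.pow_le_pow_left hD 3)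
      _ = b ^ 5 := by ring
      _ ≤ p := hp1.le
  have hpT : p * p ≤ b ^ 13 := by
    calc p * p ≤ (2 * b ^ 5) * (2 * b ^ 5) := Nat.mul_le_mul hp2 hp2
      _ = 4 * b ^ 10 := by ring
      _ ≤ b ^ 3 * b ^ 10 := Nat.mul_le_mul_right _ (by nlinarith [sq_nonneg b])
      _ = b ^ 13 := by ring
  have pair : ∀ k ∈ l, ∀ k' ∈ l, (∑ s ∈ range (b ^ 13),
      if k ≠ k' ∧ cell b D s k = cell b D s k' then 1 else 0) * M ≤ 4 * b ^ 13 := by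
    intro k hk k' hk'
    by_cases hkk : k = k'
    · simp [hkk]
    have h1 := sum_hash_le (b := b) (by omega) ((hlb k hk).trans hp1) ((hlb k' hk').trans hp1) hkk
      (fun i j => if i % M = j % M then 1 else 0) (b ^ 13)
    have h2 : ∀ i ∈ range p, ∑ j ∈ range p, (if i % M = j % M then 1 else 0) ≤ p / M + 1 := by
      intro i _
      refine (sum_range_mod_le (fun j => if i % M = j then 1 else 0) p hM0).trans ?_
      rw [sum_ite_eq]
      split_ifs <;> simp
    have h3 : ∑ i ∈ range p, ∑ j ∈ range p, (if i % M = j % M then 1 else 0) ≤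
        p * (p / M + 1) := by
      refine (sum_le_sum h2).trans ?_
      simp
    have h4 : (p / M + 1) * M ≤ 2 * p := by
      rw [add_mul, one_mul]
      have := Nat.div_mul_le_self p M
      omega
    have h5 : (b ^ 13 / (p * p) + 1) * (p * p) ≤ 2 * b ^ 13 := by
      rw [add_mul, one_mul]
      have := Nat.div_mul_le_self (b ^ 13) (p * p)
      omega
    have h6 : (∑ s ∈ range (b ^ 13), if k ≠ k' ∧ cell b D s k = cell b D s k' then 1 else 0) ≤
        (b ^ 13 / (p * p) + 1) * (p * (p / M + 1)) := by
      refine le_trans ?_ (h1.trans (Nat.mul_le_mul_left _ h3))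
      refine sum_le_sum fun s _ => ?_
      simp only [cell, ← hM, ne_eq, hkk, not_false_eq_true, true_and]
      exact le_rfl
    calc _ ≤ (b ^ 13 / (p * p) + 1) * (p * (p / M + 1)) * M := Nat.mul_le_mul_right _ h6
      _ = (b ^ 13 / (p * p) + 1) * (p * ((p / M + 1) * M)) := by ring
      _ ≤ (b ^ 13 / (p * p) + 1) * (p * (2 * p)) := by gcongr
      _ = 2 * ((b ^ 13 / (p * p) + 1) * (p * p)) := by ring
      _ ≤ 2 * (2 * b ^ 13) := by gcongr
      _ = _ := by ring
  have h7 : (∑ s ∈ range (b ^ 13), collisions b D s l) * M ≤ D * (D * (4 * b ^ 13)) := by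
    unfold collisions
    rw [sum_sum_list]
    simp only [sum_sum_list]
    rw [← List.sum_map_mul_right]
    refine (sum_map_le (k := D * (4 * b ^ 13)) fun k hk => ?_).trans
      (Nat.mul_le_mul_right _ hl)
    rw [← List.sum_map_mul_right]
    exact (sum_map_le fun k' hk' => pair k hk k' hk').trans (Nat.mul_le_mul_right _ hl)
  have h8 : (∑ s ∈ range (b ^ 13), collisions b D s l) * D * (4 * D ^ 2) ≤
      b ^ 13 * (4 * D ^ 2) := by
    calc _ = (∑ s ∈ range (b ^ 13), collisions b D s l) * M := by rw [hM, numCells]; ring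
      _ ≤ _ := h7
      _ = _ := by ring
  exact Nat.le_of_mul_le_mul_right h8 (by positivity)

variable {n m : ℕ} {G : SimpleGraph (Fin n)} [DecidableRel G.Adj] {L : Fin n → Finset (Fin m)}
  {σ : List (StreamToken n m)}

/-! ### Passes over the stream -/

/-- The first `D` colors of a list. -/
def truncated (D : ℕ) (S : Finset (Fin m)) : List ℕ :=
  ((S.sort (· ≤ ·)).map Fin.val).take D

/-- What reading the token `t` adds to the counter `i`. -/
def increment (n b : ℕ) {m : ℕ} (st : Memory) : StreamToken n m → ℕ → ℕ
  | .edge e => edgeIncrement n b st (e.inf : Fin n) (e.sup : Fin n)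
  | .list x S => listIncrement n b st x (truncated st.deg S)

/-- The items stored in phase `6` when the token `t` is read. -/
def itemsOf (st : Memory) : StreamToken n m → List ℕ
  | .edge e =>
    if st.col.getD (e.inf : Fin n) 0 < 2 ∨ st.col.getD (e.sup : Fin n) 0 < 2 then
      [edgeItem (e.inf : Fin n) (e.sup : Fin n)] else []
  | .list x S => if st.col.getD x 0 < 2 then (truncated st.deg S).map (colorItem x) else []

/-- The memory after reading the tokens `τ`. -/
def readTokens (n b : ℕ) {m : ℕ} (st : Memory) (τ : List (StreamToken n m)) : Memory :=
  τ.foldl (fun st t => readToken n b st t.code) st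

theorem readToken_of_phase_ne {b : ℕ} {st : Memory} (h : st.phase ≠ 6) (t : StreamToken n m) :
    readToken n b st t.code = { st with acc := addCounters st.acc (increment n b st t) } := by
  cases t <;> simp [readToken, StreamToken.code, readEdge, readList, h, increment, truncated]

theorem readToken_of_phase_eq {b : ℕ} {st : Memory} (h : st.phase = 6) (t : StreamToken n m) :
    readToken n b st t.code = { st with acc := st.acc ++ itemsOf st t } := by
  cases t <;> simp [readToken, StreamToken.code, readEdge, readList, h, itemsOf, truncated]

theorem readTokens_counters {b k : ℕ} {st : Memory} (h : st.phase ≠ 6)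
    (hacc : st.acc = List.replicate k 0) (τ : List (StreamToken n m)) :
    readTokens n b st τ = { st with
      acc := (List.range k).map fun i => (τ.map fun t => increment n b st t i).sum } := by
  have key : ∀ (τ : List (StreamToken n m)) (f : ℕ → ℕ),
      readTokens n b { st with acc := (List.range k).map f } τ = { st with
        acc := (List.range k).map fun i => f i + (τ.map fun t => increment n b st t i).sum } := by
    intro τ
    induction τ with
    | nil => intro f; simp [readTokens]
    | cons t τ ih =>
      intro f
      have h1 : readToken n b { st with acc := (List.range k).map f } t.code =
          { st with acc := (List.range k).map fun i => f i + increment n b st t i } := by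
        rw [readToken_of_phase_ne (by exact h)]
        have h2 : increment n b { st with acc := (List.range k).map f } t = increment n b st t := by
          cases t <;> rfl
        rw [h2]
        simp only [addCounters, List.length_map, List.length_range, Memory.mk.injEq, true_and]
        refine List.map_congr_left fun i hi => ?_
        simp [List.getD, List.mem_range.1 hi]
      have h3 : readTokens n b { st with acc := (List.range k).map f } (t :: τ) =
          readTokens n b (readToken n b { st with acc := (List.range k).map f } t.code) τ := rfl
      rw [h3, h1, ih]
      simp [add_assoc]
  have h0 := key τ fun _ => 0
  have h1 : (List.range k).map (fun _ => 0) = st.acc := by rw [hacc]; simp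
  rw [h1] at h0
  simpa using h0

theorem readTokens_items {b : ℕ} {st : Memory} (h : st.phase = 6)
    (τ : List (StreamToken n m)) :
    readTokens n b st τ = { st with acc := st.acc ++ τ.flatMap (itemsOf st) } := by
  have key : ∀ (τ : List (StreamToken n m)) (a : List ℕ),
      readTokens n b { st with acc := a } τ =
        { st with acc := a ++ τ.flatMap (itemsOf st) } := by
    intro τ
    induction τ with
    | nil => intro a; simp [readTokens]
    | cons t τ ih =>
      intro a
      have h1 : readToken n b { st with acc := a } t.code =
          { st with acc := a ++ itemsOf st t } := by
        rw [readToken_of_phase_eq (by exact h)]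
        cases t <;> rfl
      have h3 : readTokens n b { st with acc := a } (t :: τ) =
          readTokens n b (readToken n b { st with acc := a } t.code) τ := rfl
      rw [h3, h1, ih]
      simp
  exact key τ st.acc

/-- The sum of `F` over the edges of `G`, written with the smaller endpoint first. -/
def edgeSum (G : SimpleGraph (Fin n)) [DecidableRel G.Adj] (F : Fin n → Fin n → ℕ) : ℕ :=
  ∑ u : Fin n, ∑ v : Fin n, if G.Adj u v ∧ u < v then F u v else 0

/-- The edges and lists of the instance, in a particular order. -/
noncomputable def standardStream (G : SimpleGraph (Fin n)) [DecidableRel G.Adj]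
    (L : Fin n → Finset (Fin m)) : List (StreamToken n m) :=
  ((univ : Finset (Fin n × Fin n)).filter fun e => G.Adj e.1 e.2 ∧ e.1 < e.2).toList.map
    (fun e => .edge s(e.1, e.2)) ++ (univ : Finset (Fin n)).toList.map fun x => .list x (L x)

theorem perm_standardStream (hσ : IsInputStream G L σ) : σ.Perm (standardStream G L) := by
  refine (List.perm_ext_iff_of_nodup hσ.1 ?_).2 fun t => ?_
  · refine List.Nodup.append ?_ ?_ ?_
    · refine (nodup_toList _).map_on fun e he e' he' h => ?_
      simp only [mem_toList, mem_filter, mem_univ, true_and] at he he'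
      simp only [StreamToken.edge.injEq, Sym2.eq_iff] at h
      rcases h with h | h
      · exact Prod.ext h.1 h.2
      · rw [h.1, h.2] at he
        exact absurd he.2 he'.2.not_gt
    · exact (nodup_toList _).map fun x y h => by simpa using (StreamToken.list.inj h).1
    · intro t ht ht'
      simp only [List.mem_map] at ht ht'
      obtain ⟨e, -, rfl⟩ := ht
      obtain ⟨x, -, h⟩ := ht'
      cases h
  · rw [hσ.2 t]
    cases t with
    | edge e =>
      induction e using Sym2.ind with
      | _ u v =>
        simp only [StreamToken.Describes, SimpleGraph.mem_edgeSet, standardStream, List.mem_append,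
          List.mem_map, mem_toList, mem_filter, mem_univ, true_and, Prod.exists,
          StreamToken.edge.injEq, reduceCtorEq, exists_false, or_false, Sym2.eq_iff]
        constructor
        · intro h
          rcases lt_or_gt_of_ne h.ne with h' | h'
          · exact ⟨u, v, ⟨h, h'⟩, Or.inl ⟨rfl, rfl⟩⟩
          · exact ⟨v, u, ⟨h.symm, h'⟩, Or.inr ⟨rfl, rfl⟩⟩
        · rintro ⟨a, d, ⟨h, -⟩, ⟨rfl, rfl⟩ | ⟨rfl, rfl⟩⟩
          · exact h
          · exact h.symm
    | list x S =>
      simp only [StreamToken.Describes, standardStream, List.mem_append, List.mem_map, mem_toList,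
        mem_univ, true_and, StreamToken.list.injEq, reduceCtorEq, and_false, exists_false,
        false_or]
      exact ⟨fun h => ⟨x, rfl, h.symm⟩, by rintro ⟨a, rfl, h⟩; exact h.symm⟩

/-- The order of the tokens does not matter for sums over the stream. -/
theorem sum_stream (hσ : IsInputStream G L σ) (f : StreamToken n m → ℕ) :
    (σ.map f).sum = (∑ u : Fin n, ∑ v : Fin n,
      if G.Adj u v ∧ u < v then f (.edge s(u, v)) else 0) + ∑ x, f (.list x (L x)) := by
  rw [((perm_standardStream hσ).map f).sum_eq, standardStream, List.map_append, List.sum_append,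
    List.map_map, List.map_map, ← Fintype.sum_prod_type', ← sum_filter]
  congr 1
  · exact sum_map_toList _ _
  · exact sum_map_toList _ _

theorem sum_increment (hσ : IsInputStream G L σ) (b : ℕ) (st : Memory) (i : ℕ) :
    (σ.map fun t => increment n b st t i).sum =
      edgeSum G (fun u v => edgeIncrement n b st u v i) +
        ∑ x : Fin n, listIncrement n b st x (truncated st.deg (L x)) i := by
  rw [sum_stream hσ, edgeSum]
  congr 1
  refine sum_congr rfl fun u _ => sum_congr rfl fun v _ => ?_
  refine ite_congr rfl (fun h => ?_) fun _ => rfl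
  simp only [increment, Sym2.inf_mk, Sym2.sup_mk, min_eq_left h.2.le, max_eq_right h.2.le]

theorem edgeSum_mono {F F' : Fin n → Fin n → ℕ}
    (h : ∀ u v : Fin n, G.Adj u v → u < v → F u v ≤ F' u v) : edgeSum G F ≤ edgeSum G F' := by
  refine sum_le_sum fun u _ => sum_le_sum fun v _ => ?_
  split_ifs with huv
  · exact h u v huv.1 huv.2
  · exact le_rfl

theorem edgeSum_congr {F F' : Fin n → Fin n → ℕ}
    (h : ∀ u v : Fin n, G.Adj u v → u < v → F u v = F' u v) : edgeSum G F = edgeSum G F' :=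
  (edgeSum_mono fun u v h1 h2 => (h u v h1 h2).le).antisymm
    (edgeSum_mono fun u v h1 h2 => (h u v h1 h2).ge)

theorem edgeSum_zero : edgeSum G (fun _ _ => 0) = 0 := by
  simp [edgeSum]

theorem edgeSum_sum (k : ℕ) (F : Fin n → Fin n → ℕ → ℕ) :
    edgeSum G (fun u v => ∑ s ∈ range k, F u v s) =
      ∑ s ∈ range k, edgeSum G fun u v => F u v s := by
  simp only [edgeSum]
  rw [sum_comm (s := range k)]
  refine sum_congr rfl fun u _ => ?_
  rw [sum_comm (s := range k)]
  refine sum_congr rfl fun v _ => ?_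
  split_ifs <;> simp

/-- The sum over the edges of contributions of both ends, as a sum over pairs of adjacent
vertices. -/
theorem edgeSum_add (f F : Fin n → Fin n → ℕ)
    (h : ∀ u v : Fin n, F u v = f u v + f v u) :
    edgeSum G F = ∑ u : Fin n, ∑ v : Fin n, if G.Adj u v then f u v else 0 := by
  have h1 : ∑ u : Fin n, ∑ v : Fin n, (if G.Adj u v ∧ u < v then f v u else 0) =
      ∑ u : Fin n, ∑ v : Fin n, if G.Adj u v ∧ v < u then f u v else 0 := by
    rw [sum_comm]
    simp only [G.adj_comm]
  have h2 : edgeSum G F =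
      (∑ u : Fin n, ∑ v : Fin n, if G.Adj u v ∧ u < v then f u v else 0) +
      ∑ u : Fin n, ∑ v : Fin n, if G.Adj u v ∧ u < v then f v u else 0 := by
    simp only [edgeSum, h, ← sum_add_distrib]
    refine sum_congr rfl fun u _ => sum_congr rfl fun v _ => ?_
    split_ifs <;> simp
  rw [h2, h1]
  simp only [← sum_add_distrib]
  refine sum_congr rfl fun u _ => sum_congr rfl fun v _ => ?_
  by_cases huv : G.Adj u v
  · rcases lt_or_gt_of_ne huv.ne with h' | h' <;> simp [huv, h', h'.not_gt]
  · simp [huv]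

/-- The sum over the edges at `x` of a contribution of the other end. -/
theorem edgeSum_incident (x : Fin n) (f : Fin n → ℕ) (F : Fin n → Fin n → ℕ)
    (h : ∀ u v : Fin n, F u v = (if x = u then f v else 0) + if x = v then f u else 0) :
    edgeSum G F = ∑ y ∈ G.neighborFinset x, f y := by
  rw [edgeSum_add (fun u v => if x = u then f v else 0) F h, sum_eq_single x]
  · simp [← sum_filter, SimpleGraph.neighborFinset_eq_filter]
  · intro u _ hu
    simp [hu.symm]
  · simp

/-! ### Runs -/

/-- The memory after a pass that begins with `st`. -/
def pass (b : ℕ) (σ : List (StreamToken n m)) (st : Memory) : Memory :=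
  endPass n m b (readTokens n b st σ)

/-- A bound for the number of bits of a memory with at most `16 * b + 6` numbers below
`b ^ 20`. -/
def spaceBound (b : ℕ) : ℕ := (16 * b + 6) * (2 * (20 * (Nat.log 2 b + 1)) + 2) + 10

/-- During a pass that begins with `st`, the memory obeys the bound. -/
def Fits (b : ℕ) (σ : List (StreamToken n m)) (st : Memory) : Prop :=
  ∀ τ, τ <+: σ → (readTokens n b st τ).encode.length ≤ spaceBound b

/-- In `k` passes, `st` becomes `st'`; the space bound is obeyed, and the algorithm does not stop
before. -/
def Run (b : ℕ) (σ : List (StreamToken n m)) (k : ℕ) (st st' : Memory) : Prop :=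
  (pass b σ)^[k] st = st' ∧
    ∀ i < k, Fits b σ ((pass b σ)^[i] st) ∧ ((pass b σ)^[i] st).phase ≠ 7

theorem Run.refl (b : ℕ) (σ : List (StreamToken n m)) (st : Memory) : Run b σ 0 st st :=
  ⟨rfl, fun _ h => absurd h (Nat.not_lt_zero _)⟩

theorem Run.single {b : ℕ} {st : Memory} (h : Fits b σ st) (h7 : st.phase ≠ 7) :
    Run b σ 1 st (pass b σ st) := by
  refine ⟨rfl, fun i hi => ?_⟩
  obtain rfl : i = 0 := by omega
  exact ⟨h, h7⟩

theorem Run.trans {b k k' : ℕ} {st st' st'' : Memory} (h : Run b σ k st st')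
    (h' : Run b σ k' st' st'') : Run b σ (k + k') st st'' := by
  refine ⟨by rw [add_comm, Function.iterate_add_apply, h.1, h'.1], fun i hi => ?_⟩
  by_cases hik : i < k
  · exact h.2 i hik
  · obtain ⟨j, rfl⟩ := Nat.exists_eq_add_of_le (not_lt.1 hik)
    rw [add_comm, Function.iterate_add_apply, h.1]
    exact h'.2 j (by omega)

theorem readAll_algorithm (c : ℕ) (τ : List (StreamToken n m)) (st : Memory) :
    (algorithm c).readAll τ st.encode = (readTokens n (base c n) st τ).encode := by
  induction τ generalizing st with
  | nil => rfl
  | cons t τ ih =>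
    have h1 : (algorithm c).readAll (t :: τ) st.encode = (algorithm c).readAll τ
        ((algorithm c).read ((n, m), st.encode, t.code)) := by
      rw [StreamingAlgorithm.readAll, List.foldl_cons]
      rfl
    rw [h1, algorithm_read, Memory.decode_encode, ih]
    rfl

theorem afterPasses_algorithm (c : ℕ) (σ : List (StreamToken n m)) (i : ℕ) :
    (algorithm c).afterPasses σ i = ((pass (base c n) σ)^[i] (initial n)).encode := by
  induction i with
  | zero => rfl
  | succ i ih =>
    have h1 : (algorithm c).afterPasses σ (i + 1) = (algorithm c).endPass ((n, m),
        (algorithm c).readAll σ ((algorithm c).afterPasses σ i)) := rfl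
    rw [h1, ih, readAll_algorithm, algorithm_endPass, Memory.decode_encode,
      Function.iterate_succ_apply']
    rfl

theorem stopsWith_of_run {c k : ℕ} {st : Memory} (h : Run (base c n) σ k (initial n) st)
    (h7 : st.phase = 7) : (algorithm c).StopsWith σ k (st.col.map fun k => k - 2) := by
  have hout : ∀ i, (algorithm c).output ((n, m), (algorithm c).afterPasses σ i) =
      output ((pass (base c n) σ)^[i] (initial n)) := by
    intro i
    rw [afterPasses_algorithm, algorithm_output, Memory.decode_encode]
  refine ⟨?_, ?_, fun i _ hi => ?_⟩
  · by_contra hk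
    obtain rfl : k = 0 := by omega
    rw [← h.1] at h7
    exact absurd h7 (by simp [initial])
  · rw [hout, h.1, output, if_pos h7]
  · rw [hout, output, if_neg (h.2 i hi).2]

theorem usesSpaceAtMost_of_run {c k : ℕ} {st : Memory} (h : Run (base c n) σ k (initial n) st)
    (hst : st.encode.length ≤ spaceBound (base c n)) {s : ℝ}
    (hs : (spaceBound (base c n) : ℝ) ≤ s) : (algorithm c).UsesSpaceAtMost σ k s := by
  refine ⟨fun i hi τ hτ => ?_, ?_⟩
  · rw [afterPasses_algorithm, readAll_algorithm]
    exact le_trans (by exact_mod_cast (h.2 i hi).1 τ hτ) hs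
  · rw [afterPasses_algorithm, h.1]
    exact le_trans (by exact_mod_cast hst) hs

/-! ### Space -/

theorem length_encode_le {b : ℕ} {st : Memory}
    (hreg : ∀ a ∈ [st.phase, st.deg, st.cellSeed, st.modulus, st.seed, st.digits], a < b ^ 20)
    (hlist : ∀ l ∈ [st.col, st.res, st.slack, st.acc], l.length ≤ 4 * b ∧ ∀ a ∈ l, a < b ^ 20) :
    st.encode.length ≤ spaceBound b := by
  set k := 20 * (Nat.log 2 b + 1) with hk
  have hpow : b ^ 20 ≤ 2 ^ k := by
    rw [hk, mul_comm, pow_mul]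
    exact Nat.pow_le_pow_left (Nat.lt_pow_succ_log_self (by norm_num) b).le 20
  have h0 := length_encodeList_le (k := k) (by omega) fun a ha => (hreg a ha).trans_le hpow
  have h1 : ∀ l ∈ [st.col, st.res, st.slack, st.acc],
      (encodeList l).length ≤ 4 * b * (2 * k + 2) + 2 := fun l hl =>
    (length_encodeList_le (by omega) fun a ha => ((hlist l hl).2 a ha).trans_le hpow).trans
      (Nat.add_le_add_right (Nat.mul_le_mul_right _ (hlist l hl).1) _)
  have e1 := h1 st.col (by simp)
  have e2 := h1 st.res (by simp)
  have e3 := h1 st.slack (by simp)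
  have e4 := h1 st.acc (by simp)
  simp only [Memory.encode, encodeLists, Memory.toLists, List.flatMap_cons, List.flatMap_nil,
    List.length_append, List.length_nil, spaceBound, ← hk]
  simp only [List.length_cons, List.length_nil] at h0
  linarith

/-- Bounds for the parts of the memory that do not change during a pass. -/
structure Bounded (n b : ℕ) (st : Memory) : Prop where
  phase : st.phase ≤ 7
  deg : st.deg ≤ b
  cellSeed : st.cellSeed < b ^ 13
  modulus : st.modulus ≤ b ^ 5
  seed : st.seed < b ^ 13
  digits : st.digits ≤ 13
  length_col : st.col.length ≤ n
  col : ∀ a ∈ st.col, a ≤ b ^ 4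
  length_res : st.res.length ≤ n
  res : ∀ a ∈ st.res, a ≤ b ^ 5
  length_slack : st.slack.length ≤ 2 * n
  slack : ∀ a ∈ st.slack, a ≤ b

theorem Bounded.length_encode_le {b : ℕ} {st : Memory} (h : Bounded n b st) (hb : 100 ≤ b)
    (hn : n ≤ b) (hlen : st.acc.length ≤ 4 * b) (hacc : ∀ a ∈ st.acc, a < b ^ 20) :
    st.encode.length ≤ spaceBound b := by
  have pow : ∀ {i : ℕ}, i < 20 → b ^ i < b ^ 20 := fun {i} hi =>
    Nat.pow_lt_pow_right (by omega) hi
  have pow1 : b < b ^ 20 := by simpa using pow (i := 1) (by norm_num)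
  refine ListColoring.length_encode_le ?_ ?_
  · intro a ha
    simp only [List.mem_cons, List.not_mem_nil, or_false] at ha
    have := h.phase
    have := h.digits
    rcases ha with rfl | rfl | rfl | rfl | rfl | rfl
    · omega
    · exact h.deg.trans_lt pow1
    · exact h.cellSeed.trans (pow (by norm_num))
    · exact h.modulus.trans_lt (pow (by norm_num))
    · exact h.seed.trans (pow (by norm_num))
    · omega
  · intro l hl
    simp only [List.mem_cons, List.not_mem_nil, or_false] at hl
    have h1 := h.length_col
    have h2 := h.length_res
    have h3 := h.length_slack
    rcases hl with rfl | rfl | rfl | rfl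
    · exact ⟨by omega, fun a ha => (h.col a ha).trans_lt (pow (by norm_num))⟩
    · exact ⟨by omega, fun a ha => (h.res a ha).trans_lt (pow (by norm_num))⟩
    · exact ⟨by omega, fun a ha => (h.slack a ha).trans_lt pow1⟩
    · exact ⟨hlen, hacc⟩

theorem blockSum_le {b pre d i k : ℕ} (hb : 1 ≤ b) {f : ℕ → ℕ} (h : ∀ s, f s ≤ k) :
    blockSum b pre d i f ≤ b ^ 12 * k := by
  refine (sum_le_card_nsmul _ _ k fun s _ => h _).trans ?_
  rw [card_range, smul_eq_mul]
  exact Nat.mul_le_mul_right _ (Nat.pow_le_pow_right hb (by omega))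

theorem length_truncated_le (D : ℕ) (S : Finset (Fin m)) : (truncated D S).length ≤ D := by
  simp [truncated]

theorem lt_of_mem_truncated {D k : ℕ} {S : Finset (Fin m)} (h : k ∈ truncated D S) : k < m := by
  obtain ⟨a, -, rfl⟩ := List.mem_map.1 (List.mem_of_mem_take h)
  exact a.2

theorem increment_le {b : ℕ} {st : Memory} (hb : 100 ≤ b) (hm : m ≤ b ^ 3) (hdeg : st.deg ≤ b)
    (t : StreamToken n m) (i : ℕ) : increment n b st t i ≤ b ^ 17 := by
  have hb1 : 1 ≤ b := by omega
  have pow : ∀ {i : ℕ}, i ≤ 17 → b ^ i ≤ b ^ 17 := fun {i} hi => Nat.pow_le_pow_right hb1 hi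
  have hbig : 2 ≤ b ^ 17 := by
    calc 2 ≤ b ^ 1 := by rw [pow_one]; omega
      _ ≤ _ := pow (by norm_num)
  cases t with
  | edge e =>
    simp only [increment, edgeIncrement]
    split_ifs
    any_goals omega
    any_goals
      have hh : ∀ R a y, hits b st R a y ≤ 1 := by
        intro R a y
        unfold hits
        split_ifs <;> simp
    any_goals exact (Nat.add_le_add (hh _ _ _) (hh _ _ _)).trans hbig
    any_goals exact (Nat.add_le_add (hh _ _ _) le_rfl).trans (by omega)
    any_goals exact (Nat.add_le_add le_rfl (hh _ _ _)).trans (by omega)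
    refine (blockSum_le hb1 (k := b ^ 5) fun s => ?_).trans (le_of_eq (by ring))
    unfold edgeCost
    split_ifs
    · have hw : ∀ s, weight b s ≤ b ^ 3 + 1 := fun s => Nat.succ_le_succ (Nat.div_le_self _ _)
      refine (Nat.add_le_add (hw _) (hw _)).trans ?_
      have : 1 ≤ b ^ 3 := Nat.one_le_pow _ _ hb1
      calc b ^ 3 + 1 + (b ^ 3 + 1) ≤ 4 * b ^ 3 := by omega
        _ ≤ b ^ 2 * b ^ 3 := Nat.mul_le_mul_right _ (by nlinarith)
        _ = _ := by ring
    · exact Nat.zero_le _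
  | list x S =>
    have hlen : (truncated st.deg S).length ≤ b := (length_truncated_le _ _).trans hdeg
    have hcoll : ∀ s, collisions b st.deg s (truncated st.deg S) ≤ b ^ 2 := by
      intro s
      refine (sum_map_le (k := b) fun k _ => ?_).trans
        ((Nat.mul_le_mul_right _ hlen).trans (le_of_eq (by ring)))
      refine (sum_map_le (k := 1) fun k' _ => ?_).trans (by simpa using hlen)
      split_ifs <;> simp
    simp only [increment, listIncrement]
    split_ifs
    any_goals exact Nat.zero_le _
    · refine (blockSum_le hb1 hcoll).trans ?_
      rw [← pow_add]
      exact pow (by norm_num)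
    · exact (hcoll _).trans (pow (by norm_num))
    · refine (sum_map_le (k := 1) fun k' _ => ?_).trans ((by simpa using hlen : _ ≤ b ^ 1).trans
        (pow (by norm_num)))
      split_ifs <;> simp
    · refine (sum_map_le (k := b ^ 4) fun k hk => ?_).trans
        ((Nat.mul_le_mul_right _ hlen).trans ((le_of_eq (by ring : b * b ^ 4 = b ^ 5)).trans
          (pow (by norm_num))))
      have := lt_of_mem_truncated hk
      split_ifs
      · have h3 : 1 ≤ b ^ 3 := Nat.one_le_pow _ _ hb1
        calc k + 2 ≤ 3 * b ^ 3 := by omega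
          _ ≤ b * b ^ 3 := Nat.mul_le_mul_right _ (by omega)
          _ = _ := by ring
      · exact Nat.zero_le _

theorem length_stream_le (hσ : IsInputStream G L σ) : σ.length ≤ n * n + n := by
  have := sum_stream hσ fun _ => 1
  simp only [List.map_const', List.sum_replicate, smul_eq_mul, mul_one, sum_const, card_univ,
    Fintype.card_fin] at this
  rw [this]
  refine Nat.add_le_add_right ?_ _
  calc _ ≤ ∑ _u : Fin n, ∑ _v : Fin n, 1 :=
        sum_le_sum fun u _ => sum_le_sum fun v _ => by split_ifs <;> simp
    _ = n * n := by simp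

/-- A pass that starts with at most `4 * b` zero counters obeys the space bound. -/
theorem fits_counters {b k : ℕ} {st : Memory} (hσ : IsInputStream G L σ) (hb : 100 ≤ b)
    (hn : n < b) (hm : m ≤ b ^ 3) (hst : Bounded n b st) (h6 : st.phase ≠ 6)
    (hk : k ≤ 4 * b) (hacc : st.acc = List.replicate k 0) : Fits b σ st := by
  intro τ hτ
  rw [readTokens_counters h6 hacc]
  have hlen : τ.length ≤ b * n + n :=
    hτ.length_le.trans ((length_stream_le hσ).trans (by gcongr))
  have hst' : Bounded n b { st with
      acc := (List.range k).map fun i => (τ.map fun t => increment n b st t i).sum } :=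
    ⟨hst.1, hst.2, hst.3, hst.4, hst.5, hst.6, hst.7, hst.8, hst.9, hst.10, hst.11, hst.12⟩
  refine hst'.length_encode_le hb hn.le (by simpa using hk) fun a ha => ?_
  obtain ⟨i, -, rfl⟩ := List.mem_map.1 ha
  refine (sum_map_le fun t _ => increment_le hb hm hst.deg t i).trans_lt ?_
  calc τ.length * b ^ 17 ≤ (b * n + n) * b ^ 17 := Nat.mul_le_mul_right _ hlen
    _ < (b * b * b) * b ^ 17 := by
        refine Nat.mul_lt_mul_of_pos_right ?_ (by positivity)
        nlinarith
    _ = _ := by ring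

variable {b : ℕ} {st : Memory}

/-! ### Slacks -/

/-- A list-coloring instance with its stream, and a number `b` that is large enough compared with
it. -/
structure Setting (b : ℕ) (G : SimpleGraph (Fin n)) [DecidableRel G.Adj]
    (L : Fin n → Finset (Fin m)) (σ : List (StreamToken n m)) : Prop where
  hb : 100 ≤ b
  hn : n < b
  hm : m ≤ b ^ 3
  hL : ∀ x, G.degree x + 1 ≤ (L x).card
  hσ : IsInputStream G L σ

theorem Setting.maxDegree_lt (h : Setting b G L σ) : G.maxDegree + 1 ≤ b := by
  have : G.maxDegree ≤ n := by
    refine G.maxDegree_le_of_forall_degree_le _ fun x => ?_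
    simpa using (G.degree_lt_card_verts x).le
  have := h.hn
  omega

/-- Truncated lists are still longer than the degree. -/
theorem degree_lt_length_truncated (h : Setting b G L σ) (x : Fin n) :
    G.degree x + 1 ≤ (truncated (G.maxDegree + 1) (L x)).length := by
  have h1 := h.hL x
  have h2 := G.degree_le_maxDegree x
  simp only [truncated, List.length_take, List.length_map, length_sort]
  omega

theorem nodup_truncated (D : ℕ) (S : Finset (Fin m)) : (truncated D S).Nodup :=
  ((sort_nodup S (· ≤ ·)).map Fin.val_injective).sublist (List.take_sublist _ _)

theorem mem_of_mem_truncated {D : ℕ} {S : Finset (Fin m)} {k : Fin m}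
    (h : (k : ℕ) ∈ truncated D S) : k ∈ S := by
  obtain ⟨a, ha, hak⟩ := List.mem_map.1 (List.mem_of_mem_take h)
  rw [← Fin.val_injective hak]
  exact (mem_sort (· ≤ ·)).1 ha

/-- The number of neighbors of `x` whose color is in a cell congruent to `a` modulo `R`. -/
def taken (b : ℕ) (G : SimpleGraph (Fin n)) [DecidableRel G.Adj] (st : Memory) (R a : ℕ)
    (x : Fin n) : ℕ := ∑ y ∈ G.neighborFinset x, hits b st R a y

/-- The slack of the vertex `x` for the residue `a` modulo `R`: the number of colors of its list in
cells congruent to `a`, minus the number of neighbors that have a color in such a cell. -/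
def slackOf (b : ℕ) (G : SimpleGraph (Fin n)) [DecidableRel G.Adj] (L : Fin n → Finset (Fin m))
    (st : Memory) (R a : ℕ) (x : Fin n) : ℕ :=
  cellCount b st.deg st.cellSeed R a (truncated st.deg (L x)) - taken b G st R a x

theorem sum_residue_split {R a q : ℕ} (hR : 0 < R) (hq : 0 < q) (ha : a < R) (k : ℕ) :
    ∑ j ∈ range q, (if k % (R * q) = a + R * j then 1 else 0) = if k % R = a then 1 else 0 := by
  rw [Nat.mod_mul]
  have : ∀ j, k % R + R * (k / R % q) = a + R * j ↔ k % R = a ∧ k / R % q = j := by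
    intro j
    constructor
    · intro h
      have h1 := congrArg (· % R) h
      simp only [Nat.add_mul_mod_self_left, Nat.mod_mod, Nat.mod_eq_of_lt ha] at h1
      refine ⟨h1, ?_⟩
      rw [h1] at h
      exact Nat.eq_of_mul_eq_mul_left hR (Nat.add_left_cancel h)
    · rintro ⟨h1, h2⟩
      rw [h1, h2]
  simp only [this]
  by_cases h : k % R = a
  · simp [h, Nat.mod_lt _ hq]
  · simp [h]

theorem sum_cellCount_split {R a q D gs : ℕ} (hR : 0 < R) (hq : 0 < q) (ha : a < R)
    (l : List ℕ) :
    ∑ j ∈ range q, cellCount b D gs (R * q) (a + R * j) l = cellCount b D gs R a l := by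
  unfold cellCount
  rw [sum_sum_list]
  simp only [sum_residue_split hR hq ha]

theorem sum_taken_split {R a q : ℕ} (hR : 0 < R) (hq : 0 < q) (ha : a < R) (x : Fin n) :
    ∑ j ∈ range q, taken b G st (R * q) (a + R * j) x = taken b G st R a x := by
  unfold taken
  rw [sum_comm]
  refine sum_congr rfl fun y _ => ?_
  unfold hits
  by_cases h : 2 ≤ st.col.getD y 0
  · simp only [h, true_and]
    exact sum_residue_split hR hq ha _
  · simp only [h, false_and, if_false, sum_const_zero]

/-- The slack of a residue is at most the sum of the slacks of its refinements. It need not be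
equal, as the slacks of refinements are truncated at `0`. -/
theorem slackOf_le_sum {R a q : ℕ} (hR : 0 < R) (hq : 0 < q) (ha : a < R) (x : Fin n) :
    slackOf b G L st R a x ≤ ∑ j ∈ range q, slackOf b G L st (R * q) (a + R * j) x := by
  unfold slackOf
  rw [← sum_cellCount_split hR hq ha, ← sum_taken_split hR hq ha, tsub_le_iff_left,
    ← sum_add_distrib]
  exact sum_le_sum fun j _ => by omega

theorem cellCount_le (D gs R a : ℕ) (l : List ℕ) : cellCount b D gs R a l ≤ l.length := by
  refine (sum_map_le (k := 1) fun k _ => ?_).trans (by simp)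
  split_ifs <;> simp

theorem slackOf_le (R a : ℕ) (x : Fin n) : slackOf b G L st R a x ≤ st.deg :=
  (Nat.sub_le _ _).trans ((cellCount_le _ _ _ _ _).trans (length_truncated_le _ _))

theorem sum_slackOf_le {R a q : ℕ} (hR : 0 < R) (hq : 0 < q) (ha : a < R) (x : Fin n) :
    ∑ j ∈ range q, slackOf b G L st (R * q) (a + R * j) x ≤ st.deg := by
  refine le_trans (sum_le_sum fun j _ => Nat.sub_le _ _) ?_
  rw [sum_cellCount_split hR hq ha]
  exact (cellCount_le _ _ _ _ _).trans (length_truncated_le _ _)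

theorem mem_activeList {col : List ℕ} {x : ℕ} :
    x ∈ activeList col ↔ x < col.length ∧ col.getD x 0 = 1 := by
  simp [activeList]

theorem mem_activeList_iff {col : List ℕ} {x : ℕ} : x ∈ activeList col ↔ col.getD x 0 = 1 := by
  rw [mem_activeList]
  refine ⟨fun h => h.2, fun h => ⟨?_, h⟩⟩
  by_contra hx
  rw [List.getD_eq_default _ _ (not_lt.1 hx)] at h
  exact zero_ne_one h

theorem nodup_activeList (col : List ℕ) : (activeList col).Nodup :=
  List.nodup_range.filter _

theorem length_activeList {col : List ℕ} (h : col.length = n) :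
    (activeList col).length = #{x : Fin n | col.getD x 0 = 1} := by
  rw [← List.toFinset_card_of_nodup (nodup_activeList col), ← card_map Fin.valEmbedding]
  congr 1
  ext x
  simp only [List.mem_toFinset, mem_activeList, mem_map, mem_filter, mem_univ, true_and,
    Fin.valEmbedding_apply, h]
  exact ⟨fun hx => ⟨⟨x, hx.1⟩, hx.2, rfl⟩, by rintro ⟨y, hy, rfl⟩; exact ⟨y.2, hy⟩⟩

theorem length_activeList_le {col : List ℕ} (h : col.length = n) :
    (activeList col).length ≤ n := by
  rw [length_activeList h]
  exact (card_filter_le _ _).trans (by simp)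

theorem splitting_pos (n : ℕ) (col : List ℕ) : 0 < splitting n col := Nat.succ_pos _

theorem splitting_le (n : ℕ) (col : List ℕ) : splitting n col ≤ n + 1 :=
  Nat.succ_le_succ (Nat.div_le_self _ _)

theorem length_mul_splitting_le {col : List ℕ} (h : col.length = n) :
    (activeList col).length * splitting n col ≤ 2 * n := by
  have h1 := Nat.mul_div_le n (activeList col).length
  have h2 := length_activeList_le h
  rw [splitting, mul_add, mul_one]
  omega

/-! ### Invariants -/

/-- The properties of the partial coloring that hold from the first epoch on: it is a proper list
coloring (`mem`, `proper`), the colors in the list of an active vertex lie in different cells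
(`inj`), and few vertices have been set aside (`aside`). -/
structure Colored (b : ℕ) (G : SimpleGraph (Fin n)) [DecidableRel G.Adj]
    (L : Fin n → Finset (Fin m)) (st : Memory) : Prop where
  bounded : Bounded n b st
  deg_eq : st.deg = G.maxDegree + 1
  length_col : st.col.length = n
  mem : ∀ (x : Fin n) (k : ℕ), st.col.getD x 0 = k + 2 → k ∈ truncated st.deg (L x)
  proper : ∀ x y : Fin n, G.Adj x y → 2 ≤ st.col.getD x 0 → st.col.getD x 0 ≠ st.col.getD y 0
  inj : ∀ x : Fin n, st.col.getD x 0 = 1 → ∀ k ∈ truncated st.deg (L x),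
    ∀ k' ∈ truncated st.deg (L x),
      cell b st.deg st.cellSeed k = cell b st.deg st.cellSeed k' → k = k'
  aside : #{x : Fin n | st.col.getD x 0 = 0} * st.deg ≤ n

/-- The sum of the weights of the ends of all edges between active vertices with the same
residue. -/
def potential (b : ℕ) (G : SimpleGraph (Fin n)) [DecidableRel G.Adj]
    (L : Fin n → Finset (Fin m)) (st : Memory) : ℕ :=
  edgeSum G fun u v => if Conflict st u v then
    weight b (slackOf b G L st st.modulus (st.res.getD u 0) u) +
      weight b (slackOf b G L st st.modulus (st.res.getD v 0) v) else 0

/-- The state of an epoch after `t` refinements of the residues. The powers of `1 + 1 / b ^ 2` in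
the bound for the potential account for the rounding errors. -/
structure Refined (b : ℕ) (G : SimpleGraph (Fin n)) [DecidableRel G.Adj]
    (L : Fin n → Finset (Fin m)) (t : ℕ) (st : Memory) : Prop extends Colored b G L st where
  modulus_eq : st.modulus = splitting n st.col ^ t
  length_res : st.res.length = n
  res_lt : ∀ x : Fin n, st.res.getD x 0 < st.modulus
  slack_pos : ∀ x : Fin n, st.col.getD x 0 = 1 →
    0 < slackOf b G L st st.modulus (st.res.getD x 0) x
  potential_le : (potential b G L st : ℝ) ≤
    (1 + 1 / b ^ 2 : ℝ) ^ (4 * t + 1) * ((activeList st.col).length * b ^ 3)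

/-- The cost of a seed for the refinement of the residues: the potential after it. -/
def refineCost (b : ℕ) (G : SimpleGraph (Fin n)) [DecidableRel G.Adj] (st : Memory) (s : ℕ) : ℕ :=
  edgeSum G fun u v => if Conflict st u v then
    edgeCost b (splitting n st.col) (activeList st.col) st.slack u v s else 0

/-- The state of the search for the seed of the next refinement, when `d` digits are known. -/
structure Searching (b : ℕ) (G : SimpleGraph (Fin n)) [DecidableRel G.Adj]
    (L : Fin n → Finset (Fin m)) (t d : ℕ) (st : Memory) : Prop extends Refined b G L t st where
  phase_eq : st.phase = 4
  digits_eq : st.digits = d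
  acc_eq : st.acc = List.replicate b 0
  modulus_lt : st.modulus < numCells st.deg
  slackAt_eq : ∀ x : Fin n, st.col.getD x 0 = 1 → ∀ j < splitting n st.col,
    slackAt (splitting n st.col) (activeList st.col) st.slack x j =
      slackOf b G L st (st.modulus * splitting n st.col) (st.res.getD x 0 + st.modulus * j) x
  good : GoodPrefix b (refineCost b G st) d st.seed

/-- The state before the slacks are counted. -/
structure Counting (b : ℕ) (G : SimpleGraph (Fin n)) [DecidableRel G.Adj]
    (L : Fin n → Finset (Fin m)) (t : ℕ) (st : Memory) : Prop extends Refined b G L t st where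
  phase_eq : st.phase = 3
  acc_eq : st.acc =
    List.replicate (2 * ((activeList st.col).length * splitting n st.col)) 0
  modulus_lt : st.modulus < numCells st.deg

theorem Colored.transfer {st' : Memory} (h : Colored b G L st)
    (hb : Bounded n b st') (h1 : st'.deg = st.deg) (h2 : st'.cellSeed = st.cellSeed)
    (h3 : st'.col = st.col) : Colored b G L st' := by
  obtain ⟨_, _, _, _, _, _, _, _, _, _⟩ := st
  obtain ⟨_, _, _, _, _, _, _, _, _, _⟩ := st'
  simp only at h1 h2 h3
  subst h1 h2 h3
  exact ⟨hb, h.2, h.3, h.4, h.5, h.6, h.7⟩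

theorem Refined.transfer {t : ℕ} {st' : Memory} (h : Refined b G L t st)
    (hb : Bounded n b st') (h1 : st'.deg = st.deg) (h2 : st'.cellSeed = st.cellSeed)
    (h3 : st'.modulus = st.modulus) (h4 : st'.col = st.col) (h5 : st'.res = st.res) :
    Refined b G L t st' := by
  have hc := h.toColored.transfer hb h1 h2 h4
  obtain ⟨_, _, _, _, _, _, _, _, _, _⟩ := st
  obtain ⟨_, _, _, _, _, _, _, _, _, _⟩ := st'
  simp only at h1 h2 h3 h4 h5
  subst h1 h2 h3 h4 h5
  exact ⟨hc, h.modulus_eq, h.length_res, h.res_lt, h.slack_pos, h.potential_le⟩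

theorem Refined.modulus_pos {t : ℕ} (h : Refined b G L t st) : 0 < st.modulus := by
  rw [h.modulus_eq]
  exact Nat.pow_pos (splitting_pos _ _)

/-! ### Counting the slacks -/

theorem sum_increment_phase_three_even (hσ : IsInputStream G L σ) (h3 : st.phase = 3) (k : ℕ)
    (x : Fin n) (hx : (activeList st.col).getD (k / splitting n st.col) 0 = x) :
    (σ.map fun t => increment n b st t (2 * k)).sum =
      cellCount b st.deg st.cellSeed (st.modulus * splitting n st.col)
        (st.res.getD x 0 + st.modulus * (k % splitting n st.col)) (truncated st.deg (L x)) := by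
  rw [sum_increment hσ]
  have h1 : edgeSum G (fun u v => edgeIncrement n b st u v (2 * k)) = 0 := by
    rw [← edgeSum_zero (G := G)]
    refine edgeSum_congr fun u v _ _ => ?_
    simp [edgeIncrement, h3]
  rw [h1, zero_add, sum_eq_single x]
  · simp [listIncrement, h3, hx, -List.getD_eq_getElem?_getD]
  · intro y _ hy
    have : (x : ℕ) ≠ y := fun h => hy (Fin.val_injective h.symm)
    simp [listIncrement, h3, hx, this, -List.getD_eq_getElem?_getD]
  · simp

theorem sum_increment_phase_three_odd (hσ : IsInputStream G L σ) (h3 : st.phase = 3) (k : ℕ)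
    (x : Fin n) (hx : (activeList st.col).getD (k / splitting n st.col) 0 = x) :
    (σ.map fun t => increment n b st t (2 * k + 1)).sum =
      taken b G st (st.modulus * splitting n st.col)
        (st.res.getD x 0 + st.modulus * (k % splitting n st.col)) x := by
  rw [sum_increment hσ]
  have h0 : (2 * k + 1) % 2 = 1 := by omega
  have h0' : (2 * k + 1) / 2 = k := by omega
  have h1 : ∑ x : Fin n, listIncrement n b st x (truncated st.deg (L x)) (2 * k + 1) = 0 := by
    refine sum_eq_zero fun y _ => ?_
    simp [listIncrement, h3, h0]
  rw [h1, add_zero, taken]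
  refine edgeSum_incident x _ _ fun u v => ?_
  simp only [edgeIncrement, h3, h0, h0', hx, Fin.val_inj]
  rw [if_neg (by norm_num), if_pos trivial, if_pos trivial]
  congr 1
  · split_ifs with h
    · rw [h]
    · rfl
  · split_ifs with h
    · rw [h]
    · rfl

/-- The pass in which the slacks of the refinements are counted. -/
theorem searching_of_counting {t : ℕ} (hs : Setting b G L σ) (h : Counting b G L t st) :
    Searching b G L t 0 (pass b σ st) := by
  set q := splitting n st.col with hq
  set U := (activeList st.col).length with hU
  have hq0 : 0 < q := splitting_pos _ _
  set acc := (List.range (2 * (U * q))).map fun i =>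
    (σ.map fun t => increment n b st t i).sum with hacc
  set sl := (List.range (U * q)).map fun k => acc.getD (2 * k) 0 - acc.getD (2 * k + 1) 0 with hsl
  have hpass : pass b σ st = { st with
      phase := 4, seed := 0, digits := 0, slack := sl, acc := List.replicate b 0 } := by
    rw [pass, readTokens_counters (by rw [h.phase_eq]; norm_num) h.acc_eq]
    simp [endPass, h.phase_eq, startSearch, hsl, hacc, hU, hq]
  have haccget : ∀ i < 2 * (U * q),
      acc.getD i 0 = (σ.map fun t => increment n b st t i).sum := by
    intro i hi
    simp [hacc, List.getD, hi]
  have hslget : ∀ k < U * q, ∀ x : Fin n, (activeList st.col).getD (k / q) 0 = x →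
      sl.getD k 0 =
        slackOf b G L st (st.modulus * q) (st.res.getD x 0 + st.modulus * (k % q)) x := by
    intro k hk x hx
    have : sl.getD k 0 = acc.getD (2 * k) 0 - acc.getD (2 * k + 1) 0 := by
      simp [hsl, List.getD, hk]
    rw [this, haccget _ (by omega), haccget _ (by omega),
      sum_increment_phase_three_even hs.hσ h.phase_eq k x hx,
      sum_increment_phase_three_odd hs.hσ h.phase_eq k x hx, slackOf]
  have hdeg : st.deg ≤ b := h.deg_eq ▸ hs.maxDegree_lt
  have hbd := h.bounded
  have hact : ∀ i < U, ∃ x : Fin n, (activeList st.col).getD i 0 = x := by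
    intro i hi
    have hmem : (activeList st.col).getD i 0 ∈ activeList st.col := by
      rw [List.getD_eq_getElem _ _ hi]
      exact List.getElem_mem hi
    have := (mem_activeList.1 hmem).1
    rw [h.length_col] at this
    exact ⟨⟨_, this⟩, rfl⟩
  have hsl_le : ∀ a ∈ sl, a ≤ b := by
    intro a ha
    obtain ⟨k, hk, rfl⟩ := List.mem_map.1 ha
    have hk' := List.mem_range.1 hk
    obtain ⟨x, hx⟩ := hact (k / q) (Nat.div_lt_of_lt_mul (by rwa [mul_comm]))
    have h1 := hslget k hk' x hx
    have h2 : sl.getD k 0 = acc.getD (2 * k) 0 - acc.getD (2 * k + 1) 0 := by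
      simp [hsl, List.getD, hk']
    rw [← h2, h1]
    exact (slackOf_le _ _ _).trans hdeg
  rw [hpass]
  exact
    { toRefined := h.toRefined.transfer ⟨by norm_num, hbd.2, hbd.3, hbd.4,
        by have := hs.hb; positivity, by norm_num, hbd.7, hbd.8, hbd.9, hbd.10,
        by simpa [hsl] using length_mul_splitting_le h.length_col, hsl_le⟩ rfl rfl rfl rfl rfl
      phase_eq := rfl
      digits_eq := rfl
      acc_eq := rfl
      modulus_lt := h.modulus_lt
      slackAt_eq := by
        intro x hx j hj
        have hmem : (x : ℕ) ∈ activeList st.col := mem_activeList_iff.2 hx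
        have hlt : (activeList st.col).idxOf (x : ℕ) < U := List.idxOf_lt_length_of_mem hmem
        have hj' : j < q := hj
        have hdiv : ((activeList st.col).idxOf (x : ℕ) * q + j) / q =
            (activeList st.col).idxOf (x : ℕ) := by
          rw [mul_comm, Nat.mul_add_div hq0, Nat.div_eq_of_lt hj', add_zero]
        have hmod : ((activeList st.col).idxOf (x : ℕ) * q + j) % q = j := by
          rw [mul_comm, Nat.mul_add_mod, Nat.mod_eq_of_lt hj']
        have h1 := hslget ((activeList st.col).idxOf (x : ℕ) * q + j) (by nlinarith) x (by
          rw [hdiv, List.getD_eq_getElem _ _ hlt]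
          exact List.getElem_idxOf hlt)
        rw [hmod] at h1
        exact h1
      good := goodPrefix_zero _ _ }

theorem Counting.run {t : ℕ} (hs : Setting b G L σ) (h : Counting b G L t st) :
    Run b σ 1 st (pass b σ st) := by
  refine Run.single (fits_counters hs.hσ hs.hb hs.hn hs.hm h.bounded
    (by rw [h.phase_eq]; norm_num) ?_ h.acc_eq) (by rw [h.phase_eq]; norm_num)
  have := length_mul_splitting_le h.length_col
  have := hs.hn
  omega

/-! ### Refining the residues -/

theorem edgeSum_le_mul {F F' : Fin n → Fin n → ℕ} {r : ℝ}
    (h : ∀ u v : Fin n, G.Adj u v → u < v → (F u v : ℝ) ≤ r * F' u v) :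
    (edgeSum G F : ℝ) ≤ r * edgeSum G F' := by
  simp only [edgeSum]
  push_cast
  rw [mul_sum]
  refine sum_le_sum fun u _ => ?_
  rw [mul_sum]
  refine sum_le_sum fun v _ => ?_
  split_ifs with huv
  · exact h u v huv.1 huv.2
  · simp

/-- The slots of an active vertex are at least as many as the slack that it has had so far. -/
theorem Searching.length_slots {t d : ℕ} (hs : Setting b G L σ) (h : Searching b G L t d st)
    {x : Fin n} (hx : st.col.getD x 0 = 1) :
    slackOf b G L st st.modulus (st.res.getD x 0) x ≤
        (slots (splitting n st.col) (activeList st.col) st.slack x).length ∧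
      (slots (splitting n st.col) (activeList st.col) st.slack x).length ≤ b := by
  have e : (slots (splitting n st.col) (activeList st.col) st.slack x).length =
      ∑ j ∈ range (splitting n st.col), slackOf b G L st (st.modulus * splitting n st.col)
        (st.res.getD x 0 + st.modulus * j) x := by
    rw [ListColoring.length_slots]
    exact sum_congr rfl fun j hj => h.slackAt_eq x hx j (mem_range.1 hj)
  rw [e]
  exact ⟨slackOf_le_sum h.modulus_pos (splitting_pos _ _) (h.res_lt x) x,
    (sum_slackOf_le h.modulus_pos (splitting_pos _ _) (h.res_lt x) x).trans
      (h.deg_eq ▸ hs.maxDegree_lt)⟩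

/-- Averaged over the seeds, the potential grows at most by the factor `(1 + 1 / b ^ 2) ^ 4`. -/
theorem Searching.average_refineCost_le {t d : ℕ} (hs : Setting b G L σ)
    (h : Searching b G L t d st) :
    ((∑ s ∈ range (b ^ 13), refineCost b G st s : ℕ) : ℝ) ≤
      b ^ 13 * (1 + 1 / b ^ 2 : ℝ) ^ 4 * potential b G L st := by
  unfold refineCost
  rw [← edgeSum_sum]
  refine edgeSum_le_mul fun u v huv _ => ?_
  by_cases hc : Conflict st u v
  · simp only [if_pos hc]
    obtain ⟨h1, h2⟩ := h.length_slots hs hc.1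
    obtain ⟨h3, h4⟩ := h.length_slots hs hc.2.1
    rw [mul_assoc]
    exact average_edgeCost_le hs.hb (u.2.trans hs.hn) (v.2.trans hs.hn)
      (fun h => huv.ne (Fin.val_injective h)) (h.slack_pos u hc.1) (h.slack_pos v hc.2.1)
      h1 h3 h2 h4
  · simp [hc]

theorem sum_increment_phase_four (hσ : IsInputStream G L σ) (h4 : st.phase = 4) (i : ℕ) :
    (σ.map fun t => increment n b st t i).sum =
      blockSum b st.seed st.digits i (refineCost b G st) := by
  rw [sum_increment hσ]
  have h1 : ∑ x : Fin n, listIncrement n b st x (truncated st.deg (L x)) i = 0 := by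
    refine sum_eq_zero fun y _ => ?_
    simp [listIncrement, h4]
  rw [h1, add_zero]
  unfold blockSum refineCost
  rw [← edgeSum_sum]
  refine edgeSum_congr fun u v _ _ => ?_
  by_cases hc : Conflict st u v <;> simp [edgeIncrement, h4, hc, blockSum]

/-- The memory after the next digit of the seed has been chosen. -/
theorem Searching.nextDigit {t d : ℕ} (hs : Setting b G L σ) (hd : d ≤ 12)
    (h : Searching b G L t d st) :
    Searching b G L t (d + 1) (nextDigit b (readTokens n b st σ)) := by
  have hb0 : 0 < b := by have := hs.hb; omega
  have hread := readTokens_counters (b := b) (by rw [h.phase_eq]; norm_num) h.acc_eq σ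
  simp only [sum_increment_phase_four hs.hσ h.phase_eq, h.digits_eq] at hread
  rw [hread]
  have hgood := h.good.succ hb0 hd
  have hbd := h.bounded
  exact
    { toRefined := h.toRefined.transfer ⟨hbd.1, hbd.2, hbd.3, hbd.4,
        hgood.1.trans_le (Nat.pow_le_pow_right hb0 (by omega)),
        Nat.succ_le_succ hd, hbd.7, hbd.8, hbd.9, hbd.10, hbd.11, hbd.12⟩ rfl rfl rfl rfl rfl
      phase_eq := h.phase_eq
      digits_eq := rfl
      acc_eq := rfl
      modulus_lt := h.modulus_lt
      slackAt_eq := h.slackAt_eq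
      good := hgood }

theorem choice_spec {q s x : ℕ} {act sl : List ℕ} (h : 0 < (slots q act sl x).length) :
    choice b q act sl s x < q ∧ 0 < slackAt q act sl x (choice b q act sl s x) := by
  have hlt := Nat.mod_lt (hash b s x) h
  have hmem : choice b q act sl s x ∈ slots q act sl x := by
    rw [choice, List.getD_eq_getElem _ _ hlt]
    exact List.getElem_mem hlt
  obtain ⟨j, hj, hj'⟩ := List.mem_flatMap.1 hmem
  obtain ⟨h0, h1⟩ := List.mem_replicate.1 hj'
  rw [h1]
  exact ⟨List.mem_range.1 hj, Nat.pos_of_ne_zero h0⟩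

theorem choice_lt {q s x : ℕ} {act sl : List ℕ} (hq : 0 < q) :
    choice b q act sl s x < q := by
  by_cases h : 0 < (slots q act sl x).length
  · exact (choice_spec h).1
  · have : slots q act sl x = [] := List.length_eq_zero_iff.1 (by omega)
    simpa [choice, this] using hq

theorem getD_map_range {k i : ℕ} (f : ℕ → ℕ) (hi : i < k) :
    ((List.range k).map f).getD i 0 = f i := by
  simp [List.getD, hi]

theorem numCells_le (hs : Setting b G L σ) : numCells (G.maxDegree + 1) ≤ 4 * b ^ 3 :=
  Nat.mul_le_mul_left _ (Nat.pow_le_pow_left hs.maxDegree_lt 3)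

/-- The seed that was found is at least as good as the average. -/
theorem Searching.refined {t : ℕ} (hs : Setting b G L σ) (h : Searching b G L t 13 st) :
    Refined b G L (t + 1) (refine n b st) := by
  have hb := hs.hb
  have hq0 : 0 < splitting n st.col := splitting_pos _ _
  have hbd := h.bounded
  have hM : st.modulus * splitting n st.col ≤ b ^ 5 := by
    have h1 : st.modulus ≤ 4 * b ^ 3 := h.modulus_lt.le.trans (h.deg_eq ▸ numCells_le hs)
    have h2 : splitting n st.col ≤ b := (splitting_le _ _).trans hs.hn
    calc _ ≤ 4 * b ^ 3 * b := Nat.mul_le_mul h1 h2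
      _ = 4 * b ^ 4 := by ring
      _ ≤ b * b ^ 4 := Nat.mul_le_mul_right _ (by omega)
      _ = _ := by ring
  have hres : ∀ x < n, (refine n b st).res.getD x 0 = st.res.getD x 0 + st.modulus *
      choice b (splitting n st.col) (activeList st.col) st.slack st.seed x := fun x hx =>
    getD_map_range _ hx
  have hslots : ∀ x : Fin n, st.col.getD x 0 = 1 →
      0 < (slots (splitting n st.col) (activeList st.col) st.slack x).length := fun x hx =>
    (h.slack_pos x hx).trans_le (h.length_slots hs hx).1
  have hslack : ∀ x : Fin n, st.col.getD x 0 = 1 →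
      slackOf b G L (refine n b st) (refine n b st).modulus ((refine n b st).res.getD x 0) x =
        slackAt (splitting n st.col) (activeList st.col) st.slack x
          (choice b (splitting n st.col) (activeList st.col) st.slack st.seed x) := by
    intro x hx
    rw [h.slackAt_eq x hx _ (choice_lt hq0), hres x x.2]
    rfl
  have hlt : ∀ x, st.res.getD x 0 < st.modulus → st.res.getD x 0 + st.modulus *
      choice b (splitting n st.col) (activeList st.col) st.slack st.seed x <
        st.modulus * splitting n st.col := by
    intro x hx
    have h1 : choice b (splitting n st.col) (activeList st.col) st.slack st.seed x + 1 ≤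
      splitting n st.col := choice_lt hq0
    nlinarith [Nat.mul_le_mul_left st.modulus h1]
  have hpot : potential b G L (refine n b st) ≤ refineCost b G st st.seed := by
    refine edgeSum_mono fun u v _ _ => ?_
    by_cases hc' : Conflict (refine n b st) u v
    · obtain ⟨h1, h2, h3⟩ := hc'
      have h1' : st.col.getD u 0 = 1 := h1
      have h2' : st.col.getD v 0 = 1 := h2
      rw [hres u u.2, hres v v.2] at h3
      have h4 := congrArg (· % st.modulus) h3
      simp only [Nat.add_mul_mod_self_left, Nat.mod_eq_of_lt (h.res_lt _)] at h4
      have h5 : choice b (splitting n st.col) (activeList st.col) st.slack st.seed u =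
          choice b (splitting n st.col) (activeList st.col) st.slack st.seed v := by
        rw [h4] at h3
        exact Nat.eq_of_mul_eq_mul_left h.modulus_pos (Nat.add_left_cancel h3)
      have hc : Conflict st u v := ⟨h1, h2, h4⟩
      rw [if_pos hc, if_pos ⟨h1, h2, by rw [hres u u.2, hres v v.2, h3]⟩, edgeCost, if_pos h5,
        hslack u h1', hslack v h2']
    · rw [if_neg hc']
      exact Nat.zero_le _
  exact
    { bounded := ⟨hbd.1, hbd.2, hbd.3, hM, hbd.5, hbd.6, hbd.7, hbd.8,
        by simp [refine], by
          intro a ha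
          obtain ⟨x, hx, rfl⟩ := List.mem_map.1 ha
          exact (hlt x (h.res_lt ⟨x, List.mem_range.1 hx⟩)).le.trans hM, hbd.11, hbd.12⟩
      deg_eq := h.deg_eq
      length_col := h.length_col
      mem := h.mem
      proper := h.proper
      inj := h.inj
      aside := h.aside
      modulus_eq := by
        change st.modulus * splitting n st.col = splitting n st.col ^ (t + 1)
        rw [h.modulus_eq, pow_succ]
      length_res := by simp [refine]
      res_lt := fun x => by
        rw [hres x x.2]
        exact hlt x (h.res_lt x)
      slack_pos := fun x hx => by
        rw [hslack x hx]
        exact (choice_spec (hslots x hx)).2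
      potential_le := by
        have hbR : (0 : ℝ) < b ^ 13 := by
          have : (100 : ℝ) ≤ b := by exact_mod_cast hb
          positivity
        have h1 : (refineCost b G st st.seed : ℝ) * b ^ 13 ≤
            b ^ 13 * (1 + 1 / b ^ 2 : ℝ) ^ 4 * potential b G L st := by
          refine le_trans ?_ (h.average_refineCost_le hs)
          exact_mod_cast h.good.cost_le
        have h2 : (refineCost b G st st.seed : ℝ) ≤
            (1 + 1 / b ^ 2 : ℝ) ^ 4 * potential b G L st := by
          rw [mul_comm, mul_assoc] at h1
          exact le_of_mul_le_mul_left h1 hbR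
        have h3 : (potential b G L (refine n b st) : ℝ) ≤ refineCost b G st st.seed := by
          exact_mod_cast hpot
        refine h3.trans (h2.trans ?_)
        calc _ ≤ (1 + 1 / b ^ 2 : ℝ) ^ 4 * ((1 + 1 / b ^ 2 : ℝ) ^ (4 * t + 1) *
              ((activeList st.col).length * b ^ 3)) :=
              mul_le_mul_of_nonneg_left h.potential_le (by positivity)
          _ = (1 + 1 / b ^ 2 : ℝ) ^ (4 * (t + 1) + 1) *
              ((activeList st.col).length * b ^ 3) := by ring }

/-- The state before the new colors are determined. -/
structure Committing (b : ℕ) (G : SimpleGraph (Fin n)) [DecidableRel G.Adj]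
    (L : Fin n → Finset (Fin m)) (t : ℕ) (st : Memory) : Prop extends Refined b G L t st where
  phase_eq : st.phase = 5
  acc_eq : st.acc = List.replicate (2 * n) 0
  le_modulus : numCells st.deg ≤ st.modulus
  pow_lt : splitting n st.col ^ (t - 1) < numCells st.deg

theorem Searching.single {t d : ℕ} (hs : Setting b G L σ) (h : Searching b G L t d st) :
    Run b σ 1 st (pass b σ st) := by
  have := hs.hb
  exact Run.single (fits_counters hs.hσ hs.hb hs.hn hs.hm h.bounded
    (by rw [h.phase_eq]; norm_num) (by omega) h.acc_eq) (by rw [h.phase_eq]; norm_num)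

theorem readTokens_phase_digits {k : ℕ} (h6 : st.phase ≠ 6) (hacc : st.acc = List.replicate k 0) :
    (readTokens n b st σ).phase = st.phase ∧ (readTokens n b st σ).digits = st.digits ∧
      (readTokens n b st σ).col = st.col := by
  rw [readTokens_counters h6 hacc]
  exact ⟨rfl, rfl, rfl⟩

theorem Searching.run {t d : ℕ} (hs : Setting b G L σ) (hd : d ≤ 12)
    (h : Searching b G L t 0 st) :
    ∃ st', Run b σ d st st' ∧ Searching b G L t d st' ∧ st'.col = st.col := by
  induction d with
  | zero => exact ⟨st, Run.refl _ _ _, h, rfl⟩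
  | succ d ih =>
    obtain ⟨st', h1, h2, h3⟩ := ih (by omega)
    obtain ⟨e1, e2, e3⟩ := readTokens_phase_digits (n := n) (b := b) (σ := σ)
      (by rw [h2.phase_eq]; norm_num) h2.acc_eq
    have hpass : pass b σ st' = ListColoring.nextDigit b (readTokens n b st' σ) := by
      have : ¬ d = 12 := by omega
      simp [pass, endPass, e1, e2, h2.phase_eq, h2.digits_eq, this]
    refine ⟨_, h1.trans (h2.single hs), ?_, ?_⟩
    · rw [hpass]
      exact h2.nextDigit hs (by omega)
    · rw [hpass]
      exact e3.trans h3

/-- The passes of one refinement of the residues. -/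
theorem Counting.run_refine {t : ℕ} (hs : Setting b G L σ) (h : Counting b G L t st) :
    ∃ st', Run b σ 14 st st' ∧ st'.col = st.col ∧
      (Counting b G L (t + 1) st' ∨ Committing b G L (t + 1) st') := by
  have h0 := searching_of_counting hs h
  obtain ⟨st', h1, h2, h3⟩ := h0.run hs le_rfl
  have hcol : (pass b σ st).col = st.col := by
    rw [pass, readTokens_counters (by rw [h.phase_eq]; norm_num) h.acc_eq]
    simp [endPass, h.phase_eq, startSearch]
  obtain ⟨e1, e2, e3⟩ := readTokens_phase_digits (n := n) (b := b) (σ := σ)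
    (by rw [h2.phase_eq]; norm_num) h2.acc_eq
  have h4 := h2.nextDigit hs le_rfl
  have h5 := h4.refined hs
  set st₁ := ListColoring.nextDigit b (readTokens n b st' σ) with hst₁
  have hdeg : st₁.deg = (readTokens n b st' σ).deg := rfl
  have hpass : pass b σ st' = if numCells st₁.deg ≤ (refine n b st₁).modulus then
        { refine n b st₁ with phase := 5, acc := List.replicate (2 * n) 0 }
      else startStage n (refine n b st₁) := by
    rw [pass, endPass]
    simp only [e1, e2, h2.phase_eq, h2.digits_eq]
    rfl
  have hcol' : (refine n b st₁).col = st.col := e3.trans (h3.trans hcol)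
  have hbd := h5.bounded
  refine ⟨pass b σ st', ((h.run hs).trans h1).trans (h2.single hs), ?_, ?_⟩
  · rw [hpass]
    split_ifs
    · exact hcol'
    · exact hcol'
  · rw [hpass]
    split_ifs with hM
    · refine Or.inr ⟨h5.transfer ?_ rfl rfl rfl rfl rfl, rfl, rfl, hM, ?_⟩
      swap
      · rw [Nat.add_sub_cancel]
        exact h4.modulus_eq ▸ h4.modulus_lt
      exact ⟨by norm_num, hbd.2, hbd.3, hbd.4, hbd.5, hbd.6, hbd.7, hbd.8, hbd.9, hbd.10, hbd.11,
        hbd.12⟩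
    · refine Or.inl ⟨h5.transfer ?_ rfl rfl rfl rfl rfl, rfl, rfl, not_le.1 hM⟩
      exact ⟨by norm_num [startStage], hbd.2, hbd.3, hbd.4, hbd.5, hbd.6, hbd.7, hbd.8, hbd.9,
        hbd.10, hbd.11, hbd.12⟩

/-! ### Beginning an epoch -/

/-- The state before the last pass: the active vertices are so few that their edges and lists can be
stored. -/
structure Finishing (b : ℕ) (G : SimpleGraph (Fin n)) [DecidableRel G.Adj]
    (L : Fin n → Finset (Fin m)) (st : Memory) : Prop extends Colored b G L st where
  phase_eq : st.phase = 6
  acc_eq : st.acc = []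
  active_le : (activeList st.col).length * st.deg ≤ n

/-- The state at the beginning of an epoch. -/
structure Starting (b : ℕ) (G : SimpleGraph (Fin n)) [DecidableRel G.Adj]
    (L : Fin n → Finset (Fin m)) (st : Memory) : Prop extends Counting b G L 0 st where
  lt_active : n < (activeList st.col).length * st.deg

/-- At the beginning of an epoch, the slack exceeds the number of active neighbors. -/
theorem slackOf_one (h : Colored b G L st) (hs : Setting b G L σ) (x : Fin n) :
    #((G.neighborFinset x).filter fun y : Fin n => st.col.getD (y : ℕ) 0 = 1) + 1 ≤
      slackOf b G L st 1 0 x := by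
  have h1 : cellCount b st.deg st.cellSeed 1 0 (truncated st.deg (L x)) =
      (truncated st.deg (L x)).length := by
    simp [cellCount, Nat.mod_one]
  have h2 : taken b G st 1 0 x =
      #((G.neighborFinset x).filter fun y : Fin n => 2 ≤ st.col.getD (y : ℕ) 0) := by
    rw [card_filter, taken]
    refine sum_congr rfl fun y _ => ?_
    simp only [hits, Nat.mod_one, and_true]
  have h3 := degree_lt_length_truncated hs x
  rw [← h.deg_eq] at h3
  have h4 : #((G.neighborFinset x).filter fun y : Fin n => st.col.getD (y : ℕ) 0 = 1) +
      #((G.neighborFinset x).filter fun y : Fin n => 2 ≤ st.col.getD (y : ℕ) 0) ≤ G.degree x := by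
    rw [← card_union_of_disjoint, ← SimpleGraph.card_neighborFinset_eq_degree]
    · exact card_le_card (union_subset (filter_subset _ _) (filter_subset _ _))
    · rw [disjoint_filter]
      intro y _ hy
      omega
  rw [slackOf, h1, h2]
  omega

/-- At the beginning of an epoch an active vertex has slack larger than its number of active
neighbors, and hence contributes little more than one to the potential, in units of `b ^ 3`. -/
theorem potential_le_of_start (h : Colored b G L st) (hs : Setting b G L σ)
    (hmod : st.modulus = 1) (hres : ∀ x : Fin n, st.res.getD x 0 = 0) :
    potential b G L st ≤ (activeList st.col).length * (b ^ 3 + b) := by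
  have h1 : potential b G L st = ∑ u : Fin n, ∑ v : Fin n, if G.Adj u v then
      (if st.col.getD u 0 = 1 ∧ st.col.getD v 0 = 1 then
        weight b (slackOf b G L st 1 0 u) else 0) else 0 := by
    refine edgeSum_add _ _ fun u v => ?_
    simp only [Conflict, hres, hmod, and_true]
    by_cases hu : st.col.getD u 0 = 1 <;> by_cases hv : st.col.getD v 0 = 1 <;>
      simp only [hu, hv, and_true, and_false, if_true, if_false, add_zero]
  rw [h1, length_activeList h.length_col, card_filter, sum_mul]
  refine sum_le_sum fun u _ => ?_
  by_cases hu : st.col.getD u 0 = 1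
  · have h2 : (∑ v : Fin n, if G.Adj u v then (if st.col.getD u 0 = 1 ∧ st.col.getD v 0 = 1 then
        weight b (slackOf b G L st 1 0 u) else 0) else 0) =
        #((G.neighborFinset u).filter fun y : Fin n => st.col.getD (y : ℕ) 0 = 1) *
          weight b (slackOf b G L st 1 0 u) := by
      rw [← sum_filter, ← SimpleGraph.neighborFinset_eq_filter, card_filter, sum_mul]
      refine sum_congr rfl fun y _ => ?_
      by_cases hy : st.col.getD y 0 = 1 <;>
        simp only [hu, hy, and_true, and_false, if_true, if_false, one_mul, zero_mul]
    rw [h2, if_pos hu, one_mul]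
    have h3 := slackOf_one h hs u
    refine (Nat.mul_le_mul_right _ (Nat.le_of_succ_le h3)).trans ((mul_weight_le _ _).trans ?_)
    exact Nat.add_le_add_left ((slackOf_le _ _ _).trans (h.deg_eq ▸ hs.maxDegree_lt)) _
  · simp only [hu, false_and, if_false]
    simp

theorem getD_replicate_zero (k i : ℕ) : (List.replicate k 0).getD i 0 = 0 := by
  by_cases h : i < k <;> simp [List.getD, h]

theorem startEpoch_spec (hs : Setting b G L σ) (h : Colored b G L st) :
    (startEpoch n st).col = st.col ∧
      (Finishing b G L (startEpoch n st) ∨ Starting b G L (startEpoch n st)) := by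
  have hb := hs.hb
  have hbd := h.bounded
  rw [startEpoch]
  split_ifs with hU
  · refine ⟨rfl, Or.inl ⟨h.transfer ?_ rfl rfl rfl, rfl, rfl, hU⟩⟩
    exact ⟨by norm_num, hbd.2, hbd.3, hbd.4, hbd.5, hbd.6, hbd.7, hbd.8, hbd.9, hbd.10, hbd.11,
      hbd.12⟩
  · refine ⟨rfl, Or.inr ⟨?_, not_le.1 hU⟩⟩
    have hc : Colored b G L (startStage n { st with modulus := 1, res := List.replicate n 0 }) := by
      refine h.transfer ?_ rfl rfl rfl
      exact ⟨by norm_num [startStage], hbd.2, hbd.3, Nat.one_le_pow _ _ (by omega), hbd.5, hbd.6,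
        hbd.7, hbd.8, by simp [startStage], by
          intro a ha
          rw [List.eq_of_mem_replicate ha]
          exact Nat.zero_le _, hbd.11, hbd.12⟩
    have hres : ∀ x : ℕ, (startStage n
        { st with modulus := 1, res := List.replicate n 0 }).res.getD x 0 = 0 := fun x =>
      getD_replicate_zero n x
    exact
      { toColored := hc
        modulus_eq := rfl
        length_res := by simp [startStage]
        res_lt := fun x => by
          rw [hres]
          exact Nat.one_pos
        slack_pos := fun x _ => by
          rw [hres]
          exact (Nat.succ_pos _).trans_le (slackOf_one hc hs x)
        potential_le := by
          have h1 := potential_le_of_start hc hs rfl fun x => hres x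
          have hb0 : (b : ℝ) ≠ 0 := by
            have : (0 : ℝ) < b := by exact_mod_cast (by omega : 0 < b)
            exact this.ne'
          have h2 : ((activeList st.col).length : ℝ) * (b ^ 3 + b) =
              (1 + 1 / b ^ 2 : ℝ) ^ (4 * 0 + 1) * ((activeList st.col).length * b ^ 3) := by
            rw [mul_zero, zero_add, pow_one]
            field_simp
          change _ ≤ (1 + 1 / b ^ 2 : ℝ) ^ (4 * 0 + 1) * ((activeList st.col).length * b ^ 3)
          rw [← h2]
          exact_mod_cast h1
        phase_eq := rfl
        acc_eq := rfl
        modulus_lt := by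
          change 1 < 4 * st.deg ^ 3
          have : 1 ≤ st.deg ^ 3 := Nat.one_le_pow _ _ (by rw [h.deg_eq]; omega)
          omega }

/-! ### New colors -/

theorem sum_map_eq_single {l : List ℕ} (hl : l.Nodup) {a : ℕ} (ha : a ∈ l) (f : ℕ → ℕ)
    (h : ∀ k ∈ l, k ≠ a → f k = 0) : (l.map f).sum = f a := by
  rw [← List.sum_toFinset f hl]
  refine sum_eq_single a (fun k hk hka => h k (List.mem_toFinset.1 hk) hka) fun ha' => ?_
  exact absurd (List.mem_toFinset.2 ha) ha'

theorem cell_lt {D gs k : ℕ} (hD : 0 < D) : cell b D gs k < numCells D :=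
  Nat.mod_lt _ (by unfold numCells; positivity)

/-- When the residues determine the cells, an active vertex has a unique color in its list in the
cell of its residue, and no neighbor has a color in this cell. -/
theorem Committing.exists_color {t : ℕ} (h : Committing b G L t st) {x : Fin n}
    (hx : st.col.getD x 0 = 1) :
    ∃ k ∈ truncated st.deg (L x), cell b st.deg st.cellSeed k = st.res.getD x 0 ∧
      ((truncated st.deg (L x)).map fun k' =>
        if cell b st.deg st.cellSeed k' = st.res.getD x 0 then k' + 2 else 0).sum = k + 2 ∧
      slackOf b G L st st.modulus (st.res.getD x 0) x = 1 ∧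
      ∀ y, G.Adj x y → 2 ≤ st.col.getD y 0 →
        cell b st.deg st.cellSeed (st.col.getD y 0 - 2) ≠ st.res.getD x 0 := by
  have hD : 0 < st.deg := by rw [h.deg_eq]; omega
  have hmod : ∀ k, cell b st.deg st.cellSeed k % st.modulus = cell b st.deg st.cellSeed k :=
    fun k => Nat.mod_eq_of_lt ((cell_lt hD).trans_le h.le_modulus)
  have hpos := h.slack_pos x hx
  have hcc : 0 < cellCount b st.deg st.cellSeed st.modulus (st.res.getD x 0)
      (truncated st.deg (L x)) := hpos.trans_le (Nat.sub_le _ _)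
  simp only [cellCount, hmod] at hcc
  obtain ⟨k, hk, hk'⟩ : ∃ k ∈ truncated st.deg (L x),
      cell b st.deg st.cellSeed k = st.res.getD x 0 := by
    by_contra hne
    push Not at hne
    refine hcc.ne' (List.sum_eq_zero fun a ha => ?_)
    obtain ⟨k, hk, rfl⟩ := List.mem_map.1 ha
    exact if_neg (hne k hk)
  have huniq : ∀ k' ∈ truncated st.deg (L x), k' ≠ k →
      cell b st.deg st.cellSeed k' ≠ st.res.getD x 0 := fun k' hk'' hne heq =>
    hne (h.inj x hx k' hk'' k hk (heq.trans hk'.symm))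
  have hone : cellCount b st.deg st.cellSeed st.modulus (st.res.getD x 0)
      (truncated st.deg (L x)) = 1 := by
    simp only [cellCount, hmod]
    rw [sum_map_eq_single (nodup_truncated _ _) hk _ fun k' h1 h2 => if_neg (huniq k' h1 h2)]
    exact if_pos hk'
  have htaken : taken b G st st.modulus (st.res.getD x 0) x = 0 := by
    rw [slackOf, hone] at hpos
    omega
  refine ⟨k, hk, hk', ?_, ?_, fun y hxy hy heq => ?_⟩
  · rw [sum_map_eq_single (nodup_truncated _ _) hk _ fun k' h1 h2 => if_neg (huniq k' h1 h2)]
    exact if_pos hk'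
  · rw [slackOf, hone, htaken]
  · have h1 := (sum_eq_zero_iff.1 htaken) y (by simpa using hxy)
    rw [hits, if_pos ⟨hy, by rw [hmod]; exact heq⟩] at h1
    exact one_ne_zero h1

/-- The first `n` counters of phase `5` count the smaller neighbors with the same residue. -/
theorem sum_increment_phase_five_lt (hσ : IsInputStream G L σ) (h5 : st.phase = 5) (x : Fin n) :
    (σ.map fun t => increment n b st t x).sum =
      edgeSum G fun u v => if Conflict st u v ∧ x = v then 1 else 0 := by
  rw [sum_increment hσ]
  have h1 : ∑ y : Fin n, listIncrement n b st y (truncated st.deg (L y)) x = 0 := by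
    refine sum_eq_zero fun y _ => ?_
    have : ¬ (x : ℕ) = n + y := by omega
    simp [listIncrement, h5, this]
  rw [h1, add_zero]
  refine edgeSum_congr fun u v _ _ => ?_
  simp [edgeIncrement, h5, Fin.val_inj]

/-- The last `n` counters of phase `5` add up the colors in the cell of the residue, of which there
is only one by `Committing.exists_color`. -/
theorem sum_increment_phase_five_ge (hσ : IsInputStream G L σ) (h5 : st.phase = 5) (x : Fin n)
    (hx : st.col.getD x 0 = 1) :
    (σ.map fun t => increment n b st t (n + x)).sum = ((truncated st.deg (L x)).map fun k =>
      if cell b st.deg st.cellSeed k = st.res.getD x 0 then k + 2 else 0).sum := by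
  rw [sum_increment hσ]
  have h1 : edgeSum G (fun u v => edgeIncrement n b st u v (n + x)) = 0 := by
    rw [← edgeSum_zero (G := G)]
    refine edgeSum_congr fun u v _ _ => ?_
    have : ¬ n + (x : ℕ) = v := by omega
    simp [edgeIncrement, h5, this]
  rw [h1, zero_add, sum_eq_single x]
  · simp [listIncrement, h5, hx, -List.getD_eq_getElem?_getD]
  · intro y _ hy
    have : (x : ℕ) ≠ y := fun h => hy (Fin.val_injective h.symm)
    simp [listIncrement, h5, this]
  · simp

/-- The number of stages is so small that the rounding errors of all of them together are
harmless. -/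
theorem Committing.le_of_pow_lt {t : ℕ} (hs : Setting b G L σ) (h : Committing b G L t st)
    (hq : 2 ≤ splitting n st.col) : 3 * (4 * t + 1) ≤ b ^ 2 := by
  have hb := hs.hb
  have h1 : 2 ^ (t - 1) < 2 ^ (4 * b) := by
    calc 2 ^ (t - 1) ≤ splitting n st.col ^ (t - 1) := Nat.pow_le_pow_left hq _
      _ < numCells st.deg := h.pow_lt
      _ ≤ 4 * b ^ 3 := h.deg_eq ▸ numCells_le hs
      _ ≤ b ^ 4 := by
          rw [pow_succ b 3, mul_comm]
          exact Nat.mul_le_mul_left _ (by omega)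
      _ ≤ (2 ^ b) ^ 4 := Nat.pow_le_pow_left Nat.lt_two_pow_self.le 4
      _ = 2 ^ (4 * b) := by rw [← pow_mul, mul_comm]
  have h2 := (Nat.pow_lt_pow_iff_right (by norm_num)).1 h1
  have h3 : t ≤ 4 * b := by omega
  nlinarith

theorem one_add_pow_le {e : ℝ} (he : 0 ≤ e) {k : ℕ} (h : 3 * (k * e) ≤ 1) :
    (1 + e) ^ k ≤ 3 / 2 := by
  have h1 : (1 + e) ^ k ≤ Real.exp (k * e) := by
    rw [Real.exp_nat_mul]
    exact pow_le_pow_left₀ (by linarith) (by linarith [Real.add_one_le_exp e]) k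
  have h2 : Real.exp (k * e) ≤ 1 / (1 - k * e) := by
    have h3 : 1 - k * e ≤ Real.exp (-(k * e)) := by linarith [Real.add_one_le_exp (-(k * e))]
    rw [le_div_iff₀ (by linarith)]
    refine (mul_le_mul_of_nonneg_left h3 (Real.exp_pos _).le).trans ?_
    rw [← Real.exp_add, add_neg_cancel, Real.exp_zero]
  refine h1.trans (h2.trans ?_)
  rw [div_le_iff₀ (by linarith)]
  linarith

theorem edgeSum_mul (k : ℕ) (F : Fin n → Fin n → ℕ) :
    edgeSum G (fun u v => k * F u v) = k * edgeSum G F := by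
  simp only [edgeSum, mul_sum]
  refine sum_congr rfl fun u _ => sum_congr rfl fun v _ => ?_
  split_ifs <;> simp

/-- The number of edges between active vertices with the same residue is at most three quarters of
the number of active vertices. -/
theorem Committing.conflicts_le {t : ℕ} (hs : Setting b G L σ) (h : Committing b G L t st)
    (hq : 2 ≤ splitting n st.col) :
    4 * edgeSum G (fun u v => if Conflict st u v then 1 else 0) ≤
      3 * (activeList st.col).length := by
  have h1 : 2 * b ^ 3 * edgeSum G (fun u v => if Conflict st u v then 1 else 0) ≤
      potential b G L st := by
    rw [← edgeSum_mul]
    refine edgeSum_mono fun u v _ _ => ?_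
    by_cases hc : Conflict st u v
    · rw [if_pos hc, if_pos hc]
      obtain ⟨-, -, -, -, e1, -⟩ := h.exists_color hc.1
      obtain ⟨-, -, -, -, e2, -⟩ := h.exists_color hc.2.1
      rw [e1, e2, weight, Nat.div_one]
      omega
    · simp [hc]
  have hb0 : (0 : ℝ) < b := by
    have := hs.hb
    exact_mod_cast (by omega : 0 < b)
  have h2 : (1 + 1 / b ^ 2 : ℝ) ^ (4 * t + 1) ≤ 3 / 2 := by
    refine one_add_pow_le (by positivity) ?_
    rw [mul_one_div, ← mul_div_assoc, div_le_one (by positivity)]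
    exact_mod_cast h.le_of_pow_lt hs hq
  set C := edgeSum G (fun u v => if Conflict st u v then 1 else 0)
  set U := (activeList st.col).length
  have h3 : (2 * b ^ 3 * C : ℝ) ≤ 3 / 2 * (U * b ^ 3) := by
    refine le_trans (by exact_mod_cast h1) (h.potential_le.trans ?_)
    gcongr
  have h4 : (4 * C : ℝ) ≤ 3 * U := by
    have hb3 : (0 : ℝ) < b ^ 3 := by positivity
    have : (4 * C : ℝ) * b ^ 3 ≤ 3 * U * b ^ 3 := by linarith
    exact le_of_mul_le_mul_right this hb3
  exact_mod_cast h4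

theorem edgeSum_pos {F : Fin n → Fin n → ℕ} {u v : Fin n} (huv : G.Adj u v) (hlt : u < v)
    (h : 0 < F u v) : 0 < edgeSum G F := by
  have h1 : F u v ≤ ∑ v' : Fin n, if G.Adj u v' ∧ u < v' then F u v' else 0 := by
    have := single_le_sum (f := fun v' => if G.Adj u v' ∧ u < v' then F u v' else 0)
      (fun _ _ => Nat.zero_le _) (mem_univ v)
    simpa only [huv, hlt, and_self, if_true] using this
  have h2 := single_le_sum
    (f := fun u => ∑ v' : Fin n, if G.Adj u v' ∧ u < v' then F u v' else 0)
    (fun _ _ => Nat.zero_le _) (mem_univ u)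
  exact (h.trans_le h1).trans_le h2

/-- Each vertex that stays active is the larger end of an edge whose ends have the same residue, and
different such vertices come from different edges. The colors are proper: a new one is not that of
a neighbor colored before by `Committing.exists_color`, and neighbors with the same new color
would have equal residues. -/
theorem Committing.commit {t : ℕ} (hs : Setting b G L σ) (h : Committing b G L t st)
    (hq : 2 ≤ splitting n st.col) :
    Colored b G L (commit n (readTokens n b st σ)) ∧
      4 * (activeList (commit n (readTokens n b st σ)).col).length ≤
        3 * (activeList st.col).length := by
  set acc := (List.range (2 * n)).map fun i =>
    (σ.map fun t => increment n b st t i).sum with hacc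
  set st' := ListColoring.commit n { st with acc := acc } with hst'
  have hread : ListColoring.commit n (readTokens n b st σ) = st' := by
    rw [readTokens_counters (by rw [h.phase_eq]; norm_num) h.acc_eq]
  rw [hread]
  set kill : Fin n → ℕ := fun x => edgeSum G fun u v =>
    if Conflict st u v ∧ x = v then 1 else 0 with hkill
  have hcol : ∀ x : Fin n, st'.col.getD x 0 =
      if st.col.getD x 0 = 1 ∧ kill x = 0 then acc.getD (n + x) 0 else st.col.getD x 0 := by
    intro x
    have h1 : st'.col.getD x 0 = if st.col.getD x 0 = 1 ∧ acc.getD x 0 = 0 then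
        acc.getD (n + x) 0 else st.col.getD x 0 := getD_map_range _ x.2
    have h2 : acc.getD x 0 = kill x := by
      rw [hacc, getD_map_range _ (by omega), sum_increment_phase_five_lt hs.hσ h.phase_eq]
    rw [h1, h2]
  have hnew : ∀ x : Fin n, st.col.getD x 0 = 1 → acc.getD (n + x) 0 =
      ((truncated st.deg (L x)).map fun k =>
        if cell b st.deg st.cellSeed k = st.res.getD x 0 then k + 2 else 0).sum := by
    intro x hx
    rw [hacc, getD_map_range _ (by omega), sum_increment_phase_five_ge hs.hσ h.phase_eq x hx]
  -- a vertex keeps its state, or it is active and gets a color in the cell of its residue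
  have hcases : ∀ x : Fin n, st'.col.getD x 0 = st.col.getD x 0 ∧
        ¬ (st.col.getD x 0 = 1 ∧ kill x = 0) ∨
      st.col.getD x 0 = 1 ∧ kill x = 0 ∧ ∃ k ∈ truncated st.deg (L x),
        st'.col.getD x 0 = k + 2 ∧ cell b st.deg st.cellSeed k = st.res.getD x 0 ∧
        ∀ y, G.Adj x y → 2 ≤ st.col.getD y 0 →
          cell b st.deg st.cellSeed (st.col.getD y 0 - 2) ≠ st.res.getD x 0 := by
    intro x
    by_cases hx : st.col.getD x 0 = 1 ∧ kill x = 0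
    · obtain ⟨k, hk, h1, h2, -, h3⟩ := h.exists_color hx.1
      refine Or.inr ⟨hx.1, hx.2, k, hk, ?_, h1, h3⟩
      rw [hcol, if_pos hx, hnew x hx.1, h2]
    · refine Or.inl ⟨?_, hx⟩
      rw [hcol, if_neg hx]
  have hbd := h.bounded
  have hdeg : st'.deg = st.deg := rfl
  have hseed : st'.cellSeed = st.cellSeed := rfl
  have hcolb : ∀ x : Fin n, st'.col.getD x 0 ≤ b ^ 4 := by
    intro x
    have hb := hs.hb
    rcases hcases x with ⟨h1, -⟩ | ⟨-, -, k, hk, h1, -⟩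
    · rw [h1, List.getD_eq_getElem _ _ (by rw [h.length_col]; exact x.2)]
      exact hbd.col _ (List.getElem_mem _)
    · rw [h1]
      have h2 := (lt_of_mem_truncated hk).trans_le hs.hm
      have h3 : 2 ≤ b ^ 3 := Nat.le_trans (by omega) (Nat.le_self_pow (by norm_num : 3 ≠ 0) b)
      calc k + 2 ≤ 2 * b ^ 3 := by omega
        _ ≤ b * b ^ 3 := Nat.mul_le_mul_right _ (by omega)
        _ = b ^ 4 := by ring
  refine ⟨⟨⟨hbd.1, hbd.2, hbd.3, hbd.4, hbd.5, hbd.6, by simp [hst', ListColoring.commit], ?_,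
    hbd.9, hbd.10, hbd.11, hbd.12⟩, h.deg_eq, by simp [hst', ListColoring.commit],
    ?_, ?_, ?_, ?_⟩, ?_⟩
  · intro a ha
    obtain ⟨x, hx, hxa⟩ := List.mem_map.1 ha
    have hx' := List.mem_range.1 hx
    have h1 := hcolb ⟨x, hx'⟩
    rw [show st'.col.getD x 0 = a from (getD_map_range _ hx').trans hxa] at h1
    exact h1
  · intro x k hk
    rcases hcases x with ⟨h1, -⟩ | ⟨-, -, k', hk', h1, -⟩
    · rw [h1] at hk
      exact h.mem x k hk
    · rw [h1] at hk
      obtain rfl : k' = k := by omega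
      exact hk'
  · intro x y hxy hx heq
    rcases hcases x with ⟨h1, -⟩ | ⟨hx1, hkx, k, hk, h1, hcx, hnx⟩ <;>
      rcases hcases y with ⟨h2, -⟩ | ⟨hy1, hky, k', hk', h2, hcy, hny⟩
    · rw [h1] at hx heq
      rw [h2] at heq
      exact h.proper x y hxy hx heq
    · rw [h1] at hx heq
      refine hny x hxy.symm hx ?_
      rw [heq, h2, Nat.add_sub_cancel, hcy]
    · rw [h2] at heq
      refine hnx y hxy (by rw [← heq]; exact hx) ?_
      rw [← heq, h1, Nat.add_sub_cancel, hcx]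
    · rw [h1, h2] at heq
      obtain rfl : k = k' := by omega
      have hres : st.res.getD x 0 = st.res.getD y 0 := hcx.symm.trans hcy
      rcases lt_or_gt_of_ne hxy.ne with hlt | hlt
      · have := edgeSum_pos (F := fun u v : Fin n => if Conflict st u v ∧ y = v then 1 else 0)
          hxy hlt (by rw [if_pos ⟨⟨hx1, hy1, hres⟩, rfl⟩]; exact Nat.one_pos)
        exact this.ne' hky
      · have := edgeSum_pos (F := fun u v : Fin n => if Conflict st u v ∧ x = v then 1 else 0)
          hxy.symm hlt (by rw [if_pos ⟨⟨hy1, hx1, hres.symm⟩, rfl⟩]; exact Nat.one_pos)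
        exact this.ne' hkx
  · intro x hx
    rcases hcases x with ⟨h1, -⟩ | ⟨hx1, -⟩
    · exact h.inj x (h1.symm.trans hx)
    · exact h.inj x hx1
  · refine le_trans (Nat.mul_le_mul_right _ (card_le_card fun x hx => ?_)) h.aside
    simp only [mem_filter, mem_univ, true_and] at hx ⊢
    rcases hcases x with ⟨h1, -⟩ | ⟨-, -, k, -, h1, -⟩
    · exact h1.symm.trans hx
    · omega
  · refine le_trans (Nat.mul_le_mul_left 4 ?_) (h.conflicts_le hs hq)
    rw [length_activeList (n := n) (by simp [hst', ListColoring.commit]), card_filter]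
    have h1 : ∑ x : Fin n, kill x = edgeSum G fun u v => if Conflict st u v then 1 else 0 := by
      simp only [hkill, edgeSum]
      rw [sum_comm]
      refine sum_congr rfl fun u _ => ?_
      rw [sum_comm]
      refine sum_congr rfl fun v _ => ?_
      by_cases hc : Conflict st u v <;> simp [hc]
    rw [← h1]
    refine sum_le_sum fun x _ => ?_
    split_ifs with hx
    · rcases hcases x with ⟨h2, h3⟩ | ⟨-, -, k, -, h2, -⟩
      · have : kill x ≠ 0 := fun h0 => h3 ⟨h2.symm.trans hx, h0⟩
        omega
      · omega
    · exact Nat.zero_le _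

/-! ### Epochs -/

/-- The stages of an epoch end, because the modulus grows at each of them. -/
theorem Counting.run_stages {t : ℕ} (hs : Setting b G L σ) (h : Counting b G L t st)
    (hq : 2 ≤ splitting n st.col) :
    ∃ t' st', t < t' ∧ Run b σ (14 * (t' - t)) st st' ∧ st'.col = st.col ∧
      Committing b G L t' st' := by
  have ht : t < numCells (G.maxDegree + 1) := by
    rw [← h.deg_eq]
    refine (Nat.lt_pow_self hq).trans ?_
    rw [← h.modulus_eq]
    exact h.modulus_lt
  obtain ⟨r, hr⟩ : ∃ r, numCells (G.maxDegree + 1) - t = r := ⟨_, rfl⟩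
  induction r using Nat.strong_induction_on generalizing t st with
  | _ r ih =>
    obtain ⟨st₁, h1, h2, h3⟩ := h.run_refine hs
    rcases h3 with h3 | h3
    · have hq' : 2 ≤ splitting n st₁.col := by rwa [h2]
      have ht' : t + 1 < numCells (G.maxDegree + 1) := by
        rw [← h3.deg_eq]
        refine (Nat.lt_pow_self hq').trans ?_
        rw [← h3.modulus_eq]
        exact h3.modulus_lt
      obtain ⟨t', st', h4, h5, h6, h7⟩ := ih _ (by omega) h3 hq' ht' rfl
      refine ⟨t', st', by omega, ?_, h6.trans h2, h7⟩
      rw [show 14 * (t' - t) = 14 + 14 * (t' - (t + 1)) by omega]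
      exact h1.trans h5
    · exact ⟨t + 1, st₁, by omega, by simpa using h1, h2, h3⟩

theorem Starting.two_le_splitting (h : Starting b G L st) : 2 ≤ splitting n st.col := by
  have h1 : 0 < (activeList st.col).length := by
    refine Nat.pos_of_ne_zero fun h0 => ?_
    have := h.lt_active
    rw [h0] at this
    omega
  exact Nat.succ_le_succ (Nat.div_pos (length_activeList_le h.length_col) h1)

/-- An epoch colors at least a quarter of the active vertices. -/
theorem Starting.run_epoch (hs : Setting b G L σ) (h : Starting b G L st) :
    ∃ t st', Run b σ (14 * t + 1) st st' ∧
      splitting n st.col ^ (t - 1) < numCells (G.maxDegree + 1) ∧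
      4 * (activeList st'.col).length ≤ 3 * (activeList st.col).length ∧
      (Finishing b G L st' ∨ Starting b G L st') := by
  obtain ⟨t, st₁, -, h1, h2, h3⟩ := h.toCounting.run_stages hs h.two_le_splitting
  have hq : 2 ≤ splitting n st₁.col := by
    rw [h2]
    exact h.two_le_splitting
  obtain ⟨h4, h5⟩ := h3.commit hs hq
  obtain ⟨h6, h7⟩ := startEpoch_spec hs h4
  have hpass : pass b σ st₁ = startEpoch n (ListColoring.commit n (readTokens n b st₁ σ)) := by
    have := (readTokens_phase_digits (b := b) (σ := σ) (by rw [h3.phase_eq]; norm_num) h3.acc_eq).1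
    simp [pass, endPass, this, h3.phase_eq]
  have hn := hs.hn
  refine ⟨t, pass b σ st₁, ?_, ?_, ?_, ?_⟩
  · refine Run.trans (by simpa using h1) (Run.single (fits_counters hs.hσ hs.hb hs.hn hs.hm
      h3.bounded (by rw [h3.phase_eq]; norm_num) (by omega) h3.acc_eq)
      (by rw [h3.phase_eq]; norm_num))
  · rw [← h2, ← h3.deg_eq]
    exact h3.pow_lt
  · rw [hpass, h6, ← h2]
    exact h5
  · rw [hpass]
    exact h7

/-! ### The first passes -/

theorem foldr_max_degrees (f : ℕ → ℕ) (hf : ∀ x : Fin n, f x = G.degree x) :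
    ((List.range n).map f).foldr max 0 = G.maxDegree := by
  have key : ∀ (l : List ℕ) (k : ℕ), l.foldr max 0 ≤ k ↔ ∀ a ∈ l, a ≤ k := by
    intro l k
    induction l with
    | nil => simp
    | cons a l ih => simp [ih]
  refine le_antisymm ?_ ?_
  · rw [key]
    intro a ha
    obtain ⟨x, hx, rfl⟩ := List.mem_map.1 ha
    have := hf ⟨x, List.mem_range.1 hx⟩
    simp only at this
    rw [this]
    exact G.degree_le_maxDegree _
  · refine G.maxDegree_le_of_forall_degree_le _ fun x => ?_
    refine (key _ _).1 le_rfl _ ?_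
    rw [← hf x]
    exact List.mem_map.2 ⟨x, List.mem_range.2 x.2, rfl⟩

/-- The total number of collisions in the lists. -/
def totalCollisions (b : ℕ) (L : Fin n → Finset (Fin m)) (D s : ℕ) : ℕ :=
  ∑ x, collisions b D s (truncated D (L x))

/-- The state of the search for the seed of the cells, when `d` digits are known. -/
structure CellSearching (b : ℕ) (G : SimpleGraph (Fin n)) [DecidableRel G.Adj]
    (L : Fin n → Finset (Fin m)) (d : ℕ) (st : Memory) : Prop where
  bounded : Bounded n b st
  deg_eq : st.deg = G.maxDegree + 1
  phase_eq : st.phase = 1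
  digits_eq : st.digits = d
  acc_eq : st.acc = List.replicate b 0
  good : GoodPrefix b (totalCollisions b L st.deg) d st.seed

theorem run_degrees (hs : Setting b G L σ) :
    Run b σ 1 (initial n) (pass b σ (initial n)) ∧
      CellSearching b G L 0 (pass b σ (initial n)) := by
  have hb := hs.hb
  have hn := hs.hn
  have hbd : Bounded n b (initial n) := by
    constructor <;> simp [initial]
    all_goals positivity
  refine ⟨Run.single (fits_counters hs.hσ hb hn hs.hm hbd (by simp [initial])
    (show n ≤ 4 * b by omega) rfl) (by simp [initial]), ?_⟩
  have hsum : ∀ x : Fin n,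
      (σ.map fun t => increment n b (initial n) t x).sum = G.degree x := by
    intro x
    rw [sum_increment hs.hσ, edgeSum_incident x (fun _ => 1)]
    · simp [listIncrement, initial]
    · intro u v
      simp [edgeIncrement, initial, Fin.val_inj]
  have hpass : pass b σ (initial n) = startSearch b 1 { initial n with
      deg := G.maxDegree + 1
      acc := (List.range n).map fun i =>
        (σ.map fun t => increment n b (initial n) t i).sum } := by
    rw [pass, readTokens_counters (k := n) (by simp [initial]) rfl]
    simp only [endPass, initial, if_true]
    have := foldr_max_degrees (G := G)
      (fun i => (σ.map fun t => increment n b (initial n) t i).sum) hsum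
    simp only [initial] at this
    rw [this]
  rw [hpass]
  refine ⟨⟨by norm_num [startSearch], hs.maxDegree_lt, hbd.3, hbd.4, ?_, ?_, hbd.7, hbd.8, hbd.9,
    hbd.10, hbd.11, hbd.12⟩, rfl, rfl, rfl, rfl, goodPrefix_zero _ _⟩
  · exact hbd.5
  · exact hbd.6

theorem sum_increment_phase_one (hσ : IsInputStream G L σ) (h1 : st.phase = 1) (i : ℕ) :
    (σ.map fun t => increment n b st t i).sum =
      blockSum b st.seed st.digits i (totalCollisions b L st.deg) := by
  rw [sum_increment hσ]
  have h2 : edgeSum G (fun u v => edgeIncrement n b st u v i) = 0 := by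
    rw [← edgeSum_zero (G := G)]
    refine edgeSum_congr fun u v _ _ => ?_
    simp [edgeIncrement, h1]
  rw [h2, zero_add]
  unfold blockSum totalCollisions
  rw [sum_comm]
  refine sum_congr rfl fun x _ => ?_
  simp [listIncrement, h1, blockSum]

theorem CellSearching.nextDigit {d : ℕ} (hs : Setting b G L σ) (hd : d ≤ 12)
    (h : CellSearching b G L d st) :
    CellSearching b G L (d + 1) (nextDigit b (readTokens n b st σ)) := by
  have hb0 : 0 < b := by have := hs.hb; omega
  have hread := readTokens_counters (b := b) (by rw [h.phase_eq]; norm_num) h.acc_eq σ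
  simp only [sum_increment_phase_one hs.hσ h.phase_eq, h.digits_eq] at hread
  rw [hread]
  have hgood := h.good.succ hb0 hd
  have hbd := h.bounded
  exact ⟨⟨hbd.1, hbd.2, hbd.3, hbd.4, hgood.1.trans_le (Nat.pow_le_pow_right hb0 (by omega)),
    Nat.succ_le_succ hd, hbd.7, hbd.8, hbd.9, hbd.10, hbd.11, hbd.12⟩,
    h.deg_eq, h.phase_eq, rfl, rfl, hgood⟩

theorem CellSearching.single {d : ℕ} (hs : Setting b G L σ) (h : CellSearching b G L d st) :
    Run b σ 1 st (pass b σ st) := by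
  have := hs.hb
  exact Run.single (fits_counters hs.hσ hs.hb hs.hn hs.hm h.bounded
    (by rw [h.phase_eq]; norm_num) (by omega) h.acc_eq) (by rw [h.phase_eq]; norm_num)

theorem CellSearching.run {d : ℕ} (hs : Setting b G L σ) (hd : d ≤ 12)
    (h : CellSearching b G L 0 st) :
    ∃ st', Run b σ d st st' ∧ CellSearching b G L d st' := by
  induction d with
  | zero => exact ⟨st, Run.refl _ _ _, h⟩
  | succ d ih =>
    obtain ⟨st', h1, h2⟩ := ih (by omega)
    obtain ⟨e1, e2, -⟩ := readTokens_phase_digits (n := n) (b := b) (σ := σ)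
      (by rw [h2.phase_eq]; norm_num) h2.acc_eq
    have hpass : pass b σ st' = ListColoring.nextDigit b (readTokens n b st' σ) := by
      have : ¬ d = 12 := by omega
      simp [pass, endPass, e1, e2, h2.phase_eq, h2.digits_eq, this]
    refine ⟨_, h1.trans (h2.single hs), ?_⟩
    rw [hpass]
    exact h2.nextDigit hs (by omega)

/-- The state before the vertices with collisions are determined. -/
structure Separating (b : ℕ) (G : SimpleGraph (Fin n)) [DecidableRel G.Adj]
    (L : Fin n → Finset (Fin m)) (st : Memory) : Prop where
  bounded : Bounded n b st
  deg_eq : st.deg = G.maxDegree + 1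
  phase_eq : st.phase = 2
  acc_eq : st.acc = List.replicate n 0
  collisions_le : totalCollisions b L st.deg st.cellSeed * st.deg ≤ n

theorem run_cellSeed (hs : Setting b G L σ) :
    ∃ st, Run b σ 14 (initial n) st ∧ Separating b G L st := by
  obtain ⟨h0, h1⟩ := run_degrees hs
  obtain ⟨st', h2, h3⟩ := h1.run hs le_rfl
  obtain ⟨e1, e2, -⟩ := readTokens_phase_digits (n := n) (b := b) (σ := σ)
    (by rw [h3.phase_eq]; norm_num) h3.acc_eq
  have hpass : pass b σ st' = { nextDigit b (readTokens n b st' σ) with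
      phase := 2
      cellSeed := (nextDigit b (readTokens n b st' σ)).seed
      acc := List.replicate n 0 } := by
    simp [pass, endPass, e1, e2, h3.phase_eq, h3.digits_eq]
  have h4 := h3.nextDigit hs le_rfl
  have hbd := h4.bounded
  refine ⟨pass b σ st', (h0.trans h2).trans (h3.single hs), ?_⟩
  rw [hpass]
  refine ⟨⟨by norm_num, hbd.2, hbd.5, hbd.4, hbd.5, hbd.6, hbd.7, hbd.8, hbd.9, hbd.10, hbd.11,
    hbd.12⟩, h4.deg_eq, rfl, rfl, ?_⟩
  set D := (nextDigit b (readTokens n b st' σ)).deg with hD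
  have hb := hs.hb
  have h5 : ∀ x, (∑ s ∈ range (b ^ 13), collisions b D s (truncated D (L x))) * D ≤ b ^ 13 := by
    intro x
    refine average_collisions_le hb (by rw [hD, h4.deg_eq]; omega) hbd.deg
      (length_truncated_le _ _) fun k hk => ?_
    exact (lt_of_mem_truncated hk).trans_le
      (hs.hm.trans (Nat.pow_le_pow_right (by omega) (by norm_num)))
  have h6 : (∑ s ∈ range (b ^ 13), totalCollisions b L D s) * D ≤ n * b ^ 13 := by
    unfold totalCollisions
    rw [sum_comm, sum_mul]
    refine (sum_le_card_nsmul _ _ _ fun x _ => h5 x).trans ?_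
    simp
  have h7 := h4.good.cost_le
  have h8 : totalCollisions b L D (nextDigit b (readTokens n b st' σ)).seed * D * b ^ 13 ≤
      n * b ^ 13 := by
    refine le_trans ?_ ((Nat.mul_le_mul_right D h7).trans h6)
    rw [mul_right_comm]
  exact Nat.le_of_mul_le_mul_right h8 (by positivity)

theorem eq_of_collisions_eq_zero {D gs : ℕ} {l : List ℕ} (h : collisions b D gs l = 0)
    {k k' : ℕ} (hk : k ∈ l) (hk' : k' ∈ l) (heq : cell b D gs k = cell b D gs k') : k = k' := by
  by_contra hne
  have h1 := List.sum_eq_zero_iff.1 h _ (List.mem_map.2 ⟨k, hk, rfl⟩)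
  have h2 := List.sum_eq_zero_iff.1 h1 _ (List.mem_map.2 ⟨k', hk', rfl⟩)
  rw [if_pos ⟨hne, heq⟩] at h2
  exact one_ne_zero h2

/-- The passes before the first epoch. -/
theorem run_first (hs : Setting b G L σ) :
    ∃ st, Run b σ 15 (initial n) st ∧ (Finishing b G L st ∨ Starting b G L st) := by
  obtain ⟨st, h0, h⟩ := run_cellSeed hs
  have hb := hs.hb
  have hn := hs.hn
  set acc := (List.range n).map fun i => (σ.map fun t => increment n b st t i).sum with hacc
  set st' : Memory := { st with acc := acc, col := acc.map fun k => if k = 0 then 1 else 0 }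
    with hst'
  have hpass : pass b σ st = startEpoch n st' := by
    rw [pass, readTokens_counters (by rw [h.phase_eq]; norm_num) h.acc_eq]
    simp [endPass, h.phase_eq, hst', hacc]
  have hcoll : ∀ x : Fin n, (σ.map fun t => increment n b st t x).sum =
      collisions b st.deg st.cellSeed (truncated st.deg (L x)) := by
    intro x
    rw [sum_increment hs.hσ]
    have h1 : edgeSum G (fun u v => edgeIncrement n b st u v x) = 0 := by
      rw [← edgeSum_zero (G := G)]
      refine edgeSum_congr fun u v _ _ => ?_
      simp [edgeIncrement, h.phase_eq]
    rw [h1, zero_add, sum_eq_single x]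
    · simp [listIncrement, h.phase_eq]
    · intro y _ hy
      have : (x : ℕ) ≠ y := fun h => hy (Fin.val_injective h.symm)
      simp [listIncrement, h.phase_eq, this]
    · simp
  have hcol : ∀ x : Fin n, st'.col.getD x 0 =
      if collisions b st.deg st.cellSeed (truncated st.deg (L x)) = 0 then 1 else 0 := by
    intro x
    rw [← hcoll x]
    have : st'.col = (List.range n).map fun i =>
        if (σ.map fun t => increment n b st t i).sum = 0 then 1 else 0 := by
      simp [hst', hacc]
    rw [this, getD_map_range _ x.2]
  have hle : ∀ x : Fin n, st'.col.getD x 0 ≤ 1 := by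
    intro x
    rw [hcol]
    split_ifs <;> simp
  have hbd := h.bounded
  have hc : Colored b G L st' := by
    refine ⟨⟨hbd.1, hbd.2, hbd.3, hbd.4, hbd.5, hbd.6, by simp [hst', hacc], ?_, hbd.9, hbd.10,
      hbd.11, hbd.12⟩, h.deg_eq, by simp [hst', hacc], ?_, ?_, ?_, ?_⟩
    · intro a ha
      obtain ⟨k, -, rfl⟩ := List.mem_map.1 ha
      have : 1 ≤ b ^ 4 := Nat.one_le_pow _ _ (by omega)
      split_ifs
      · exact this
      · exact Nat.zero_le _
    · intro x k hk
      have := hle x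
      omega
    · intro x y _ hx
      have := hle x
      omega
    · intro x hx k hk k' hk' heq
      rw [hcol] at hx
      refine eq_of_collisions_eq_zero ?_ hk hk' heq
      by_contra hne
      have hne' : ¬ collisions b st.deg st.cellSeed (truncated st.deg (L x)) = 0 := hne
      rw [if_neg hne'] at hx
      exact zero_ne_one hx
    · refine le_trans (Nat.mul_le_mul_right _ ?_) h.collisions_le
      rw [card_filter, totalCollisions]
      refine sum_le_sum fun x _ => ?_
      rw [hcol]
      split_ifs
      all_goals first | contradiction | omega
  obtain ⟨-, h1⟩ := startEpoch_spec hs hc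
  refine ⟨pass b σ st, h0.trans (Run.single (fits_counters hs.hσ hb hn hs.hm h.bounded
    (by rw [h.phase_eq]; norm_num) (by omega) h.acc_eq) (by rw [h.phase_eq]; norm_num)), ?_⟩
  rw [hpass]
  exact h1

/-! ### The last pass -/

theorem edgeItem_injective {u v u' v' : ℕ} (h : edgeItem u v = edgeItem u' v') :
    u = u' ∧ v = v' :=
  Nat.pair_eq_pair.1 (Nat.eq_of_mul_eq_mul_left (by norm_num) h)

theorem colorItem_injective {x k x' k' : ℕ} (h : colorItem x k = colorItem x' k') :
    x = x' ∧ k = k' :=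
  Nat.pair_eq_pair.1 (Nat.eq_of_mul_eq_mul_left (by norm_num : 0 < 2) (Nat.succ_injective h))

theorem edgeItem_ne_colorItem (u v x k : ℕ) : edgeItem u v ≠ colorItem x k := by
  unfold edgeItem colorItem
  omega

theorem edgeItem_mem_itemsOf {t : StreamToken n m} {u v : ℕ}
    (h : edgeItem u v ∈ itemsOf st t) :
    ∃ e : Sym2 (Fin n), t = .edge e ∧ (e.inf : Fin n) = u ∧ (e.sup : Fin n) = v := by
  cases t with
  | edge e =>
    simp only [itemsOf] at h
    split_ifs at h
    · obtain ⟨h1, h2⟩ := edgeItem_injective (List.mem_singleton.1 h)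
      exact ⟨e, rfl, h1.symm, h2.symm⟩
    · simp at h
  | list x S =>
    simp only [itemsOf] at h
    split_ifs at h
    · obtain ⟨k, -, hk⟩ := List.mem_map.1 h
      exact absurd hk.symm (edgeItem_ne_colorItem _ _ _ _)
    · simp at h

theorem colorItem_mem_itemsOf {t : StreamToken n m} {x k : ℕ}
    (h : colorItem x k ∈ itemsOf st t) :
    ∃ y S, t = .list y S ∧ (y : ℕ) = x ∧ k ∈ truncated st.deg S := by
  cases t with
  | edge e =>
    simp only [itemsOf] at h
    split_ifs at h
    · exact absurd (List.mem_singleton.1 h).symm (edgeItem_ne_colorItem _ _ _ _)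
    · simp at h
  | list y S =>
    simp only [itemsOf] at h
    split_ifs at h
    · obtain ⟨k', hk', hk⟩ := List.mem_map.1 h
      obtain ⟨h1, h2⟩ := colorItem_injective hk
      exact ⟨y, S, rfl, h1, h2 ▸ hk'⟩
    · simp at h

omit [DecidableRel G.Adj] in
theorem colorItem_mem_iff (hσ : IsInputStream G L σ) {x : Fin n} (hx : st.col.getD x 0 < 2)
    {k : ℕ} : colorItem x k ∈ σ.flatMap (itemsOf st) ↔ k ∈ truncated st.deg (L x) := by
  rw [List.mem_flatMap]
  constructor
  · rintro ⟨t, ht, h⟩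
    obtain ⟨y, S, rfl, hy, hk⟩ := colorItem_mem_itemsOf h
    obtain rfl := Fin.val_injective hy
    have hS : S = L y := (hσ.2 _).1 ht
    rwa [← hS]
  · intro h
    refine ⟨.list x (L x), (hσ.2 _).2 rfl, ?_⟩
    simp only [itemsOf, if_pos hx]
    exact List.mem_map.2 ⟨k, h, rfl⟩

omit [DecidableRel G.Adj] in
theorem edgeItem_mem_iff (hσ : IsInputStream G L σ) {x : Fin n} (hx : st.col.getD x 0 < 2)
    {y : Fin n} : (edgeItem x y ∈ σ.flatMap (itemsOf st) ∨ edgeItem y x ∈ σ.flatMap (itemsOf st)) ↔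
      G.Adj x y := by
  have key : ∀ u v : Fin n, edgeItem u v ∈ σ.flatMap (itemsOf st) → G.Adj u v := by
    intro u v h
    obtain ⟨t, ht, h⟩ := List.mem_flatMap.1 h
    obtain ⟨e, rfl, h1, h2⟩ := edgeItem_mem_itemsOf h
    have he : e ∈ G.edgeSet := (hσ.2 _).1 ht
    induction e using Sym2.ind with
    | _ a d =>
      simp only [Sym2.inf_mk, Sym2.sup_mk, Fin.val_inj] at h1 h2
      rcases le_total a d with hle | hle
      · rw [inf_eq_left.2 hle] at h1
        rw [sup_eq_right.2 hle] at h2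
        exact h1 ▸ h2 ▸ he
      · rw [inf_eq_right.2 hle] at h1
        rw [sup_eq_left.2 hle] at h2
        exact h1 ▸ h2 ▸ ((SimpleGraph.mem_edgeSet G).1 he).symm
  constructor
  · rintro (h | h)
    · exact key x y h
    · exact (key y x h).symm
  · intro h
    have hmem : StreamToken.edge s(x, y) ∈ σ := (hσ.2 _).2 h
    rcases le_total x y with hle | hle
    · refine Or.inl (List.mem_flatMap.2 ⟨_, hmem, ?_⟩)
      simp only [itemsOf, Sym2.inf_mk, Sym2.sup_mk, inf_eq_left.2 hle, sup_eq_right.2 hle,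
        hx, true_or, if_true, List.mem_singleton]
    · refine Or.inr (List.mem_flatMap.2 ⟨_, hmem, ?_⟩)
      simp only [itemsOf, Sym2.inf_mk, Sym2.sup_mk, inf_eq_right.2 hle, sup_eq_left.2 hle,
        hx, or_true, if_true, List.mem_singleton]

theorem lt_of_mem_itemsOf (hs : Setting b G L σ) {t : StreamToken n m} {a : ℕ}
    (h : a ∈ itemsOf st t) : a < b ^ 20 := by
  have hb := hs.hb
  have key : ∀ i j, i < b ^ 3 → j < b ^ 3 → 2 * Nat.pair i j + 1 < b ^ 20 := by
    intro i j hi hj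
    have h1 := Nat.pair_lt_max_add_one_sq i j
    have h2 : max i j + 1 ≤ b ^ 3 := max_lt hi hj
    have h3 : Nat.pair i j < b ^ 6 := h1.trans_le ((Nat.pow_le_pow_left h2 2).trans
      (le_of_eq (by ring)))
    calc 2 * Nat.pair i j + 1 < 2 * b ^ 6 := by omega
      _ ≤ b * b ^ 6 := Nat.mul_le_mul_right _ (by omega)
      _ = b ^ 7 := by ring
      _ ≤ b ^ 20 := Nat.pow_le_pow_right (by omega) (by norm_num)
  have hn : n ≤ b ^ 3 := hs.hn.le.trans (Nat.le_self_pow (by norm_num) b)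
  cases t with
  | edge e =>
    simp only [itemsOf] at h
    split_ifs at h
    · rw [List.mem_singleton.1 h, edgeItem]
      have := key (e.inf : Fin n) (e.sup : Fin n) ((e.inf).2.trans_le hn) ((e.sup).2.trans_le hn)
      omega
    · simp at h
  | list x S =>
    simp only [itemsOf] at h
    split_ifs at h
    · obtain ⟨k, hk, rfl⟩ := List.mem_map.1 h
      exact key x k (x.2.trans_le hn) ((lt_of_mem_truncated hk).trans_le hs.hm)
    · simp at h

/-- In the last pass at most `4 * n` items are stored: at most `2 * (G.maxDegree + 1)` of them for
each of the at most `2 * n / (G.maxDegree + 1)` uncolored vertices. -/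
theorem Finishing.length_items_le (hs : Setting b G L σ) (h : Finishing b G L st) :
    (σ.flatMap (itemsOf st)).length ≤ 4 * n := by
  have hU : #{x : Fin n | st.col.getD x 0 < 2} * st.deg ≤ 2 * n := by
    have h1 : #{x : Fin n | st.col.getD x 0 < 2} ≤
        #{x : Fin n | st.col.getD x 0 = 0} + #{x : Fin n | st.col.getD x 0 = 1} := by
      refine le_trans (card_le_card fun x hx => ?_) (card_union_le _ _)
      simp only [mem_filter, mem_univ, true_and, mem_union] at hx ⊢
      omega
    rw [← length_activeList h.length_col] at h1
    have h2 := h.aside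
    have h3 := h.active_le
    calc _ ≤ (#{x : Fin n | st.col.getD x 0 = 0} + (activeList st.col).length) * st.deg :=
          Nat.mul_le_mul_right _ h1
      _ ≤ 2 * n := by rw [add_mul]; omega
  rw [List.length_flatMap, sum_stream hs.hσ]
  have h1 : (∑ u : Fin n, ∑ v : Fin n, if G.Adj u v ∧ u < v then
      (itemsOf st (.edge s(u, v) : StreamToken n m)).length else 0) ≤
      #{x : Fin n | st.col.getD x 0 < 2} * st.deg := by
    have h2 : (∑ u : Fin n, ∑ v : Fin n, if G.Adj u v ∧ u < v then
        (itemsOf st (.edge s(u, v) : StreamToken n m)).length else 0) ≤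
        edgeSum G fun u v => (if st.col.getD u 0 < 2 then 1 else 0) +
          if st.col.getD v 0 < 2 then 1 else 0 := by
      refine sum_le_sum fun u _ => sum_le_sum fun v _ => ?_
      by_cases huv : G.Adj u v ∧ u < v
      · rw [if_pos huv, if_pos huv]
        simp only [itemsOf, Sym2.inf_mk, Sym2.sup_mk, inf_eq_left.2 huv.2.le,
          sup_eq_right.2 huv.2.le]
        by_cases hu : st.col.getD u 0 < 2
        · rw [if_pos (Or.inl hu), if_pos hu]
          exact Nat.le_add_right _ _
        · by_cases hv : st.col.getD v 0 < 2
          · rw [if_pos (Or.inr hv), if_pos hv]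
            exact Nat.le_add_left _ _
          · rw [if_neg (by tauto)]
            exact Nat.zero_le _
      · rw [if_neg huv, if_neg huv]
    refine h2.trans ?_
    rw [edgeSum_add (fun u _ => if st.col.getD u 0 < 2 then 1 else 0) _ fun u v => rfl,
      card_filter, sum_mul]
    refine sum_le_sum fun u _ => ?_
    rw [← sum_filter, ← SimpleGraph.neighborFinset_eq_filter, sum_const, smul_eq_mul, mul_comm,
      SimpleGraph.card_neighborFinset_eq_degree]
    refine Nat.mul_le_mul_left _ ?_
    rw [h.deg_eq]
    exact (G.degree_le_maxDegree u).trans (Nat.le_succ _)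
  have h2 : ∑ x, (itemsOf st (.list x (L x))).length ≤
      #{x : Fin n | st.col.getD x 0 < 2} * st.deg := by
    rw [card_filter, sum_mul]
    refine sum_le_sum fun x _ => ?_
    by_cases hx : st.col.getD x 0 < 2
    · simp only [itemsOf, if_pos hx, List.length_map, one_mul]
      exact length_truncated_le _ _
    · simp only [itemsOf, if_neg hx, List.length_nil, zero_mul, le_refl]
  omega

theorem Finishing.fits (hs : Setting b G L σ) (h : Finishing b G L st) : Fits b σ st := by
  intro τ hτ
  rw [readTokens_items h.phase_eq, h.acc_eq, List.nil_append]
  have hn := hs.hn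
  have hbd := h.bounded
  have h1 : (τ.flatMap (itemsOf st)).length ≤ 4 * n := by
    obtain ⟨ρ, rfl⟩ := hτ
    have := h.length_items_le hs
    rw [List.flatMap_append, List.length_append] at this
    omega
  have hst' : Bounded n b { st with acc := τ.flatMap (itemsOf st) } :=
    ⟨hbd.1, hbd.2, hbd.3, hbd.4, hbd.5, hbd.6, hbd.7, hbd.8, hbd.9, hbd.10, hbd.11, hbd.12⟩
  refine hst'.length_encode_le hs.hb hn.le (show (τ.flatMap (itemsOf st)).length ≤ 4 * b by omega)
    fun a ha => ?_
  obtain ⟨t, -, ha'⟩ := List.mem_flatMap.1 ha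
  exact lt_of_mem_itemsOf hs ha'

/-- The colors from the list of an uncolored vertex are more than its neighbors, hence one is
free. -/
theorem exists_free_color (hs : Setting b G L σ) (x : Fin n) (col : List ℕ) :
    ∃ k ∈ truncated (G.maxDegree + 1) (L x), ∀ y, G.Adj x y → col.getD y 0 ≠ k + 2 := by
  by_contra hne
  push Not at hne
  have h1 : (truncated (G.maxDegree + 1) (L x)).toFinset ⊆
      (G.neighborFinset x).image fun y : Fin n => col.getD y 0 - 2 := by
    intro k hk
    obtain ⟨y, hy, hyk⟩ := hne k (List.mem_toFinset.1 hk)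
    exact mem_image.2 ⟨y, by simpa using hy, by rw [hyk, Nat.add_sub_cancel]⟩
  have h2 := (card_le_card h1).trans card_image_le
  rw [List.toFinset_card_of_nodup (nodup_truncated _ _),
    SimpleGraph.card_neighborFinset_eq_degree] at h2
  have := degree_lt_length_truncated hs x
  omega

theorem getD_set {l : List ℕ} {i j a : ℕ} (hi : i < l.length) :
    (l.set i a).getD j 0 = if i = j then a else l.getD j 0 := by
  by_cases h : i = j
  · subst h
    simp [List.getD, hi]
  · simp [List.getD, h]

/-- The greedy algorithm turns a partial list coloring into a total one. -/
theorem Finishing.greedy_spec (hs : Setting b G L σ) (h : Finishing b G L st) :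
    let col := greedy n m (σ.flatMap (itemsOf st)) st.col
    col.length = n ∧ (∀ x : Fin n, ∃ k ∈ truncated st.deg (L x), col.getD x 0 = k + 2) ∧
      ∀ x y : Fin n, G.Adj x y → col.getD x 0 ≠ col.getD y 0 := by
  set items := σ.flatMap (itemsOf st) with hitems
  set step : List ℕ → ℕ → List ℕ := fun col x =>
    if col.getD x 0 < 2 then col.set x (greedyColor n m items col x + 2) else col with hstep
  have key : ∀ i ≤ n, ((List.range i).foldl step st.col).length = n ∧
      (∀ x : Fin n, x < i → 2 ≤ ((List.range i).foldl step st.col).getD x 0) ∧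
      (∀ x : Fin n, i ≤ x → ((List.range i).foldl step st.col).getD x 0 = st.col.getD x 0) ∧
      (∀ (x : Fin n) (k : ℕ), ((List.range i).foldl step st.col).getD x 0 = k + 2 →
        k ∈ truncated st.deg (L x)) ∧
      ∀ x y : Fin n, G.Adj x y → 2 ≤ ((List.range i).foldl step st.col).getD x 0 →
        ((List.range i).foldl step st.col).getD x 0 ≠
          ((List.range i).foldl step st.col).getD y 0 := by
    intro i
    induction i with
    | zero =>
      intro _
      exact ⟨h.length_col, fun x hx => absurd hx (Nat.not_lt_zero _), fun _ _ => rfl, h.mem,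
        h.proper⟩
    | succ i ih =>
      intro hi
      obtain ⟨h1, h2, h3, h4, h5⟩ := ih (by omega)
      rw [List.range_succ, List.foldl_append, List.foldl_cons, List.foldl_nil]
      set col := (List.range i).foldl step st.col with hcol
      set z : Fin n := ⟨i, by omega⟩ with hz
      by_cases hcz : col.getD i 0 < 2
      · have hz0 : st.col.getD z 0 < 2 := by
          rw [← h3 z le_rfl]
          exact hcz
        have hgreedy : greedyColor n m items col z ∈ truncated st.deg (L z) ∧
            ∀ y, G.Adj z y → col.getD y 0 ≠ greedyColor n m items col z + 2 := by
          obtain ⟨k, hk, hk'⟩ := exists_free_color hs z col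
          rw [← h.deg_eq] at hk
          have hP : colorItem z k ∈ items ∧ ∀ y < n,
              (edgeItem z y ∈ items ∨ edgeItem y z ∈ items) → ¬ col.getD y 0 = k + 2 :=
            ⟨(colorItem_mem_iff hs.hσ hz0).2 hk, fun y hy hmem =>
              hk' ⟨y, hy⟩ ((edgeItem_mem_iff hs.hσ hz0 (y := ⟨y, hy⟩)).1 hmem)⟩
          have hspec := Nat.findGreatest_spec (P := fun k => colorItem z k ∈ items ∧ ∀ y < n,
            (edgeItem z y ∈ items ∨ edgeItem y z ∈ items) → ¬ col.getD y 0 = k + 2)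
            (lt_of_mem_truncated hk).le hP
          exact ⟨(colorItem_mem_iff hs.hσ hz0).1 hspec.1, fun y hy =>
            hspec.2 y y.2 ((edgeItem_mem_iff hs.hσ hz0).2 hy)⟩
        set g := greedyColor n m items col z with hg
        have hcol' : step col i = col.set i (g + 2) := by
          simp only [hstep]
          rw [if_pos hcz]
        have hget : ∀ x : Fin n, (step col i).getD x 0 =
            if z = x then g + 2 else col.getD x 0 := by
          intro x
          rw [hcol', getD_set (by rw [h1]; omega)]
          simp [hz, Fin.ext_iff]
        refine ⟨by rw [hcol', List.length_set, h1], ?_, ?_, ?_, ?_⟩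
        · intro x hx
          rw [hget]
          split_ifs with hzx
          · omega
          · refine h2 x (lt_of_le_of_ne (Nat.lt_succ_iff.1 hx) fun heq => hzx ?_)
            exact Fin.ext heq.symm
        · intro x hx
          rw [hget, if_neg, h3 x (by omega)]
          rintro rfl
          simp [hz] at hx
        · intro x k hk
          rw [hget] at hk
          split_ifs at hk with hzx
          · obtain rfl : g = k := by omega
            exact hzx ▸ hgreedy.1
          · exact h4 x k hk
        · intro x y hxy hx
          rw [hget] at hx
          rw [hget, hget]
          split_ifs with hzx hzy hzy
          · exact absurd (hzx.symm.trans hzy) hxy.ne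
          · subst hzx
            exact (hgreedy.2 y hxy).symm
          · subst hzy
            exact hgreedy.2 x hxy.symm
          · rw [if_neg hzx] at hx
            exact h5 x y hxy hx
      · have hcol' : step col i = col := by
          simp only [hstep]
          rw [if_neg hcz]
        rw [hcol']
        refine ⟨h1, fun x hx => ?_, fun x hx => h3 x (by omega), h4, h5⟩
        rcases Nat.lt_succ_iff_lt_or_eq.1 hx with hx | hx
        · exact h2 x hx
        · rw [hx]
          omega
  obtain ⟨h1, h2, -, h4, h5⟩ := key n le_rfl
  refine ⟨h1, fun x => ?_, fun x y hxy => h5 x y hxy (h2 x x.2)⟩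
  have := h2 x x.2
  refine ⟨((List.range n).foldl step st.col).getD x 0 - 2, h4 x _ (by omega), ?_⟩
  change ((List.range n).foldl step st.col).getD x 0 = _
  omega

/-- The last pass. -/
theorem Finishing.run (hs : Setting b G L σ) (h : Finishing b G L st) :
    ∃ st', Run b σ 1 st st' ∧ st'.phase = 7 ∧ st'.encode.length ≤ spaceBound b ∧
      ∃ χ : G.Coloring (Fin m), (∀ x, χ x ∈ L x) ∧
        st'.col.map (fun k => k - 2) = List.ofFn fun x => (χ x).val := by
  obtain ⟨h1, h2, h3⟩ := h.greedy_spec hs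
  set items := σ.flatMap (itemsOf st) with hitems
  set col := greedy n m items st.col with hcol
  have hn := hs.hn
  have hb := hs.hb
  have hbd := h.bounded
  have hpass : pass b σ st = { st with phase := 7, col := col, acc := items } := by
    rw [pass, readTokens_items h.phase_eq, h.acc_eq, List.nil_append]
    simp [endPass, h.phase_eq, hcol, hitems]
  have hlt : ∀ x : Fin n, col.getD x 0 - 2 < m := by
    intro x
    obtain ⟨k, hk, hk'⟩ := h2 x
    rw [hk', Nat.add_sub_cancel]
    exact lt_of_mem_truncated hk
  refine ⟨pass b σ st, Run.single (h.fits hs) (by rw [h.phase_eq]; norm_num), ?_, ?_,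
    ⟨fun x => ⟨col.getD x 0 - 2, hlt x⟩, ?_⟩, ?_, ?_⟩
  · rw [hpass]
  · rw [hpass]
    have hst' : Bounded n b { st with phase := 7, col := col, acc := items } := by
      refine ⟨le_rfl, hbd.2, hbd.3, hbd.4, hbd.5, hbd.6, h1.le, ?_, hbd.9, hbd.10, hbd.11,
        hbd.12⟩
      intro a ha
      obtain ⟨x, hx, rfl⟩ := List.getElem_of_mem ha
      have hx : x < col.length := hx
      have hx' : x < n := by rw [← h1]; exact hx
      change col[x] ≤ b ^ 4
      obtain ⟨k, hk, hk'⟩ := h2 ⟨x, hx'⟩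
      have h4 : col.getD x 0 = k + 2 := hk'
      rw [List.getD_eq_getElem _ _ hx] at h4
      have h5 := (lt_of_mem_truncated hk).trans_le hs.hm
      have h6 : 2 ≤ b ^ 3 := Nat.le_trans (by omega) (Nat.le_self_pow (by norm_num : 3 ≠ 0) b)
      calc col[x] ≤ 2 * b ^ 3 := by omega
        _ ≤ b * b ^ 3 := Nat.mul_le_mul_right _ (by omega)
        _ = b ^ 4 := by ring
    have h4 : items.length ≤ 4 * n := h.length_items_le hs
    refine hst'.length_encode_le hb hn.le (show items.length ≤ 4 * b by omega) fun a ha => ?_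
    obtain ⟨t, -, ha'⟩ := List.mem_flatMap.1 ha
    exact lt_of_mem_itemsOf hs ha'
  · intro x y hxy heq
    obtain ⟨k, -, hk⟩ := h2 x
    obtain ⟨k', -, hk'⟩ := h2 y
    have h4 := congrArg Fin.val heq
    simp only at h4
    exact h3 x y hxy (by omega)
  · intro x
    obtain ⟨k, hk, hk'⟩ := h2 x
    refine mem_of_mem_truncated (D := st.deg) ?_
    change col.getD x 0 - 2 ∈ _
    rw [hk', Nat.add_sub_cancel]
    exact hk
  · rw [hpass]
    refine List.ext_getElem (by simpa using h1) fun i hi _ => ?_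
    have hi' : i < col.length := by simpa using hi
    simp only [List.getElem_map, List.getElem_ofFn]
    change _ = col.getD i 0 - 2
    rw [List.getD_eq_getElem _ _ hi']

/-! ### The number of passes -/

/-- If at most `(3 / 4) ^ e * n` vertices are active, then an epoch has
`O(log D / (e + 1))` stages, because the splitting factor is at least `(4 / 3) ^ e` as well as at
least `2`. -/
theorem Starting.stages_le (h : Starting b G L st) {e t : ℕ}
    (he : 4 ^ e * (activeList st.col).length ≤ 3 ^ e * n)
    (ht : splitting n st.col ^ (t - 1) < numCells (G.maxDegree + 1)) :
    (t : ℝ) ≤ 1 + 8 * Real.log (numCells (G.maxDegree + 1)) * ((e : ℝ) + 1)⁻¹ := by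
  set q := splitting n st.col with hq
  have hq2 : 2 ≤ q := h.two_le_splitting
  have hqe : 4 ^ e ≤ 3 ^ e * q := by
    have hU : 0 < (activeList st.col).length := by
      by_contra h0
      have := h.lt_active
      simp [Nat.eq_zero_of_not_pos h0] at this
    have h1 : n ≤ (activeList st.col).length * q := by
      have := Nat.div_add_mod n (activeList st.col).length
      have := Nat.mod_lt n hU
      rw [hq, splitting, Nat.mul_add, Nat.mul_one]
      omega
    refine Nat.le_of_mul_le_mul_right (he.trans ?_) hU
    calc 3 ^ e * n ≤ 3 ^ e * ((activeList st.col).length * q) := Nat.mul_le_mul_left _ h1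
      _ = 3 ^ e * q * (activeList st.col).length := by ring
  have hq2' : (2 : ℝ) ≤ q := by exact_mod_cast hq2
  have hqe' : (4 / 3 : ℝ) ^ e ≤ q := by
    rw [div_pow, div_le_iff₀ (by positivity), mul_comm]
    exact_mod_cast hqe
  have hlog : (1 / 4 : ℝ) ≤ Real.log (4 / 3) := by
    have := Real.one_sub_inv_le_log_of_pos (show (0 : ℝ) < 4 / 3 by norm_num)
    norm_num at this ⊢
    exact this
  -- `q * q` exceeds `(4 / 3) * (4 / 3) ^ e`, which covers the cases `e = 0` and `0 < e` at once.
  have h1 : ((e : ℝ) + 1) * (1 / 4) ≤ 2 * Real.log q := by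
    have h2 : (4 / 3 : ℝ) ^ (e + 1) ≤ (q : ℝ) ^ 2 := by
      rw [pow_succ, pow_two]
      exact mul_le_mul hqe' (by linarith) (by norm_num) (by linarith)
    have h3 := Real.log_le_log (by positivity) h2
    rw [Real.log_pow, Real.log_pow] at h3
    push_cast at h3
    nlinarith [(by positivity : (0 : ℝ) ≤ (e : ℝ) + 1)]
  have h2 : ((t - 1 : ℕ) : ℝ) * Real.log q ≤ Real.log (numCells (G.maxDegree + 1)) := by
    rw [← Real.log_pow]
    refine Real.log_le_log (by positivity) ?_
    exact_mod_cast ht.le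
  have h3 : (t : ℝ) ≤ 1 + ((t - 1 : ℕ) : ℝ) := by exact_mod_cast (by omega : t ≤ 1 + (t - 1))
  have h4 : ((t - 1 : ℕ) : ℝ) ≤
      8 * Real.log (numCells (G.maxDegree + 1)) * ((e : ℝ) + 1)⁻¹ := by
    rw [← div_eq_mul_inv, le_div_iff₀ (by positivity)]
    nlinarith [(by positivity : (0 : ℝ) ≤ ((t - 1 : ℕ) : ℝ))]
  linarith

/-- Since an epoch colors a quarter of the active vertices, epochs end after `E` of them if
`(4 / 3) ^ E` is at least the maximum degree plus one. -/
theorem Starting.run_epochs (hs : Setting b G L σ) {E : ℕ}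
    (hE : 3 ^ E * (G.maxDegree + 1) ≤ 4 ^ E) (r : ℕ) :
    ∀ {e : ℕ} {st : Memory}, e + r = E → Starting b G L st →
      4 ^ e * (activeList st.col).length ≤ 3 ^ e * n →
      ∃ k st', Run b σ k st st' ∧ Finishing b G L st' ∧
        (k : ℝ) ≤ ∑ i ∈ Ico e E,
          (15 + 112 * Real.log (numCells (G.maxDegree + 1)) * ((i : ℝ) + 1)⁻¹) := by
  induction r with
  | zero =>
    intro e st her h he
    rw [Nat.add_zero] at her
    rw [her] at he
    have h1 := h.lt_active
    rw [h.deg_eq] at h1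
    have h2 : 3 ^ E * n < 3 ^ E * n := by
      calc 3 ^ E * n < 3 ^ E * ((activeList st.col).length * (G.maxDegree + 1)) :=
            Nat.mul_lt_mul_of_pos_left h1 (by positivity)
        _ = 3 ^ E * (G.maxDegree + 1) * (activeList st.col).length := by ring
        _ ≤ 4 ^ E * (activeList st.col).length := Nat.mul_le_mul_right _ hE
        _ ≤ 3 ^ E * n := he
    exact absurd h2 (lt_irrefl _)
  | succ r ih =>
    intro e st her h he
    obtain ⟨t, st₁, hrun, ht, hU, h'⟩ := h.run_epoch hs
    have hk : ((14 * t + 1 : ℕ) : ℝ) ≤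
        15 + 112 * Real.log (numCells (G.maxDegree + 1)) * ((e : ℝ) + 1)⁻¹ := by
      have := h.stages_le he ht
      push_cast
      linarith
    have hΛ : 0 ≤ Real.log (numCells (G.maxDegree + 1)) := Real.log_natCast_nonneg _
    rw [sum_eq_sum_Ico_succ_bot (by omega)]
    have hnonneg : 0 ≤ ∑ i ∈ Ico (e + 1) E,
        (15 + 112 * Real.log (numCells (G.maxDegree + 1)) * ((i : ℝ) + 1)⁻¹) :=
      sum_nonneg fun i _ => by positivity
    rcases h' with hf | hst
    · exact ⟨_, st₁, hrun, hf, by linarith⟩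
    · have he' : 4 ^ (e + 1) * (activeList st₁.col).length ≤ 3 ^ (e + 1) * n := by
        calc 4 ^ (e + 1) * (activeList st₁.col).length
            = 4 ^ e * (4 * (activeList st₁.col).length) := by ring
          _ ≤ 4 ^ e * (3 * (activeList st.col).length) := Nat.mul_le_mul_left _ hU
          _ = 3 * (4 ^ e * (activeList st.col).length) := by ring
          _ ≤ 3 * (3 ^ e * n) := Nat.mul_le_mul_left _ he
          _ = 3 ^ (e + 1) * n := by ring
      obtain ⟨k, st', hrun', hf, hk'⟩ := ih (by omega) hst he'
      refine ⟨_, st', hrun.trans hrun', hf, ?_⟩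
      push_cast at hk ⊢
      linarith

theorem sum_inv_le (E : ℕ) : ∑ i ∈ range E, ((i : ℝ) + 1)⁻¹ ≤ 1 + Real.log E := by
  have h := harmonic_le_one_add_log E
  rw [harmonic] at h
  push_cast at h
  exact h

/-- The whole computation up to the last pass. -/
theorem run_finishing (hs : Setting b G L σ) {E : ℕ}
    (hE : 3 ^ E * (G.maxDegree + 1) ≤ 4 ^ E) :
    ∃ k st, Run b σ k (initial n) st ∧ Finishing b G L st ∧
      (k : ℝ) ≤ 15 + 15 * E +
        112 * Real.log (numCells (G.maxDegree + 1)) * (1 + Real.log E) := by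
  have hΛ : 0 ≤ Real.log (numCells (G.maxDegree + 1)) := Real.log_natCast_nonneg _
  have hE0 : 0 ≤ Real.log E := Real.log_natCast_nonneg _
  obtain ⟨st, hrun, h⟩ := run_first hs
  rcases h with hf | hst
  · refine ⟨15, st, hrun, hf, ?_⟩
    have : 0 ≤ 15 * (E : ℝ) +
        112 * Real.log (numCells (G.maxDegree + 1)) * (1 + Real.log E) := by positivity
    push_cast
    linarith
  · have h0 : 4 ^ 0 * (activeList st.col).length ≤ 3 ^ 0 * n := by
      simpa using length_activeList_le hst.length_col
    obtain ⟨k, st', hrun', hf, hk⟩ := Starting.run_epochs hs hE E (Nat.zero_add E) hst h0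
    refine ⟨_, st', hrun.trans hrun', hf, ?_⟩
    rw [Nat.Ico_zero_eq_range, sum_add_distrib, sum_const, card_range, nsmul_eq_mul,
      ← mul_sum] at hk
    have := mul_le_mul_of_nonneg_left (sum_inv_le E) (mul_nonneg (by norm_num : (0 : ℝ) ≤ 112) hΛ)
    push_cast
    linarith

/-- The number of epochs, and the bound for the number of passes, in terms of the maximum
degree. -/
theorem exists_epochs (Δ : ℕ) : ∃ E : ℕ, 3 ^ E * (Δ + 1) ≤ 4 ^ E ∧
    15 + 15 * (E : ℝ) + 112 * Real.log (numCells (Δ + 1)) * (1 + Real.log E) + 1 ≤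
      10000 * (1 + Real.logb 2 Δ * Real.logb 2 (Real.logb 2 Δ)) := by
  set D : ℝ := (Δ : ℝ) + 1 with hD
  have hD1 : (1 : ℝ) ≤ D := by
    have : (0 : ℝ) ≤ Δ := Nat.cast_nonneg _
    linarith
  have hlD : 0 ≤ Real.log D := Real.log_nonneg hD1
  have hE1 := Nat.le_ceil (4 * Real.log D)
  have hE2 := (Nat.ceil_lt_add_one (show 0 ≤ 4 * Real.log D by linarith)).le
  set E := ⌈4 * Real.log D⌉₊ with hE
  have hlog : (1 / 4 : ℝ) ≤ Real.log (4 / 3) := by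
    have := Real.one_sub_inv_le_log_of_pos (show (0 : ℝ) < 4 / 3 by norm_num)
    norm_num at this ⊢
    exact this
  have hlog2 : Real.log 2 ≤ 1 := by linarith [Real.log_two_lt_d9]
  have hlog2' : 0 < Real.log 2 := Real.log_pos (by norm_num)
  have hΛ : Real.log (numCells (Δ + 1)) ≤ 2 + 3 * Real.log D := by
    have h4 : Real.log 4 = 2 * Real.log 2 := by
      rw [show (4 : ℝ) = 2 ^ 2 by norm_num, Real.log_pow]
      norm_num
    rw [numCells]
    push_cast
    rw [Real.log_mul (by norm_num) (by positivity), Real.log_pow, h4, ← hD]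
    push_cast
    linarith
  have hΛ0 : 0 ≤ Real.log (numCells (Δ + 1)) := Real.log_natCast_nonneg _
  have hE0 : 0 ≤ Real.log E := Real.log_natCast_nonneg _
  refine ⟨E, ?_, ?_⟩
  · have h1 : D ≤ (4 / 3 : ℝ) ^ E := by
      rw [← Real.log_le_log_iff (by linarith) (by positivity), Real.log_pow]
      nlinarith [(Nat.cast_nonneg E : (0 : ℝ) ≤ E)]
    rw [div_pow, le_div_iff₀ (by positivity), hD, mul_comm] at h1
    exact_mod_cast h1
  · rcases le_or_gt Δ 3 with hΔ | hΔ
    · have h0 : 0 ≤ Real.logb 2 Δ * Real.logb 2 (Real.logb 2 Δ) := by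
        interval_cases Δ
        · simp
        · simp
        · norm_num
        · have h1 : (1 : ℝ) ≤ Real.logb 2 3 := by
            rw [Real.le_logb_iff_rpow_le (by norm_num) (by norm_num)]
            norm_num
          have h2 : 0 ≤ Real.logb 2 (Real.logb 2 3) := Real.logb_nonneg (by norm_num) h1
          push_cast
          positivity
      have h1 : Real.log D ≤ 3 := by
        have : (Δ : ℝ) ≤ 3 := by exact_mod_cast hΔ
        linarith [Real.log_le_sub_one_of_pos (show 0 < D by linarith)]
      have h2 : (E : ℝ) ≤ 13 := by linarith
      have h3 : Real.log E ≤ 3 := by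
        rcases Nat.eq_zero_or_pos E with h | h
        · rw [h]
          norm_num
        · have h5 : Real.log E ≤ Real.log (2 ^ 4 : ℝ) :=
            Real.log_le_log (by exact_mod_cast h) (by linarith)
          rw [Real.log_pow] at h5
          have := Real.log_two_lt_d9
          push_cast at h5
          linarith
      have h4 : Real.log (numCells (Δ + 1)) * (1 + Real.log E) ≤ 11 * 4 :=
        mul_le_mul (by linarith) (by linarith) (by linarith) (by norm_num)
      linarith
    · have hΔ' : (4 : ℝ) ≤ Δ := by exact_mod_cast hΔ
      set l := Real.logb 2 Δ with hl
      set ll := Real.logb 2 l with hll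
      have hl2 : 2 ≤ l := by
        rw [hl, Real.le_logb_iff_rpow_le (by norm_num) (by linarith)]
        norm_num
        exact hΔ
      have hll1 : 1 ≤ ll := by
        rw [hll, Real.le_logb_iff_rpow_le (by norm_num) (by linarith)]
        norm_num
        exact hl2
      have hlogl : Real.log l ≤ ll := by
        rw [hll, Real.logb, le_div_iff₀ hlog2']
        exact mul_le_of_le_one_right (Real.log_nonneg (by linarith)) hlog2
      have hlD' : Real.log D ≤ 1 + l := by
        have h1 : Real.log D ≤ Real.log (2 * Δ) := Real.log_le_log (by linarith) (by linarith)
        have h2 : Real.log Δ ≤ l := by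
          rw [hl, Real.logb, le_div_iff₀ hlog2']
          exact mul_le_of_le_one_right (Real.log_nonneg (by linarith)) hlog2
        rw [Real.log_mul (by norm_num) (by linarith)] at h1
        linarith
      have h2 : (E : ℝ) ≤ 8 * l := by linarith
      have h3 : Real.log E ≤ 3 + ll := by
        rcases Nat.eq_zero_or_pos E with h | h
        · rw [h, Nat.cast_zero, Real.log_zero]
          linarith
        · have h5 : Real.log E ≤ Real.log (2 ^ 3 * l) :=
            Real.log_le_log (by exact_mod_cast h) (by linarith)
          rw [Real.log_mul (by norm_num) (by linarith), Real.log_pow] at h5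
          push_cast at h5
          linarith
      have h4 : Real.log (numCells (Δ + 1)) * (1 + Real.log E) ≤ (6 * l) * (5 * ll) :=
        mul_le_mul (by linarith) (by linarith) (by linarith) (by linarith)
      have h5 : l * 1 ≤ l * ll := mul_le_mul_of_nonneg_left hll1 (by linarith)
      linarith

theorem spaceBound_le (c n : ℕ) : (spaceBound (base c n) : ℝ) ≤
    (22 * ((c : ℝ) + 101) * (80 * ((c : ℝ) + 101) + 82) + 10) *
      (1 + n * Real.logb 2 n ^ 2) := by
  set B : ℝ := (c : ℝ) + 101 with hB
  have hB1 : (101 : ℝ) ≤ B := by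
    have : (0 : ℝ) ≤ c := Nat.cast_nonneg _
    linarith
  have hb : (base c n : ℝ) = n + B - 1 := by
    rw [base, hB]
    push_cast
    ring
  have hlog : (Nat.log 2 (base c n) : ℝ) ≤ Real.logb 2 (base c n) := Real.natLog_le_logb _ _
  have hlog' : (Nat.log 2 (base c n) : ℝ) ≤ base c n := by
    exact_mod_cast Nat.log_le_self 2 _
  have hw : (0 : ℝ) ≤ Nat.log 2 (base c n) := Nat.cast_nonneg _
  rw [spaceBound]
  push_cast
  generalize (Nat.log 2 (base c n) : ℝ) = w at *
  generalize (base c n : ℝ) = β at *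
  rcases Nat.lt_or_ge n 2 with hn | hn
  · have h1 : (n : ℝ) ≤ 1 := by exact_mod_cast Nat.lt_succ_iff.1 hn
    have h2 : (16 * β + 6) * (2 * (20 * (w + 1)) + 2) ≤ (22 * B) * (80 * B + 82) :=
      mul_le_mul (by linarith) (by linarith) (by linarith) (by linarith)
    have h3 : (0 : ℝ) ≤ n * Real.logb 2 n ^ 2 := by positivity
    have h4 : 0 ≤ 22 * B * (80 * B + 82) + 10 := by positivity
    have h5 := mul_nonneg h4 h3
    linarith
  · have hn' : (2 : ℝ) ≤ n := by exact_mod_cast hn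
    set l := Real.logb 2 n with hl
    have hl1 : 1 ≤ l := by
      rw [hl, Real.le_logb_iff_rpow_le (by norm_num) (by linarith)]
      norm_num
      exact hn
    have h1 : β ≤ B * n := by nlinarith
    have h2 : w ≤ 2 * B + l := by
      have hlogB : Real.logb 2 B ≤ 2 * B := by
        rw [Real.logb, div_le_iff₀ (Real.log_pos (by norm_num))]
        have := Real.log_le_sub_one_of_pos (show 0 < B by linarith)
        nlinarith [Real.log_two_gt_d9]
      refine hlog.trans ((Real.logb_le_logb_of_le (by norm_num) (by linarith) h1).trans ?_)
      rw [Real.logb_mul (by linarith) (by linarith)]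
      linarith
    have h3 : 2 * B * 1 ≤ 2 * B * l := mul_le_mul_of_nonneg_left hl1 (by linarith)
    have h4 : B * 2 ≤ B * n := mul_le_mul_of_nonneg_left hn' (by linarith)
    have h5 : (16 * β + 6) * (2 * (20 * (w + 1)) + 2) ≤ (22 * (B * n)) * ((80 * B + 82) * l) :=
      mul_le_mul (by linarith) (by linarith) (by linarith) (by linarith)
    have h6 : (22 * B * (80 * B + 82) * n) * (l * 1) ≤ (22 * B * (80 * B + 82) * n) * (l * l) :=
      mul_le_mul_of_nonneg_left (mul_le_mul_of_nonneg_left hl1 (by linarith)) (by positivity)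
    have h7 : 0 ≤ (n : ℝ) * (l * l) := by positivity
    have h8 : 0 ≤ 22 * B * (80 * B + 82) := by positivity
    linarith

end ListColoring

theorem theorem2 (c : ℕ) :
    ∃ (A : StreamingAlgorithm) (K : ℝ),
      ∀ (n m : ℕ), m ≤ c * n ^ 2 →
      ∀ (G : SimpleGraph (Fin n)) [DecidableRel G.Adj] (L : Fin n → Finset (Fin m)),
        (∀ x, G.degree x + 1 ≤ (L x).card) →
      ∀ σ : List (StreamToken n m), IsInputStream G L σ →
        ∃ (p : ℕ) (χ : G.Coloring (Fin m)),
          (∀ x, χ x ∈ L x) ∧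
          A.StopsWith σ p (List.ofFn fun x => (χ x).val) ∧
          A.UsesSpaceAtMost σ p (K * (1 + n * (Real.logb 2 n) ^ 2)) ∧
          (p : ℝ) ≤ K * (1 + Real.logb 2 G.maxDegree *
            Real.logb 2 (Real.logb 2 G.maxDegree)) := by
  set K₀ : ℝ := 22 * ((c : ℝ) + 101) * (80 * ((c : ℝ) + 101) + 82) + 10 with hK₀
  have hK₀0 : 0 ≤ K₀ := by positivity
  refine ⟨ListColoring.algorithm c, K₀ + 10000, fun n m hm G _ L hL σ hσ => ?_⟩
  have hs : ListColoring.Setting (ListColoring.base c n) G L σ := by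
    refine ⟨by simp [ListColoring.base], by simp only [ListColoring.base]; omega,
      hm.trans ?_, hL, hσ⟩
    have h1 : c ≤ ListColoring.base c n := by simp only [ListColoring.base]; omega
    have h2 : n ≤ ListColoring.base c n := by simp only [ListColoring.base]; omega
    calc c * n ^ 2 ≤ ListColoring.base c n * ListColoring.base c n ^ 2 :=
          Nat.mul_le_mul h1 (Nat.pow_le_pow_left h2 2)
      _ = ListColoring.base c n ^ 3 := by ring
  obtain ⟨E, hE, hpasses⟩ := ListColoring.exists_epochs G.maxDegree
  obtain ⟨k, st, hrun, hf, hk⟩ := ListColoring.run_finishing hs hE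
  obtain ⟨st', hrun', h7, hfits, χ, hχ, hout⟩ := hf.run hs
  have hrun := hrun.trans hrun'
  refine ⟨k + 1, χ, hχ, ?_, ?_, ?_⟩
  · rw [← hout]
    exact ListColoring.stopsWith_of_run hrun h7
  · refine ListColoring.usesSpaceAtMost_of_run hrun hfits
      ((ListColoring.spaceBound_le c n).trans ?_)
    exact mul_le_mul_of_nonneg_right (by linarith) (by positivity)
  · have h0 : (0 : ℝ) ≤ 1 + Real.logb 2 G.maxDegree * Real.logb 2 (Real.logb 2 G.maxDegree) := by
      have h1 : (0 : ℝ) ≤ 15 + 15 * (E : ℝ) + 112 * Real.log (ListColoring.numCells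
          (G.maxDegree + 1)) * (1 + Real.log E) + 1 := by
        have := Real.log_natCast_nonneg (ListColoring.numCells (G.maxDegree + 1))
        have := Real.log_natCast_nonneg E
        positivity
      linarith
    push_cast
    linarith [mul_nonneg hK₀0 h0]
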